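/- **Setting.** Fix a set of operation symbols. The types of the effect handler calculus $\lambda_{\mathrm{eff}}$ are: value types $A,B ::= A\to C \mid \prod_{i=1}^n A_i$ ($n\ge 0$), computation types $C ::= A!\Sigma$, and signatures $\Sigma$, i.e. finite partial functions sending operation symbols to pairs of value types, written $(\mathtt{op}:A_{\mathtt{op}}\rightarrowtriangle B_{\mathtt{op}})\in\Sigma$. Its simply typed value terms $\Gamma\vdash V:A$, computation terms $\Gamma\vdash M:C$ and handlers $\Gamma\vdash H:\Sigma\Rightarrow C$ (terms being identified with their typing derivations) are $$V,W ::= x\mid\lambda x.M\mid\langle V_1,\dots,V_n\rangle\mid\pi_i V,$$ $$M,N ::= V\,W\mid\mathtt{return}\,V\mid\mathtt{let}\,x=M\,\mathtt{in}\,N\mid\mathtt{op}(V)\mid\mathtt{with}\,H\,\mathtt{handle}\,M\,\mathtt{to}\,x.N,\qquad H=\{\mathtt{op}(x,k)\mapsto M_{\mathtt{op}}\}_{\mathtt{op}\in\Sigma}.$$ Derivable equality is the least typed congruence containing the $\beta\eta$-laws of functions and tuples, the three monad laws for $\mathtt{let}$, and the equations $\mathtt{with}\,H\,\mathtt{handle}\,\mathtt{return}\,V\,\mathtt{to}\,x.M=M[V/x]$;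 $\mathtt{with}\,H\,\mathtt{handle}\,(\mathtt{let}\,x=L\,\mathtt{in}\,M)\,\mathtt{to}\,y.N=\mathtt{with}\,H\,\mathtt{handle}\,L\,\mathtt{to}\,x.(\mathtt{with}\,H\,\mathtt{handle}\,M\,\mathtt{to}\,y.N)$; $\mathtt{with}\,H\,\mathtt{handle}\,\mathtt{op}(V)\,\mathtt{to}\,x.M=M_{\mathtt{op}}[V/x,\lambda x.M/k]$. The relation $\leadsto$ on closed computation terms is the least relation that is closed under evaluation contexts $\mathcal C::=[\,]\mid\mathtt{let}\,x=\mathcal C\,\mathtt{in}\,N\mid\mathtt{with}\,H\,\mathtt{handle}\,\mathcal C\,\mathtt{to}\,x.M$ and contains $\mathtt{let}\,x=\mathtt{return}\,V\,\mathtt{in}\,M\leadsto M[V/x]$, $(\lambda x.M)V\leadsto M[V/x]$, $\mathtt{with}\,H\,\mathtt{handle}\,\mathtt{return}\,V\,\mathtt{to}\,x.M\leadsto M[V/x]$ and, if $\mathcal C$ contains no handle-with, $\mathtt{with}\,H\,\mathtt{handle}\,\mathcal C[\mathtt{op}(V)]\,\mathtt{to}\,x.M\leadsto M_{\mathtt{op}}[V/x,\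 \lambda y.\,\mathtt{with}\,H\,\mathtt{handle}\,\mathcal C[\mathtt{return}\,y]\,\mathtt{to}\,x.M\,/k]$. **CPS transformation.** The target is System F with types $X\mid 1\mid A\times B\mid A\to B\mid\forall X.A$ and typed $\beta\eta$-equality; finite products are iterated binary products. Put $\mathcal H_S[\beta]=\prod_{(\mathtt{op}:A_{\mathtt{op}}\rightarrowtriangle B_{\mathtt{op}})\in S}\big(A_{\mathtt{op}}\times(B_{\mathtt{op}}\to\beta)\to\beta\big)$ and $D_SX=\forall\beta.(X\to\beta)\to\mathcal H_S[\beta]\to\beta$. Let $[\![-]\!]$ be homomorphic on value types and value terms and on application, and put $[\![A!\Sigma]\!]=D_{[\![\Sigma]\!]}[\![A]\!]$, $$[\![\mathtt{return}\,V]\!]=\Lambda\beta.\lambda k.\lambda h.\,k\,[\![V]\!],\qquad [\![\mathtt{let}\,x=M\,\mathtt{in}\,N]\!]=\Lambda\beta.\lambda k.\lambda h.\,[\![M]\!]\,\beta\,(\lambda x.[\![N]\!]\,\beta\,k\,h)\,h,$$ $$[\![\mathtt{op}(V)]\!]=\Lambda\beta.\lambda k.\lambda h.\,\pi_{\mathtt{op}}\,h\,\langle[\![V]\!],k\rangle,\qquad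 [\![\mathtt{with}\,H\,\mathtt{handle}\,M\,\mathtt{to}\,x.N]\!]=[\![M]\!]\,[\![C]\!]\,(\lambda x.[\![N]\!])\,[\![H]\!]\quad(N:C),$$ $$[\![\{\mathtt{op}(x,k)\mapsto M_{\mathtt{op}}\}_{\mathtt{op}\in\Sigma}]\!]=\langle\lambda\langle x,k\rangle.[\![M_{\mathtt{op}}]\!]\rangle_{\mathtt{op}\in\Sigma}.$$ **CPS model.** A $\lambda_{\mathrm{eff}}$-model is a cartesian category with a family of strong monads $T_S$ (given as strong Kleisli triples) indexed by semantic signatures $S$ (finite partial functions from operation symbols to pairs of objects), Kleisli exponentials, morphisms $A_{\mathtt{op}}\to T_SB_{\mathtt{op}}$ for $\mathtt{op}\in S$, and morphisms $\mathbf{handle}_{S,S',X}:\mathcal H_S[X]\times T_ST_{S'}X\to T_{S'}X$, where here $\mathcal H_S[X]$ is the product over $\mathtt{op}\in S$ of the $T_{S'}$-Kleisli exponentials from $A_{\mathtt{op}}\times(B_{\mathtt{op}}\Rightarrow X)$ to $X$; $\mathbf{handle}$ must satisfy the unit and multiplication laws of an Eilenberg–Moore algebra, parametrized by $\mathcal H_S[X]$,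 and the law that handling $\mathtt{op}$ evaluates the $\mathtt{op}$-component of the handler. Every well-typed value term, computation term and handler is interpreted in such a model by induction on typing. The CPS model lives on the category of closed System F types and terms $x:A\vdash t:B$ modulo $\beta\eta$. Its strong monads are the $D_S$, with unit $\Lambda\beta.\lambda k.\lambda h.\,k\,x$ and with strong Kleisli extension sending $x_1:A_1,x_2:A_2\vdash t:D_SB$ to $\Lambda\beta.\lambda k.\lambda h.\,x_2\,\beta\,(\lambda x_2.\,t\,\beta\,k\,h)\,h$; its Kleisli exponentials are $Y\to D_SZ$; operations are $\Lambda\beta.\lambda k.\lambda h.\,\pi_{\mathtt{op}}\,h\,\langle x,k\rangle$; and $\mathbf{handle}_{S,S',A}$ is $h,x\mapsto x\,(D_{S'}A)\,(\lambda y.y)\,h$. **Theorem.** These data form a $\lambda_{\mathrm{eff}}$-model, and the interpretation in it of every value term $\Gamma\vdash V:A$, every computation term $\Gamma\vdash M:A!\Sigma$ and every handler $\Gamma\vdash H:\Sigma\Rightarrow C$ equals the $\beta\eta$-equivalence class of its CPS transform, which is a System F term of type $[\![A]\!]$, $[\![A!\Sigma]\!]$ and $\mathcal H_{[\![\Sigma]\!]}[[\![C]\!]]$,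 respectively, in context $[\![\Gamma]\!]$. (A term in context $x_1:A_1,\dots,x_n:A_n$ is regarded as a morphism out of the product of the $A_i$ by substituting the projections for the variables.) **Corollary.** If $\Gamma\vdash M=N:A!\Sigma$ is derivable in $\lambda_{\mathrm{eff}}$, then $[\![M]\!]$ and $[\![N]\!]$ are $\beta\eta$-equal in System F, and likewise for derivably equal value terms and handlers. In particular, if $M\leadsto N$ for closed well-typed computation terms of the same type, then $[\![M]\!]$ and $[\![N]\!]$ are $\beta\eta$-equal. -/

import Mathlib

universe u v w

open CategoryTheory MonoidalCategory CartesianMonoidalCategory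

namespace SysF

/-! ### Types -/

/-- `Ty m`: the well-formed types `Δ ⊢ A` of System F over a context `Δ` of `m` type variables
(de Bruijn indices, `0` being the innermost variable). -/
inductive Ty : ℕ → Type
  | var {m : ℕ} (i : Fin m) : Ty m
  | unit {m : ℕ} : Ty m
  | prod {m : ℕ} (A B : Ty m) : Ty m
  | arr {m : ℕ} (A B : Ty m) : Ty m
  | all {m : ℕ} (A : Ty (m + 1)) : Ty m

/-- Lifting of a renaming of type variables under a binder. -/
def upR {m n : ℕ} (ξ : Fin m → Fin n) : Fin (m + 1) → Fin (n + 1) :=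
  Fin.cases 0 (fun i => (ξ i).succ)

/-- Renaming of type variables in types. -/
def Ty.ren : {m n : ℕ} → (Fin m → Fin n) → Ty m → Ty n
  | _, _, ξ, .var i => .var (ξ i)
  | _, _, _, .unit => .unit
  | _, _, ξ, .prod A B => .prod (A.ren ξ) (B.ren ξ)
  | _, _, ξ, .arr A B => .arr (A.ren ξ) (B.ren ξ)
  | _, _, ξ, .all A => .all (A.ren (upR ξ))

/-- Weakening of a type by one (innermost) type variable. -/
def Ty.wk {m : ℕ} (A : Ty m) : Ty (m + 1) := A.ren Fin.succ

/-- Lifting of a substitution of types for type variables under a binder. -/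
def upT {m n : ℕ} (θ : Fin m → Ty n) : Fin (m + 1) → Ty (n + 1) :=
  Fin.cases (.var 0) (fun i => (θ i).wk)

/-- Simultaneous substitution of types for type variables in types. -/
def Ty.subst : {m n : ℕ} → (Fin m → Ty n) → Ty m → Ty n
  | _, _, θ, .var i => θ i
  | _, _, _, .unit => .unit
  | _, _, θ, .prod A B => .prod (A.subst θ) (B.subst θ)
  | _, _, θ, .arr A B => .arr (A.subst θ) (B.subst θ)
  | _, _, θ, .all A => .all (A.subst (upT θ))

/-- The substitution `[B / X₀]` of `B` for the innermost type variable. -/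
def instT {m : ℕ} (B : Ty m) : Fin (m + 1) → Ty m := Fin.cases B Ty.var

/-- `A[B / X₀]`. -/
def Ty.inst {m : ℕ} (A : Ty (m + 1)) (B : Ty m) : Ty m := A.subst (instT B)

/-! ### Terms -/

/-- Raw (Church-style) terms over `m` type variables; term variables are de Bruijn indices. -/
inductive Tm : ℕ → Type
  | var {m : ℕ} (i : ℕ) : Tm m
  | star {m : ℕ} : Tm m
  | pair {m : ℕ} (t s : Tm m) : Tm m
  | fst {m : ℕ} (t : Tm m) : Tm m
  | snd {m : ℕ} (t : Tm m) : Tm m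
  | lam {m : ℕ} (A : Ty m) (t : Tm m) : Tm m
  | app {m : ℕ} (t s : Tm m) : Tm m
  | tlam {m : ℕ} (t : Tm (m + 1)) : Tm m
  | tapp {m : ℕ} (t : Tm m) (A : Ty m) : Tm m

/-- Lifting of a renaming of term variables under a binder. -/
def upV (ρ : ℕ → ℕ) : ℕ → ℕ
  | 0 => 0
  | i + 1 => ρ i + 1

/-- Simultaneous renaming of type variables (by `ξ`) and term variables (by `ρ`). -/
def Tm.ren : {m n : ℕ} → (Fin m → Fin n) → (ℕ → ℕ) → Tm m → Tm n
  | _, _, _, ρ, .var i => .var (ρ i)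
  | _, _, _, _, .star => .star
  | _, _, ξ, ρ, .pair t s => .pair (t.ren ξ ρ) (s.ren ξ ρ)
  | _, _, ξ, ρ, .fst t => .fst (t.ren ξ ρ)
  | _, _, ξ, ρ, .snd t => .snd (t.ren ξ ρ)
  | _, _, ξ, ρ, .lam A t => .lam (A.ren ξ) (t.ren ξ (upV ρ))
  | _, _, ξ, ρ, .app t s => .app (t.ren ξ ρ) (s.ren ξ ρ)
  | _, _, ξ, ρ, .tlam t => .tlam (t.ren (upR ξ) ρ)
  | _, _, ξ, ρ, .tapp t A => .tapp (t.ren ξ ρ) (A.ren ξ)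

/-- Weakening by one term variable. -/
def Tm.wk {m : ℕ} (t : Tm m) : Tm m := t.ren id (· + 1)

/-- Weakening by one type variable. -/
def Tm.twk {m : ℕ} (t : Tm m) : Tm (m + 1) := t.ren Fin.succ id

/-- Lifting of a substitution for term variables under a term binder. -/
def upS {m : ℕ} (σ : ℕ → Tm m) : ℕ → Tm m
  | 0 => .var 0
  | i + 1 => (σ i).wk

/-- Simultaneous substitution of types for type variables (`θ`) and terms for term
variables (`σ`). -/
def Tm.subst : {m n : ℕ} → (Fin m → Ty n) → (ℕ → Tm n) → Tm m → Tm n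
  | _, _, _, σ, .var i => σ i
  | _, _, _, _, .star => .star
  | _, _, θ, σ, .pair t s => .pair (t.subst θ σ) (s.subst θ σ)
  | _, _, θ, σ, .fst t => .fst (t.subst θ σ)
  | _, _, θ, σ, .snd t => .snd (t.subst θ σ)
  | _, _, θ, σ, .lam A t => .lam (A.subst θ) (t.subst θ (upS σ))
  | _, _, θ, σ, .app t s => .app (t.subst θ σ) (s.subst θ σ)
  | _, _, θ, σ, .tlam t => .tlam (t.subst (upT θ) (fun i => (σ i).twk))
  | _, _, θ, σ, .tapp t A => .tapp (t.subst θ σ) (A.subst θ)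

/-- The substitution `[s / x₀]`. -/
def instS {m : ℕ} (s : Tm m) : ℕ → Tm m
  | 0 => s
  | i + 1 => .var i

/-- `t[s / x₀]`. -/
def Tm.inst {m : ℕ} (t s : Tm m) : Tm m := t.subst Ty.var (instS s)

/-- `t[B / X₀]`. -/
def Tm.tinst {m : ℕ} (t : Tm (m + 1)) (B : Ty m) : Tm m := t.subst (instT B) Tm.var

/-! ### Typing and `βη`-equality -/

/-- The typing judgement `Δ ∣ Γ ⊢ t : A`; a context `Γ` is the list of the types of the term
variables, the innermost variable first. -/
inductive HasType : {m : ℕ} → List (Ty m) → Tm m → Ty m → Prop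
  | var {m : ℕ} {Γ : List (Ty m)} {i : ℕ} {A : Ty m} : Γ[i]? = some A → HasType Γ (.var i) A
  | star {m : ℕ} {Γ : List (Ty m)} : HasType Γ .star .unit
  | pair {m : ℕ} {Γ : List (Ty m)} {t s : Tm m} {A B : Ty m} :
      HasType Γ t A → HasType Γ s B → HasType Γ (.pair t s) (.prod A B)
  | fst {m : ℕ} {Γ : List (Ty m)} {t : Tm m} {A B : Ty m} :
      HasType Γ t (.prod A B) → HasType Γ (.fst t) A
  | snd {m : ℕ} {Γ : List (Ty m)} {t : Tm m} {A B : Ty m} :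
      HasType Γ t (.prod A B) → HasType Γ (.snd t) B
  | lam {m : ℕ} {Γ : List (Ty m)} {t : Tm m} {A B : Ty m} :
      HasType (A :: Γ) t B → HasType Γ (.lam A t) (.arr A B)
  | app {m : ℕ} {Γ : List (Ty m)} {t s : Tm m} {A B : Ty m} :
      HasType Γ t (.arr A B) → HasType Γ s A → HasType Γ (.app t s) B
  | tlam {m : ℕ} {Γ : List (Ty m)} {t : Tm (m + 1)} {A : Ty (m + 1)} :
      HasType (Γ.map Ty.wk) t A → HasType Γ (.tlam t) (.all A)
  | tapp {m : ℕ} {Γ : List (Ty m)} {t : Tm m} {A : Ty (m + 1)} (B : Ty m) :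
      HasType Γ t (.all A) → HasType Γ (.tapp t B) (A.inst B)

/-- `βη`-equality `Δ ∣ Γ ⊢ t = s : A` of well-typed terms: the least typed congruence that
contains the `β`- and `η`-laws of all type formers. -/
inductive BEq : {m : ℕ} → List (Ty m) → Tm m → Tm m → Ty m → Prop
  | refl {m : ℕ} {Γ : List (Ty m)} {t : Tm m} {A : Ty m} : HasType Γ t A → BEq Γ t t A
  | symm {m : ℕ} {Γ : List (Ty m)} {t s : Tm m} {A : Ty m} : BEq Γ t s A → BEq Γ s t A
  | trans {m : ℕ} {Γ : List (Ty m)} {t s r : Tm m} {A : Ty m} :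
      BEq Γ t s A → BEq Γ s r A → BEq Γ t r A
  | pair {m : ℕ} {Γ : List (Ty m)} {t t' s s' : Tm m} {A B : Ty m} :
      BEq Γ t t' A → BEq Γ s s' B → BEq Γ (.pair t s) (.pair t' s') (.prod A B)
  | fst {m : ℕ} {Γ : List (Ty m)} {t t' : Tm m} {A B : Ty m} :
      BEq Γ t t' (.prod A B) → BEq Γ (.fst t) (.fst t') A
  | snd {m : ℕ} {Γ : List (Ty m)} {t t' : Tm m} {A B : Ty m} :
      BEq Γ t t' (.prod A B) → BEq Γ (.snd t) (.snd t') B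
  | lam {m : ℕ} {Γ : List (Ty m)} {t t' : Tm m} {A B : Ty m} :
      BEq (A :: Γ) t t' B → BEq Γ (.lam A t) (.lam A t') (.arr A B)
  | app {m : ℕ} {Γ : List (Ty m)} {t t' s s' : Tm m} {A B : Ty m} :
      BEq Γ t t' (.arr A B) → BEq Γ s s' A → BEq Γ (.app t s) (.app t' s') B
  | tlam {m : ℕ} {Γ : List (Ty m)} {t t' : Tm (m + 1)} {A : Ty (m + 1)} :
      BEq (Γ.map Ty.wk) t t' A → BEq Γ (.tlam t) (.tlam t') (.all A)
  | tapp {m : ℕ} {Γ : List (Ty m)} {t t' : Tm m} {A : Ty (m + 1)} (B : Ty m) :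
      BEq Γ t t' (.all A) → BEq Γ (.tapp t B) (.tapp t' B) (A.inst B)
  | unit_eta {m : ℕ} {Γ : List (Ty m)} {t : Tm m} : HasType Γ t .unit → BEq Γ t .star .unit
  | fst_beta {m : ℕ} {Γ : List (Ty m)} {t s : Tm m} {A B : Ty m} :
      HasType Γ t A → HasType Γ s B → BEq Γ (.fst (.pair t s)) t A
  | snd_beta {m : ℕ} {Γ : List (Ty m)} {t s : Tm m} {A B : Ty m} :
      HasType Γ t A → HasType Γ s B → BEq Γ (.snd (.pair t s)) s B
  | pair_eta {m : ℕ} {Γ : List (Ty m)} {t : Tm m} {A B : Ty m} :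
      HasType Γ t (.prod A B) → BEq Γ t (.pair (.fst t) (.snd t)) (.prod A B)
  | lam_beta {m : ℕ} {Γ : List (Ty m)} {t s : Tm m} {A B : Ty m} :
      HasType (A :: Γ) t B → HasType Γ s A → BEq Γ (.app (.lam A t) s) (t.inst s) B
  | lam_eta {m : ℕ} {Γ : List (Ty m)} {t : Tm m} {A B : Ty m} :
      HasType Γ t (.arr A B) → BEq Γ t (.lam A (.app t.wk (.var 0))) (.arr A B)
  | tlam_beta {m : ℕ} {Γ : List (Ty m)} {t : Tm (m + 1)} {A : Ty (m + 1)} (B : Ty m) :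
      HasType (Γ.map Ty.wk) t A → BEq Γ (.tapp (.tlam t) B) (t.tinst B) (A.inst B)
  | tlam_eta {m : ℕ} {Γ : List (Ty m)} {t : Tm m} {A : Ty (m + 1)} :
      HasType Γ t (.all A) → BEq Γ t (.tlam (.tapp t.twk (.var 0))) (.all A)

/-! ### Substitution lemmas -/

theorem upR_id {m : ℕ} : upR (id : Fin m → Fin m) = id := by
  funext i; refine Fin.cases rfl (fun _ => rfl) i

theorem upR_comp {l m n : ℕ} (ξ : Fin l → Fin m) (ζ : Fin m → Fin n) :
    upR ζ ∘ upR ξ = upR (ζ ∘ ξ) := by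
  funext i; refine Fin.cases rfl (fun _ => rfl) i

theorem Ty.ren_ren {l m n : ℕ} (ξ : Fin l → Fin m) (ζ : Fin m → Fin n) (A : Ty l) :
    (A.ren ξ).ren ζ = A.ren (ζ ∘ ξ) := by
  induction A generalizing m n with
  | all A ih => simp [Ty.ren, ih, upR_comp]
  | _ => simp_all [Ty.ren]

theorem upT_var {m : ℕ} : upT (Ty.var : Fin m → Ty m) = Ty.var := by
  funext i; refine Fin.cases rfl (fun _ => rfl) i

theorem Ty.subst_var {m : ℕ} (A : Ty m) : A.subst Ty.var = A := by
  induction A with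
  | all A ih => simp [Ty.subst, upT_var, ih]
  | _ => simp_all [Ty.subst]

theorem Ty.ren_eq {m n : ℕ} (ξ : Fin m → Fin n) (A : Ty m) :
    A.ren ξ = A.subst (fun i => .var (ξ i)) := by
  induction A generalizing n with
  | all A ih =>
    simp only [Ty.ren, Ty.subst, ih]
    congr 2; funext i; refine Fin.cases rfl (fun _ => rfl) i
  | _ => simp_all [Ty.ren, Ty.subst]

theorem Ty.subst_ren {l m n : ℕ} (ξ : Fin l → Fin m) (θ : Fin m → Ty n) (A : Ty l) :
    (A.ren ξ).subst θ = A.subst (θ ∘ ξ) := by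
  induction A generalizing m n with
  | all A ih =>
    simp only [Ty.ren, Ty.subst, ih]
    congr 2; funext i; refine Fin.cases rfl (fun _ => rfl) i
  | _ => simp_all [Ty.ren, Ty.subst]

theorem Ty.ren_wk {m n : ℕ} (ξ : Fin m → Fin n) (A : Ty m) :
    (A.ren ξ).wk = A.wk.ren (upR ξ) := by
  simp only [Ty.wk, Ty.ren_ren]; rfl

theorem Ty.ren_subst {l m n : ℕ} (θ : Fin l → Ty m) (ξ : Fin m → Fin n) (A : Ty l) :
    (A.subst θ).ren ξ = A.subst (fun i => (θ i).ren ξ) := by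
  induction A generalizing m n with
  | all A ih =>
    simp only [Ty.ren, Ty.subst, ih]
    congr 2; funext i
    refine Fin.cases rfl (fun i => ?_) i
    exact (Ty.ren_wk ξ (θ i)).symm
  | _ => simp_all [Ty.ren, Ty.subst]

theorem Ty.subst_wk {m n : ℕ} (θ : Fin m → Ty n) (A : Ty m) :
    (A.subst θ).wk = A.wk.subst (upT θ) := by
  simp only [Ty.wk, Ty.ren_subst, Ty.subst_ren]; rfl

theorem Ty.subst_subst {l m n : ℕ} (θ : Fin l → Ty m) (τ : Fin m → Ty n) (A : Ty l) :
    (A.subst θ).subst τ = A.subst (fun i => (θ i).subst τ) := by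
  induction A generalizing m n with
  | all A ih =>
    simp only [Ty.subst, ih]
    congr 2; funext i
    refine Fin.cases rfl (fun i => ?_) i
    exact (Ty.subst_wk τ (θ i)).symm
  | _ => simp_all [Ty.subst]

theorem Ty.wk_inst {m : ℕ} (A B : Ty m) : A.wk.inst B = A := by
  simp only [Ty.wk, Ty.inst, Ty.subst_ren]
  exact Ty.subst_var A

theorem Ty.inst_subst {m n : ℕ} (A : Ty (m + 1)) (B : Ty m) (θ : Fin m → Ty n) :
    (A.inst B).subst θ = (A.subst (upT θ)).inst (B.subst θ) := by
  simp only [Ty.inst, Ty.subst_subst]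
  congr 1; funext i
  refine Fin.cases rfl (fun i => ?_) i
  exact (Ty.wk_inst (θ i) (B.subst θ)).symm

theorem upV_comp (ρ π : ℕ → ℕ) : upV π ∘ upV ρ = upV (π ∘ ρ) := by
  funext i; cases i <;> rfl

theorem Tm.ren_ren {l m n : ℕ} (ξ : Fin l → Fin m) (ρ : ℕ → ℕ) (ζ : Fin m → Fin n) (π : ℕ → ℕ)
    (t : Tm l) : (t.ren ξ ρ).ren ζ π = t.ren (ζ ∘ ξ) (π ∘ ρ) := by
  induction t generalizing m n ρ π with
  | lam A t ih => simp [Tm.ren, ih, upV_comp, Ty.ren_ren]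
  | tlam t ih => simp [Tm.ren, ih, upR_comp]
  | _ => simp_all [Tm.ren, Ty.ren_ren]

theorem upS_var {m : ℕ} : upS (Tm.var : ℕ → Tm m) = Tm.var := by
  funext i; cases i <;> rfl

theorem Tm.subst_var {m : ℕ} (t : Tm m) : t.subst Ty.var Tm.var = t := by
  induction t with
  | lam A t ih => simp [Tm.subst, upS_var, ih, Ty.subst_var]
  | tlam t ih =>
    simp only [Tm.subst, upT_var]
    exact congrArg Tm.tlam ih
  | _ => simp_all [Tm.subst, Ty.subst_var]

theorem Tm.ren_eq {m n : ℕ} (ξ : Fin m → Fin n) (ρ : ℕ → ℕ) (t : Tm m) :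
    t.ren ξ ρ = t.subst (fun i => .var (ξ i)) (fun i => .var (ρ i)) := by
  induction t generalizing n ρ with
  | lam A t ih =>
    simp only [Tm.ren, Tm.subst, ih, Ty.ren_eq]
    congr 2; funext i; cases i <;> rfl
  | tlam t ih =>
    simp only [Tm.ren, Tm.subst, ih]
    congr 2; funext i; refine Fin.cases rfl (fun _ => rfl) i
  | _ => simp_all [Tm.ren, Tm.subst, Ty.ren_eq]

theorem Tm.subst_ren {l m n : ℕ} (ξ : Fin l → Fin m) (ρ : ℕ → ℕ) (θ : Fin m → Ty n)
    (σ : ℕ → Tm n) (t : Tm l) : (t.ren ξ ρ).subst θ σ = t.subst (θ ∘ ξ) (σ ∘ ρ) := by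
  induction t generalizing m n ρ with
  | lam A t ih =>
    simp only [Tm.ren, Tm.subst, ih, Ty.subst_ren]
    congr 2; funext i; cases i <;> rfl
  | tlam t ih =>
    simp only [Tm.ren, Tm.subst, ih]
    congr 2; funext i; refine Fin.cases rfl (fun _ => rfl) i
  | _ => simp_all [Tm.ren, Tm.subst, Ty.subst_ren]

theorem Tm.ren_subst {l m n : ℕ} (θ : Fin l → Ty m) (σ : ℕ → Tm m) (ξ : Fin m → Fin n)
    (ρ : ℕ → ℕ) (t : Tm l) :
    (t.subst θ σ).ren ξ ρ = t.subst (fun i => (θ i).ren ξ) (fun i => (σ i).ren ξ ρ) := by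
  induction t generalizing m n ρ with
  | lam A t ih =>
    simp only [Tm.ren, Tm.subst, ih, Ty.ren_subst]
    congr 2; funext i; cases i with
    | zero => rfl
    | succ i => simp only [upS, Tm.wk, Tm.ren_ren]; rfl
  | tlam t ih =>
    simp only [Tm.ren, Tm.subst, ih]
    congr 2
    · funext i; refine Fin.cases rfl (fun i => ?_) i
      exact (Ty.ren_wk ξ (θ i)).symm
    · funext i; simp only [Tm.twk, Tm.ren_ren]; rfl
  | _ => simp_all [Tm.ren, Tm.subst, Ty.ren_subst]

theorem Tm.subst_subst {l m n : ℕ} (θ : Fin l → Ty m) (σ : ℕ → Tm m) (τ : Fin m → Ty n)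
    (ς : ℕ → Tm n) (t : Tm l) :
    (t.subst θ σ).subst τ ς = t.subst (fun i => (θ i).subst τ) (fun i => (σ i).subst τ ς) := by
  induction t generalizing m n with
  | lam A t ih =>
    simp only [Tm.subst, ih, Ty.subst_subst]
    congr 2; funext i; cases i with
    | zero => rfl
    | succ i =>
      simp only [upS, Tm.wk, Tm.ren_subst, Tm.subst_ren]
      congr 1; funext j; simp only [Function.comp, id, Ty.ren_eq, Ty.subst_var]
  | tlam t ih =>
    simp only [Tm.subst, ih]
    congr 2
    · funext i; refine Fin.cases rfl (fun i => ?_) i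
      exact (Ty.subst_wk τ (θ i)).symm
    · funext i; simp only [Tm.twk, Tm.ren_subst, Tm.subst_ren]; rfl
  | _ => simp_all [Tm.subst, Ty.subst_subst]

/-! ### Typing and `βη`-equality are stable under substitution -/

theorem HasType.ren {m n : ℕ} {Γ : List (Ty m)} {t : Tm m} {A : Ty m} (h : HasType Γ t A)
    {Δ : List (Ty n)} {ξ : Fin m → Fin n} {ρ : ℕ → ℕ}
    (hρ : ∀ i B, Γ[i]? = some B → Δ[ρ i]? = some (B.ren ξ)) :
    HasType Δ (t.ren ξ ρ) (A.ren ξ) := by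
  induction h generalizing n ρ with
  | var h => exact .var (hρ _ _ h)
  | star => exact .star
  | pair _ _ ih₁ ih₂ => exact .pair (ih₁ hρ) (ih₂ hρ)
  | fst _ ih => exact .fst (ih hρ)
  | snd _ ih => exact .snd (ih hρ)
  | lam _ ih =>
    refine .lam (ih (fun i B h => ?_))
    cases i with
    | zero => simp_all [upV]
    | succ i => exact hρ i B h
  | app _ _ ih₁ ih₂ => exact .app (ih₁ hρ) (ih₂ hρ)
  | tlam _ ih =>
    refine .tlam (ih (fun i B h => ?_))
    simp only [List.getElem?_map, Option.map_eq_some_iff] at h ⊢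
    obtain ⟨B', h, rfl⟩ := h
    exact ⟨_, hρ i B' h, Ty.ren_wk ξ B'⟩
  | @tapp _ _ _ A B _ ih =>
    have := HasType.tapp (B.ren ξ) (ih hρ)
    have e : (A.inst B).ren ξ = (A.ren (upR ξ)).inst (B.ren ξ) := by
      simp only [Ty.inst, Ty.ren_subst, Ty.subst_ren]
      congr 1; funext i; refine Fin.cases rfl (fun _ => rfl) i
    exact e ▸ this

theorem Ty.ren_id {m : ℕ} (A : Ty m) : A.ren id = A := by
  rw [Ty.ren_eq]; exact Ty.subst_var A

theorem HasType.wk {m : ℕ} {Γ : List (Ty m)} {t : Tm m} {A : Ty m} (h : HasType Γ t A) (B : Ty m) :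
    HasType (B :: Γ) t.wk A := by
  have := h.ren (Δ := B :: Γ) (ξ := id) (ρ := (· + 1)) (fun i C hC => by simpa [Ty.ren_id] using hC)
  rwa [Ty.ren_id] at this

theorem HasType.twk {m : ℕ} {Γ : List (Ty m)} {t : Tm m} {A : Ty m} (h : HasType Γ t A) :
    HasType (Γ.map Ty.wk) t.twk A.wk :=
  h.ren (fun i C hC => by simp [hC, Ty.wk])

theorem HasType.upS {m n : ℕ} {Γ : List (Ty m)} {Δ : List (Ty n)} {θ : Fin m → Ty n}
    {σ : ℕ → Tm n} (hσ : ∀ i B, Γ[i]? = some B → HasType Δ (σ i) (B.subst θ)) (A : Ty m) :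
    ∀ i B, (A :: Γ)[i]? = some B → HasType (A.subst θ :: Δ) (upS σ i) (B.subst θ) := by
  intro i B h
  cases i with
  | zero => simp only [List.getElem?_cons_zero, Option.some.injEq] at h; subst h; exact .var rfl
  | succ i => exact (hσ i B h).wk _

theorem HasType.upT {m n : ℕ} {Γ : List (Ty m)} {Δ : List (Ty n)} {θ : Fin m → Ty n}
    {σ : ℕ → Tm n} (hσ : ∀ i B, Γ[i]? = some B → HasType Δ (σ i) (B.subst θ)) :
    ∀ i B, (Γ.map Ty.wk)[i]? = some B → HasType (Δ.map Ty.wk) (σ i).twk (B.subst (upT θ)) := by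
  intro i B h
  simp only [List.getElem?_map, Option.map_eq_some_iff] at h
  obtain ⟨B', h, rfl⟩ := h
  exact Ty.subst_wk θ B' ▸ (hσ i B' h).twk

theorem HasType.subst {m n : ℕ} {Γ : List (Ty m)} {t : Tm m} {A : Ty m} (h : HasType Γ t A)
    {Δ : List (Ty n)} {θ : Fin m → Ty n} {σ : ℕ → Tm n}
    (hσ : ∀ i B, Γ[i]? = some B → HasType Δ (σ i) (B.subst θ)) :
    HasType Δ (t.subst θ σ) (A.subst θ) := by
  induction h generalizing n with
  | var h => exact hσ _ _ h
  | star => exact .star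
  | pair _ _ ih₁ ih₂ => exact .pair (ih₁ hσ) (ih₂ hσ)
  | fst _ ih => exact .fst (ih hσ)
  | snd _ ih => exact .snd (ih hσ)
  | lam _ ih => exact .lam (ih (HasType.upS hσ _))
  | app _ _ ih₁ ih₂ => exact .app (ih₁ hσ) (ih₂ hσ)
  | tlam _ ih => exact .tlam (ih (HasType.upT hσ))
  | @tapp _ _ _ A B _ ih =>
    exact Ty.inst_subst A B θ ▸ HasType.tapp (B.subst θ) (ih hσ)

theorem Tm.inst_subst {m n : ℕ} (t s : Tm m) (θ : Fin m → Ty n) (σ : ℕ → Tm n) :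
    (t.inst s).subst θ σ = (t.subst θ (upS σ)).inst (s.subst θ σ) := by
  simp only [Tm.inst, Tm.subst_subst, Ty.subst_var]
  congr 1; funext i; cases i with
  | zero => rfl
  | succ i =>
    simp only [instS, upS, Tm.subst, Tm.wk, Tm.subst_ren]
    exact (Tm.subst_var (σ i)).symm

theorem Tm.tinst_subst {m n : ℕ} (t : Tm (m + 1)) (B : Ty m) (θ : Fin m → Ty n) (σ : ℕ → Tm n) :
    (t.tinst B).subst θ σ = (t.subst (upT θ) (fun i => (σ i).twk)).tinst (B.subst θ) := by
  simp only [Tm.tinst, Tm.subst_subst]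
  congr 1
  · funext i; refine Fin.cases rfl (fun i => ?_) i
    exact (Ty.wk_inst (θ i) (B.subst θ)).symm
  · funext i
    simp only [Tm.subst, Tm.twk, Tm.subst_ren]
    exact (Tm.subst_var (σ i)).symm

theorem Tm.subst_wk {m n : ℕ} (t : Tm m) (θ : Fin m → Ty n) (σ : ℕ → Tm n) :
    (t.subst θ σ).wk = t.wk.subst θ (upS σ) := by
  simp only [Tm.wk, Tm.ren_subst, Tm.subst_ren]
  congr 1; funext i; exact Ty.ren_id _

theorem Tm.subst_twk {m n : ℕ} (t : Tm m) (θ : Fin m → Ty n) (σ : ℕ → Tm n) :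
    (t.subst θ σ).twk = t.twk.subst (upT θ) (fun i => (σ i).twk) := by
  simp only [Tm.twk, Tm.ren_subst, Tm.subst_ren]
  rfl

theorem BEq.subst {m n : ℕ} {Γ : List (Ty m)} {t s : Tm m} {A : Ty m} (h : BEq Γ t s A)
    {Δ : List (Ty n)} {θ : Fin m → Ty n} {σ : ℕ → Tm n}
    (hσ : ∀ i B, Γ[i]? = some B → HasType Δ (σ i) (B.subst θ)) :
    BEq Δ (t.subst θ σ) (s.subst θ σ) (A.subst θ) := by
  induction h generalizing n with
  | refl h => exact .refl (h.subst hσ)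
  | symm _ ih => exact .symm (ih hσ)
  | trans _ _ ih₁ ih₂ => exact .trans (ih₁ hσ) (ih₂ hσ)
  | pair _ _ ih₁ ih₂ => exact .pair (ih₁ hσ) (ih₂ hσ)
  | fst _ ih => exact .fst (ih hσ)
  | snd _ ih => exact .snd (ih hσ)
  | lam _ ih => exact .lam (ih (HasType.upS hσ _))
  | app _ _ ih₁ ih₂ => exact .app (ih₁ hσ) (ih₂ hσ)
  | tlam _ ih => exact .tlam (ih (HasType.upT hσ))
  | @tapp _ _ _ _ A B _ ih => exact Ty.inst_subst A B θ ▸ BEq.tapp (B.subst θ) (ih hσ)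
  | unit_eta h => exact .unit_eta (h.subst hσ)
  | fst_beta h₁ h₂ => exact .fst_beta (h₁.subst hσ) (h₂.subst hσ)
  | snd_beta h₁ h₂ => exact .snd_beta (h₁.subst hσ) (h₂.subst hσ)
  | pair_eta h => exact .pair_eta (h.subst hσ)
  | lam_beta h₁ h₂ =>
    rw [Tm.inst_subst]
    exact .lam_beta (h₁.subst (HasType.upS hσ _)) (h₂.subst hσ)
  | lam_eta h =>
    have := BEq.lam_eta (h.subst hσ)
    rwa [Tm.subst_wk] at this
  | @tlam_beta _ _ _ A B h =>
    rw [Tm.tinst_subst, Ty.inst_subst]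
    exact .tlam_beta (B.subst θ) (h.subst (HasType.upT hσ))
  | tlam_eta h =>
    have := BEq.tlam_eta (h.subst hσ)
    rwa [Tm.subst_twk] at this

theorem BEq.ren {m n : ℕ} {Γ : List (Ty m)} {t s : Tm m} {A : Ty m} (h : BEq Γ t s A)
    {Δ : List (Ty n)} {ξ : Fin m → Fin n} {ρ : ℕ → ℕ}
    (hρ : ∀ i B, Γ[i]? = some B → Δ[ρ i]? = some (B.ren ξ)) :
    BEq Δ (t.ren ξ ρ) (s.ren ξ ρ) (A.ren ξ) := by
  simp only [Tm.ren_eq, Ty.ren_eq]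
  refine h.subst (fun i B hB => .var ?_)
  rw [← Ty.ren_eq]; exact hρ i B hB

theorem BEq.wk {m : ℕ} {Γ : List (Ty m)} {t s : Tm m} {A : Ty m} (h : BEq Γ t s A) (B : Ty m) :
    BEq (B :: Γ) t.wk s.wk A := by
  have := h.ren (Δ := B :: Γ) (ξ := id) (ρ := (· + 1)) (fun i C hC => by simpa [Ty.ren_id] using hC)
  rwa [Ty.ren_id] at this

theorem BEq.twk {m : ℕ} {Γ : List (Ty m)} {t s : Tm m} {A : Ty m} (h : BEq Γ t s A) :
    BEq (Γ.map Ty.wk) t.twk s.twk A.wk :=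
  h.ren (fun i C hC => by simp [hC, Ty.wk])

theorem HasType.substCongr {m n : ℕ} {Γ : List (Ty m)} {t : Tm m} {A : Ty m} (h : HasType Γ t A)
    {Δ : List (Ty n)} {θ : Fin m → Ty n} {σ τ : ℕ → Tm n}
    (hσ : ∀ i B, Γ[i]? = some B → BEq Δ (σ i) (τ i) (B.subst θ)) :
    BEq Δ (t.subst θ σ) (t.subst θ τ) (A.subst θ) := by
  induction h generalizing n with
  | var h => exact hσ _ _ h
  | star => exact .refl .star
  | pair _ _ ih₁ ih₂ => exact .pair (ih₁ hσ) (ih₂ hσ)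
  | fst _ ih => exact .fst (ih hσ)
  | snd _ ih => exact .snd (ih hσ)
  | @lam _ _ _ A _ _ ih =>
    refine .lam (ih (fun i B h => ?_))
    cases i with
    | zero => simp only [List.getElem?_cons_zero, Option.some.injEq] at h; subst h; exact .refl (.var rfl)
    | succ i => exact (hσ i B h).wk _
  | app _ _ ih₁ ih₂ => exact .app (ih₁ hσ) (ih₂ hσ)
  | tlam _ ih =>
    refine .tlam (ih (fun i B h => ?_))
    simp only [List.getElem?_map, Option.map_eq_some_iff] at h
    obtain ⟨B', h, rfl⟩ := h
    exact Ty.subst_wk θ B' ▸ (hσ i B' h).twk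
  | @tapp _ _ _ A B _ ih =>
    exact Ty.inst_subst A B θ ▸ BEq.tapp (B.subst θ) (ih hσ)

end SysF

namespace SysF

/-! ### The term model

The fibre of the term model over a context of `m` type variables: objects are the types `Ty m`, and
morphisms `A ⟶ B` are the terms `x : A ⊢ t : B` modulo `βη`-equality. -/

/-- Well-typed terms `Γ ⊢ t : A`. -/
abbrev TTm {m : ℕ} (Γ : List (Ty m)) (A : Ty m) : Type := {t : Tm m // HasType Γ t A}

/-- `βη`-equality as a setoid. -/
instance TTm.setoid {m : ℕ} (Γ : List (Ty m)) (A : Ty m) : Setoid (TTm Γ A) where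
  r t s := BEq Γ t.1 s.1 A
  iseqv := ⟨fun t => .refl t.2, fun h => .symm h, fun h₁ h₂ => .trans h₁ h₂⟩

/-- Morphisms of the term model. -/
def Hom {m : ℕ} (A B : Ty m) : Type := Quotient (TTm.setoid [A] B)

/-- The `βη`-class of a term in one variable. -/
def Hom.mk {m : ℕ} {A B : Ty m} (t : Tm m) (h : HasType [A] t B) : Hom A B :=
  Quotient.mk (TTm.setoid [A] B) ⟨t, h⟩

theorem HasType.subst₀ {m : ℕ} {Γ Δ : List (Ty m)} {t : Tm m} {B : Ty m} {σ : ℕ → Tm m}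
    (h : HasType Γ t B) (hσ : ∀ i C, Γ[i]? = some C → HasType Δ (σ i) C) :
    HasType Δ (t.subst Ty.var σ) B := by
  have := h.subst (θ := Ty.var) (Δ := Δ) (σ := σ) (fun i C hC => by
    rw [Ty.subst_var]; exact hσ i C hC)
  rwa [Ty.subst_var] at this

theorem BEq.subst₀ {m : ℕ} {Γ Δ : List (Ty m)} {t t' : Tm m} {B : Ty m} {σ σ' : ℕ → Tm m}
    (h : BEq Γ t t' B) (ht : HasType Γ t B)
    (hσ' : ∀ i C, Γ[i]? = some C → HasType Δ (σ' i) C)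
    (hσ : ∀ i C, Γ[i]? = some C → BEq Δ (σ i) (σ' i) C) :
    BEq Δ (t.subst Ty.var σ) (t'.subst Ty.var σ') B := by
  have h₁ := ht.substCongr (θ := Ty.var) (Δ := Δ) (σ := σ) (τ := σ') (fun i C hC => by
    rw [Ty.subst_var]; exact hσ i C hC)
  have h₂ := h.subst (θ := Ty.var) (Δ := Δ) (σ := σ') (fun i C hC => by
    rw [Ty.subst_var]; exact hσ' i C hC)
  rw [Ty.subst_var] at h₁ h₂
  exact h₁.trans h₂

theorem forall_single {m : ℕ} {A : Ty m} {P : Ty m → Prop} (h : P A) :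
    ∀ (i : ℕ) (C : Ty m), [A][i]? = some C → P C := by
  intro i C hC
  cases i with
  | zero => simp only [List.getElem?_cons_zero, Option.some.injEq] at hC; exact hC ▸ h
  | succ i => simp at hC

/-- Composition is substitution: `t ∘ s = t[s / x]`. -/
def Hom.comp {m : ℕ} {A B C : Ty m} : Hom A B → Hom B C → Hom A C :=
  Quotient.map₂ (fun s t => ⟨t.1.subst Ty.var (fun _ => s.1),
      t.2.subst₀ (forall_single (P := fun D => HasType [A] s.1 D) s.2)⟩)
    (fun _ s' hs t _ ht => BEq.subst₀ ht t.2 (forall_single (P := fun D => HasType [A] s'.1 D) s'.2)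
      (forall_single (P := fun D => BEq [A] _ s'.1 D) hs))

instance termModel {m : ℕ} : Category (Ty m) where
  Hom := Hom
  id _ := Hom.mk (.var 0) (.var rfl)
  comp := Hom.comp
  id_comp f := by
    obtain ⟨t, rfl⟩ := Quotient.exists_rep f
    refine Quotient.sound (s := TTm.setoid _ _) ?_
    show BEq _ _ _ _
    have := (BEq.refl t.2).subst₀ (σ := fun _ => .var 0) (σ' := Tm.var) (Δ := [_]) t.2
      (fun i C hC => .var hC) (fun i C hC => by
        cases i with
        | zero => exact .refl (.var hC)
        | succ i => simp at hC)
    rwa [Tm.subst_var] at this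
  comp_id f := by
    obtain ⟨t, rfl⟩ := Quotient.exists_rep f
    rfl
  assoc f g h := by
    obtain ⟨s, rfl⟩ := Quotient.exists_rep f
    obtain ⟨t, rfl⟩ := Quotient.exists_rep g
    obtain ⟨r, rfl⟩ := Quotient.exists_rep h
    refine congrArg (Quotient.mk _) (Subtype.ext ?_)
    exact (Tm.subst_subst Ty.var (fun _ => t.1) Ty.var (fun _ => s.1) r.1).symm

/-- The `βη`-class of a term in one variable, as a morphism of the term model. -/
def mk {m : ℕ} {A B : Ty m} (t : Tm m) (h : HasType [A] t B) : A ⟶ B := Hom.mk t h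

theorem mk_eq {m : ℕ} {A B : Ty m} {s t : Tm m} {hs : HasType [A] s B} {ht : HasType [A] t B}
    (h : BEq [A] s t B) : mk s hs = mk t ht := Quotient.sound h

theorem exists_mk {m : ℕ} {A B : Ty m} (f : A ⟶ B) : ∃ t h, f = mk t h := by
  obtain ⟨t, rfl⟩ := Quotient.exists_rep f
  exact ⟨t.1, t.2, rfl⟩

/-- Pairing. -/
def pairHom {m : ℕ} {A B C : Ty m} : (A ⟶ B) → (A ⟶ C) → (A ⟶ Ty.prod B C) :=
  Quotient.map₂ (sa := TTm.setoid [A] B) (sb := TTm.setoid [A] C) (sc := TTm.setoid [A] (.prod B C))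
    (fun s t => ⟨.pair s.1 t.1, .pair s.2 t.2⟩) (fun _ _ h₁ _ _ h₂ => BEq.pair h₁ h₂)

/-- The first projection. -/
def fstHom {m : ℕ} (A B : Ty m) : Ty.prod A B ⟶ A := mk (.fst (.var 0)) (.fst (.var rfl))

/-- The second projection. -/
def sndHom {m : ℕ} (A B : Ty m) : Ty.prod A B ⟶ B := mk (.snd (.var 0)) (.snd (.var rfl))

theorem pairHom_fst {m : ℕ} {A B C : Ty m} (f : A ⟶ B) (g : A ⟶ C) :
    pairHom f g ≫ fstHom B C = f := by
  obtain ⟨s, hs, rfl⟩ := exists_mk f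
  obtain ⟨t, ht, rfl⟩ := exists_mk g
  exact mk_eq (hs := .fst (.pair hs ht)) (.fst_beta hs ht)

theorem pairHom_snd {m : ℕ} {A B C : Ty m} (f : A ⟶ B) (g : A ⟶ C) :
    pairHom f g ≫ sndHom B C = g := by
  obtain ⟨s, hs, rfl⟩ := exists_mk f
  obtain ⟨t, ht, rfl⟩ := exists_mk g
  exact mk_eq (hs := .snd (.pair hs ht)) (.snd_beta hs ht)

theorem pairHom_eta {m : ℕ} {A B C : Ty m} (f : A ⟶ Ty.prod B C) :
    pairHom (f ≫ fstHom B C) (f ≫ sndHom B C) = f := by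
  obtain ⟨t, ht, rfl⟩ := exists_mk f
  exact mk_eq (hs := .pair (.fst ht) (.snd ht)) (BEq.pair_eta ht).symm

/-- Finite products in the term model are given by the unit and product types. -/
instance cartesian {m : ℕ} : CartesianMonoidalCategory (Ty m) :=
  .ofChosenFiniteProducts
    { cone := Limits.asEmptyCone Ty.unit
      isLimit := Limits.IsTerminal.ofUniqueHom (fun _ => mk .star .star) (fun A f => by
        obtain ⟨t, ht, rfl⟩ := exists_mk f
        exact mk_eq (.unit_eta ht)) }
    (fun A B =>
      { cone := Limits.BinaryFan.mk (fstHom A B) (sndHom A B)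
        isLimit := Limits.BinaryFan.IsLimit.mk _ (fun f g => pairHom f g)
          (fun f g => pairHom_fst f g) (fun f g => pairHom_snd f g)
          (fun f g h h₁ h₂ => by subst h₁ h₂; exact (pairHom_eta h).symm) })

/-- The product `((1 × Aₙ) × ⋯) × A₁` of the types of a context. -/
def ctxTy {m : ℕ} : List (Ty m) → Ty m
  | [] => .unit
  | A :: Γ => .prod (ctxTy Γ) A

/-- The projection of a tuple `t : ctxTy Γ` to the variable `i`. -/
def ctxProj {m : ℕ} : ℕ → Tm m → Tm m
  | 0, t => .snd t
  | i + 1, t => ctxProj i (.fst t)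

theorem hasType_ctxProj {m : ℕ} {Δ : List (Ty m)} : (Γ : List (Ty m)) → (i : ℕ) → (A : Ty m) →
    Γ[i]? = some A → {t : Tm m} → HasType Δ t (ctxTy Γ) → HasType Δ (ctxProj i t) A
  | [], _, _, h, _, _ => by simp at h
  | B :: Γ, 0, A, h, t, ht => by
      simp only [List.getElem?_cons_zero, Option.some.injEq] at h; subst h; exact .snd ht
  | B :: Γ, i + 1, A, h, t, ht => hasType_ctxProj Γ i A h (.fst ht)

/-- The morphism of the term model given by a term `Γ ⊢ t : A` in several variables: the
`βη`-class of the term `x : A₁ × ⋯ × Aₙ ⊢ t[π₁ x / x₁, …, πₙ x / xₙ] : A`. -/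
def cls {m : ℕ} {Γ : List (Ty m)} {A : Ty m} (t : Tm m) (h : HasType Γ t A) : ctxTy Γ ⟶ A :=
  mk (t.subst Ty.var (fun i => ctxProj i (.var 0)))
    (h.subst₀ (fun i C hC => hasType_ctxProj Γ i C hC (.var rfl)))

end SysF

namespace LamEff

/-! ### Types and terms of the effect handler calculus -/

/-- A signature over `X`: a finite partial function from operation symbols to pairs of elements
of `X`, given by its (finite) domain, its argument types and its result types. -/
structure Sig (Op : Type u) (X : Type v) where
  dom : Finset Op
  arg : {o // o ∈ dom} → X
  res : {o // o ∈ dom} → X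

/-- The action of a function on signatures. -/
def Sig.map {Op : Type u} {X : Type v} {Y : Type w} (f : X → Y) (S : Sig Op X) : Sig Op Y :=
  ⟨S.dom, fun o => f (S.arg o), fun o => f (S.res o)⟩

/-- The operations of a signature, listed in an arbitrary but fixed order that depends only on
the domain. -/
noncomputable def Sig.ops {Op : Type u} {X : Type v} (S : Sig Op X) : List {o // o ∈ S.dom} :=
  S.dom.attach.toList

theorem Sig.mem_ops {Op : Type u} {X : Type v} (S : Sig Op X) (o : {o // o ∈ S.dom}) :
    o ∈ S.ops := by
  simp [Sig.ops]

/-- Value types. `fn A B dom arg res` is the function type `A → B ! Σ` where `Σ` is the signature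
`⟨dom, arg, res⟩`, see `VTy.arr`; `prod n A` is the product of `A 0, …, A (n - 1)`. -/
inductive VTy (Op : Type u) : Type u
  | fn (A B : VTy Op) (dom : Finset Op) (arg res : {o // o ∈ dom} → VTy Op) : VTy Op
  | prod (n : ℕ) (A : Fin n → VTy Op) : VTy Op

/-- Computation types `A ! Σ`. -/
structure CTy (Op : Type u) where
  ret : VTy Op
  sig : Sig Op (VTy Op)

/-- The function type `A → C`. -/
abbrev VTy.arr {Op : Type u} (A : VTy Op) (C : CTy Op) : VTy Op :=
  .fn A C.ret C.sig.dom C.sig.arg C.sig.res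

/-- Contexts, the innermost variable first. -/
abbrev Ctx (Op : Type u) : Type u := List (VTy Op)

/-- Variables `(x : A) ∈ Γ` as typed de Bruijn indices. -/
inductive Var {Op : Type u} : Ctx Op → VTy Op → Type u
  | zero {Γ : Ctx Op} {A : VTy Op} : Var (A :: Γ) A
  | succ {Γ : Ctx Op} {A B : VTy Op} (x : Var Γ A) : Var (B :: Γ) A

/- Terms are intrinsically typed: an element of `Val Γ A` (of `Comp Γ C`) is a value term
(a computation term) together with a derivation of `Γ ⊢ V : A` (of `Γ ⊢ M : C`). -/
mutual
/-- Well-typed value terms `Γ ⊢ V : A`. -/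
inductive Val {Op : Type u} : Ctx Op → VTy Op → Type u
  | var {Γ : Ctx Op} {A : VTy Op} (x : Var Γ A) : Val Γ A
  | lam {Γ : Ctx Op} {A : VTy Op} {C : CTy Op} (M : Comp (A :: Γ) C) : Val Γ (A.arr C)
  | tuple {Γ : Ctx Op} {n : ℕ} {A : Fin n → VTy Op} (V : ∀ i, Val Γ (A i)) : Val Γ (.prod n A)
  | proj {Γ : Ctx Op} {n : ℕ} {A : Fin n → VTy Op} (V : Val Γ (.prod n A)) (i : Fin n) :
      Val Γ (A i)
/-- Well-typed computation terms `Γ ⊢ M : C`. -/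
inductive Comp {Op : Type u} : Ctx Op → CTy Op → Type u
  /-- application `V W` -/
  | app {Γ : Ctx Op} {A : VTy Op} {C : CTy Op} (V : Val Γ (A.arr C)) (W : Val Γ A) : Comp Γ C
  /-- `return V` -/
  | ret {Γ : Ctx Op} {A : VTy Op} {S : Sig Op (VTy Op)} (V : Val Γ A) : Comp Γ ⟨A, S⟩
  /-- `let x = M in N` -/
  | letIn {Γ : Ctx Op} {A B : VTy Op} {S : Sig Op (VTy Op)}
      (M : Comp Γ ⟨A, S⟩) (N : Comp (A :: Γ) ⟨B, S⟩) : Comp Γ ⟨B, S⟩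
  /-- `op(V)` -/
  | op {Γ : Ctx Op} {S : Sig Op (VTy Op)} (o : {o // o ∈ S.dom}) (V : Val Γ (S.arg o)) :
      Comp Γ ⟨S.res o, S⟩
  /-- `with H handle M to x. N`, where `H` has one clause `op(x, k) ↦ H op` for each operation
  `op` in the signature of `M`; in a clause `k` is the variable `0` and `x` the variable `1` -/
  | handle {Γ : Ctx Op} {A : VTy Op} {S : Sig Op (VTy Op)} {C : CTy Op}
      (M : Comp Γ ⟨A, S⟩)
      (H : ∀ o : {o // o ∈ S.dom}, Comp ((S.res o).arr C :: S.arg o :: Γ) C)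
      (N : Comp (A :: Γ) C) : Comp Γ C
end

/-- Well-typed handlers `Γ ⊢ H : Σ ⇒ C`: finite sets of clauses `op(x, k) ↦ M_op`, one for each
operation `op` in `Σ`, where `Γ, x : A_op, k : B_op → C ⊢ M_op : C`. -/
abbrev Handler {Op : Type u} (Γ : Ctx Op) (S : Sig Op (VTy Op)) (C : CTy Op) : Type u :=
  ∀ o : {o // o ∈ S.dom}, Comp ((S.res o).arr C :: S.arg o :: Γ) C

/-! ### Renaming and substitution -/

/-- Renamings. -/
def Ren {Op : Type u} (Γ Δ : Ctx Op) : Type u := ∀ A : VTy Op, Var Γ A → Var Δ A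

/-- Lifting of a renaming under a binder. -/
def Ren.lift {Op : Type u} {Γ Δ : Ctx Op} (ρ : Ren Γ Δ) {B : VTy Op} : Ren (B :: Γ) (B :: Δ)
  | _, .zero => .zero
  | _, .succ x => .succ (ρ _ x)

mutual
/-- Renaming in value terms. -/
def Val.ren {Op : Type u} : {Γ Δ : Ctx Op} → {A : VTy Op} → Val Γ A → Ren Γ Δ → Val Δ A
  | _, _, _, .var x, ρ => .var (ρ _ x)
  | _, _, _, .lam M, ρ => .lam (M.ren ρ.lift)
  | _, _, _, .tuple V, ρ => .tuple (fun i => (V i).ren ρ)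
  | _, _, _, .proj (A := _) V i, ρ => .proj (V.ren ρ) i
/-- Renaming in computation terms. -/
def Comp.ren {Op : Type u} : {Γ Δ : Ctx Op} → {C : CTy Op} → Comp Γ C → Ren Γ Δ → Comp Δ C
  | _, _, _, .app V W, ρ => .app (V.ren ρ) (W.ren ρ)
  | _, _, _, .ret V, ρ => .ret (V.ren ρ)
  | _, _, _, .letIn M N, ρ => .letIn (M.ren ρ) (N.ren ρ.lift)
  | _, _, _, .op o V, ρ => .op o (V.ren ρ)
  | _, _, _, .handle M H N, ρ =>
      .handle (M.ren ρ) (fun o => (H o).ren ρ.lift.lift) (N.ren ρ.lift)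
end

/-- The weakening renaming. -/
def Ren.wk {Op : Type u} {Γ : Ctx Op} {B : VTy Op} : Ren Γ (B :: Γ) := fun _ x => .succ x

/-- Substitutions of value terms for variables. -/
def Subst {Op : Type u} (Γ Δ : Ctx Op) : Type u := ∀ A : VTy Op, Var Γ A → Val Δ A

/-- Lifting of a substitution under a binder. -/
def Subst.lift {Op : Type u} {Γ Δ : Ctx Op} (σ : Subst Γ Δ) {B : VTy Op} :
    Subst (B :: Γ) (B :: Δ)
  | _, .zero => .var .zero
  | _, .succ x => (σ _ x).ren Ren.wk

mutual
/-- Substitution in value terms. -/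
def Val.subst {Op : Type u} : {Γ Δ : Ctx Op} → {A : VTy Op} → Val Γ A → Subst Γ Δ → Val Δ A
  | _, _, _, .var x, σ => σ _ x
  | _, _, _, .lam M, σ => .lam (M.subst σ.lift)
  | _, _, _, .tuple V, σ => .tuple (fun i => (V i).subst σ)
  | _, _, _, .proj (A := _) V i, σ => .proj (V.subst σ) i
/-- Substitution in computation terms. -/
def Comp.subst {Op : Type u} : {Γ Δ : Ctx Op} → {C : CTy Op} → Comp Γ C → Subst Γ Δ → Comp Δ C
  | _, _, _, .app V W, σ => .app (V.subst σ) (W.subst σ)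
  | _, _, _, .ret V, σ => .ret (V.subst σ)
  | _, _, _, .letIn M N, σ => .letIn (M.subst σ) (N.subst σ.lift)
  | _, _, _, .op o V, σ => .op o (V.subst σ)
  | _, _, _, .handle M H N, σ =>
      .handle (M.subst σ) (fun o => (H o).subst σ.lift.lift) (N.subst σ.lift)
end

/-- The substitution `[V / x]` for the innermost variable `x`. -/
def Subst.one {Op : Type u} {Γ : Ctx Op} {A : VTy Op} (V : Val Γ A) : Subst (A :: Γ) Γ
  | _, .zero => V
  | _, .succ x => .var x

/-- The substitution `[V / x, W / k]` for the two innermost variables `x`, `k`. -/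
def Subst.two {Op : Type u} {Γ : Ctx Op} {A B : VTy Op} (V : Val Γ A) (W : Val Γ B) :
    Subst (B :: A :: Γ) Γ
  | _, .zero => W
  | _, .succ .zero => V
  | _, .succ (.succ x) => .var x

/-! ### Equational theory -/

mutual
/-- Derivable equations `Γ ⊢ V = W : A`. -/
inductive VEq {Op : Type u} : {Γ : Ctx Op} → {A : VTy Op} → Val Γ A → Val Γ A → Prop
  | refl {Γ : Ctx Op} {A : VTy Op} (V : Val Γ A) : VEq V V
  | symm {Γ : Ctx Op} {A : VTy Op} {V W : Val Γ A} : VEq V W → VEq W V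
  | trans {Γ : Ctx Op} {A : VTy Op} {U V W : Val Γ A} : VEq U V → VEq V W → VEq U W
  | lam {Γ : Ctx Op} {A : VTy Op} {C : CTy Op} {M N : Comp (A :: Γ) C} :
      CEq M N → VEq (.lam M) (.lam N)
  | tuple {Γ : Ctx Op} {n : ℕ} {A : Fin n → VTy Op} {V W : ∀ i, Val Γ (A i)} :
      (∀ i, VEq (V i) (W i)) → VEq (.tuple V) (.tuple W)
  | proj {Γ : Ctx Op} {n : ℕ} {A : Fin n → VTy Op} {V W : Val Γ (.prod n A)} (i : Fin n) :
      VEq V W → VEq (.proj V i) (.proj W i)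
  | lam_eta {Γ : Ctx Op} {A : VTy Op} {C : CTy Op} (V : Val Γ (A.arr C)) :
      VEq V (.lam (.app (V.ren Ren.wk) (.var .zero)))
  | prod_beta {Γ : Ctx Op} {n : ℕ} {A : Fin n → VTy Op} (V : ∀ i, Val Γ (A i)) (i : Fin n) :
      VEq (.proj (.tuple V) i) (V i)
  | prod_eta {Γ : Ctx Op} {n : ℕ} {A : Fin n → VTy Op} (V : Val Γ (.prod n A)) :
      VEq V (.tuple (fun i => .proj V i))
/-- Derivable equations `Γ ⊢ M = N : C`. -/
inductive CEq {Op : Type u} : {Γ : Ctx Op} → {C : CTy Op} → Comp Γ C → Comp Γ C → Prop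
  | refl {Γ : Ctx Op} {C : CTy Op} (M : Comp Γ C) : CEq M M
  | symm {Γ : Ctx Op} {C : CTy Op} {M N : Comp Γ C} : CEq M N → CEq N M
  | trans {Γ : Ctx Op} {C : CTy Op} {L M N : Comp Γ C} : CEq L M → CEq M N → CEq L N
  | app {Γ : Ctx Op} {A : VTy Op} {C : CTy Op} {V V' : Val Γ (A.arr C)} {W W' : Val Γ A} :
      VEq V V' → VEq W W' → CEq (.app V W) (.app V' W')
  | ret {Γ : Ctx Op} {A : VTy Op} {S : Sig Op (VTy Op)} {V W : Val Γ A} :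
      VEq V W → CEq (.ret (S := S) V) (.ret W)
  | letIn {Γ : Ctx Op} {A B : VTy Op} {S : Sig Op (VTy Op)} {M M' : Comp Γ ⟨A, S⟩}
      {N N' : Comp (A :: Γ) ⟨B, S⟩} : CEq M M' → CEq N N' → CEq (.letIn M N) (.letIn M' N')
  | op {Γ : Ctx Op} {S : Sig Op (VTy Op)} (o : {o // o ∈ S.dom}) {V W : Val Γ (S.arg o)} :
      VEq V W → CEq (.op o V) (.op o W)
  | handle {Γ : Ctx Op} {A : VTy Op} {S : Sig Op (VTy Op)} {C : CTy Op}
      {M M' : Comp Γ ⟨A, S⟩} {H H' : Handler Γ S C} {N N' : Comp (A :: Γ) C} :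
      CEq M M' → (∀ o, CEq (H o) (H' o)) → CEq N N' → CEq (.handle M H N) (.handle M' H' N')
  | lam_beta {Γ : Ctx Op} {A : VTy Op} {C : CTy Op} (M : Comp (A :: Γ) C) (V : Val Γ A) :
      CEq (.app (.lam M) V) (M.subst (Subst.one V))
  | ret_let {Γ : Ctx Op} {A B : VTy Op} {S : Sig Op (VTy Op)} (V : Val Γ A)
      (M : Comp (A :: Γ) ⟨B, S⟩) : CEq (.letIn (.ret V) M) (M.subst (Subst.one V))
  | let_ret {Γ : Ctx Op} {A : VTy Op} {S : Sig Op (VTy Op)} (M : Comp Γ ⟨A, S⟩) :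
      CEq (.letIn M (.ret (.var .zero))) M
  | let_let {Γ : Ctx Op} {A₁ A₂ A₃ : VTy Op} {S : Sig Op (VTy Op)} (M : Comp Γ ⟨A₁, S⟩)
      (N : Comp (A₁ :: Γ) ⟨A₂, S⟩) (L : Comp (A₂ :: Γ) ⟨A₃, S⟩) :
      CEq (.letIn (.letIn M N) L) (.letIn M (.letIn N (L.ren Ren.wk.lift)))
  | handle_ret {Γ : Ctx Op} {A : VTy Op} {S : Sig Op (VTy Op)} {C : CTy Op} (V : Val Γ A)
      (H : Handler Γ S C) (M : Comp (A :: Γ) C) :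
      CEq (.handle (.ret V) H M) (M.subst (Subst.one V))
  | handle_let {Γ : Ctx Op} {A B : VTy Op} {S : Sig Op (VTy Op)} {C : CTy Op}
      (L : Comp Γ ⟨A, S⟩) (M : Comp (A :: Γ) ⟨B, S⟩) (H : Handler Γ S C) (N : Comp (B :: Γ) C) :
      CEq (.handle (.letIn L M) H N)
        (.handle L H (.handle M (fun o => (H o).ren Ren.wk.lift.lift) (N.ren Ren.wk.lift)))
  | handle_op {Γ : Ctx Op} {S : Sig Op (VTy Op)} {C : CTy Op} (o : {o // o ∈ S.dom})
      (V : Val Γ (S.arg o)) (H : Handler Γ S C) (M : Comp (S.res o :: Γ) C) :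
      CEq (.handle (.op o V) H M) ((H o).subst (Subst.two V (.lam M)))
end

/-- Derivable equations `Γ ⊢ H = H' : Σ ⇒ C`: the congruence rule for handlers, which is already
reflexive, symmetric and transitive. -/
def HEqv {Op : Type u} {Γ : Ctx Op} {S : Sig Op (VTy Op)} {C : CTy Op} (H H' : Handler Γ S C) :
    Prop :=
  ∀ o, CEq (H o) (H' o)

/-! ### Operational semantics -/

/-- Evaluation contexts `𝒞 ::= [] | let x = 𝒞 in N | with H handle 𝒞 to x. M`; an element of
`ECtx Γ D C` has a hole of type `D` and is of type `C`. -/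
inductive ECtx {Op : Type u} (Γ : Ctx Op) (D : CTy Op) : CTy Op → Type u
  | hole : ECtx Γ D D
  | letIn {A B : VTy Op} {S : Sig Op (VTy Op)} (E : ECtx Γ D ⟨A, S⟩)
      (N : Comp (A :: Γ) ⟨B, S⟩) : ECtx Γ D ⟨B, S⟩
  | handle {A : VTy Op} {S : Sig Op (VTy Op)} {C : CTy Op} (E : ECtx Γ D ⟨A, S⟩)
      (H : Handler Γ S C) (M : Comp (A :: Γ) C) : ECtx Γ D C

/-- `𝒞[M]`. -/
def ECtx.plug {Op : Type u} {Γ : Ctx Op} {D : CTy Op} :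
    {C : CTy Op} → ECtx Γ D C → Comp Γ D → Comp Γ C
  | _, .hole, M => M
  | _, .letIn E N, M => .letIn (E.plug M) N
  | _, .handle E H N, M => .handle (E.plug M) H N

/-- Renaming in evaluation contexts. -/
def ECtx.ren {Op : Type u} {Γ Δ : Ctx Op} {D : CTy Op} :
    {C : CTy Op} → ECtx Γ D C → Ren Γ Δ → ECtx Δ D C
  | _, .hole, _ => .hole
  | _, .letIn E N, ρ => .letIn (E.ren ρ) (N.ren ρ.lift)
  | _, .handle E H M, ρ => .handle (E.ren ρ) (fun o => (H o).ren ρ.lift.lift) (M.ren ρ.lift)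

/-- `𝒞` does not contain handle-with (on the path to the hole). -/
def ECtx.HandleFree {Op : Type u} {Γ : Ctx Op} {D : CTy Op} : {C : CTy Op} → ECtx Γ D C → Prop
  | _, .hole => True
  | _, .letIn E _ => E.HandleFree
  | _, .handle _ _ _ => False

/-- The reduction relation `M ⇝ N` on closed computation terms. (In the last rule a handle-free
context has the same signature as its hole, so that both are typed with the signature of `H`.) -/
inductive Red {Op : Type u} : {C : CTy Op} → Comp [] C → Comp [] C → Prop
  | ctx {C D : CTy Op} (E : ECtx [] D C) {M N : Comp [] D} : Red M N → Red (E.plug M) (E.plug N)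
  | ret_let {A B : VTy Op} {S : Sig Op (VTy Op)} (V : Val [] A) (M : Comp [A] ⟨B, S⟩) :
      Red (.letIn (.ret V) M) (M.subst (Subst.one V))
  | lam_beta {A : VTy Op} {C : CTy Op} (M : Comp [A] C) (V : Val [] A) :
      Red (.app (.lam M) V) (M.subst (Subst.one V))
  | handle_ret {A : VTy Op} {S : Sig Op (VTy Op)} {C : CTy Op} (V : Val [] A)
      (H : Handler [] S C) (M : Comp [A] C) :
      Red (.handle (.ret V) H M) (M.subst (Subst.one V))
  | handle_op {A : VTy Op} {S : Sig Op (VTy Op)} {C : CTy Op} (o : {o // o ∈ S.dom})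
      (E : ECtx [] ⟨S.res o, S⟩ ⟨A, S⟩) (hE : E.HandleFree) (V : Val [] (S.arg o))
      (H : Handler [] S C) (M : Comp [A] C) :
      Red (.handle (E.plug (.op o V)) H M)
        ((H o).subst (Subst.two V
          (.lam (.handle ((E.ren Ren.wk).plug (.ret (.var .zero)))
            (fun o' => (H o').ren Ren.wk.lift.lift) (M.ren Ren.wk.lift)))))

/-! ### Models -/

section Products

variable {C : Type v} [Category.{w} C] [CartesianMonoidalCategory C] {ι : Type u}

/-- The product `A i₁ × (A i₂ × ⋯ × 1)` of a family over a list of indices. -/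
def listProd (A : ι → C) (l : List ι) : C := l.foldr (fun i P => A i ⊗ P) (𝟙_ C)

/-- Tupling into `listProd`. -/
def listTuple {X : C} {A : ι → C} (f : ∀ i, X ⟶ A i) : (l : List ι) → (X ⟶ listProd A l)
  | [] => toUnit X
  | i :: l => lift (f i) (listTuple f l)

/-- The projections of `listProd`. -/
def listProj [DecidableEq ι] (A : ι → C) : (l : List ι) → (i : ι) → i ∈ l → (listProd A l ⟶ A i)
  | [], _, h => absurd h List.not_mem_nil
  | j :: l, i, h =>
      if e : i = j then fst (A j) (listProd A l) ≫ eqToHom (congrArg A e.symm)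
      else snd (A j) (listProd A l) ≫ listProj A l i ((List.mem_cons.mp h).resolve_left e)

end Products

/-- The data of a strong Kleisli triple on a cartesian category. -/
structure KleisliData (C : Type v) [Category.{w} C] [CartesianMonoidalCategory C] where
  obj : C → C
  unit (X : C) : X ⟶ obj X
  ext {X Y Z : C} (f : X ⊗ Y ⟶ obj Z) : X ⊗ obj Y ⟶ obj Z

namespace KleisliData

variable {C : Type v} [Category.{w} C] [CartesianMonoidalCategory C] (T : KleisliData C)

/-- The laws of a strong Kleisli triple. -/
structure IsStrongKleisliTriple : Prop where
  ext_unit (X : C) : T.ext ((λ_ X).hom ≫ T.unit X) = (λ_ (T.obj X)).hom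
  unit_ext {X Y Z : C} (f : X ⊗ Y ⟶ T.obj Z) : X ◁ T.unit Y ≫ T.ext f = f
  ext_ext {W X Y Z V : C} (f : X ⊗ Y ⟶ T.obj Z) (g : W ⊗ Z ⟶ T.obj V) :
    (α_ W X (T.obj Y)).hom ≫ W ◁ T.ext f ≫ T.ext g =
      T.ext ((α_ W X Y).hom ≫ W ◁ f ≫ T.ext g)

/-- The action on morphisms of the strong monad of a strong Kleisli triple. -/
def map {X Y : C} (f : X ⟶ Y) : T.obj X ⟶ T.obj Y :=
  (λ_ (T.obj X)).inv ≫ T.ext ((λ_ X).hom ≫ f ≫ T.unit Y)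

/-- The multiplication. -/
def mu (X : C) : T.obj (T.obj X) ⟶ T.obj X :=
  (λ_ (T.obj (T.obj X))).inv ≫ T.ext (λ_ (T.obj X)).hom

/-- The strength. -/
def str (X Y : C) : X ⊗ T.obj Y ⟶ T.obj (X ⊗ Y) := T.ext (T.unit (X ⊗ Y))

end KleisliData

/-- A family of strong Kleisli triples indexed by semantic signatures, with Kleisli exponentials
`exp S Y Z = (Y ⇒ Z)` given by currying and evaluation (data only). -/
structure ClosedData (Op : Type u) (C : Type v) [Category.{w} C]
    [CartesianMonoidalCategory C] where
  T : Sig Op C → KleisliData C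
  exp : Sig Op C → C → C → C
  curry (S : Sig Op C) {X Y Z : C} (f : X ⊗ Y ⟶ (T S).obj Z) : X ⟶ exp S Y Z
  ev (S : Sig Op C) (Y Z : C) : exp S Y Z ⊗ Y ⟶ (T S).obj Z

/-- The object `ℋ_S[X]` of `S`-algebra structures on `X` in the Kleisli category of `T_{S'}`: the
product over `(op : A ⇀ B) ∈ S` of the Kleisli exponentials `A × (B ⇒ X) ⇒ X`. -/
noncomputable def ClosedData.bundle {Op : Type u} {C : Type v} [Category.{w} C]
    [CartesianMonoidalCategory C] (K : ClosedData Op C) (S S' : Sig Op C) (X : C) : C :=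
  listProd (fun o => K.exp S' (S.arg o ⊗ K.exp S' (S.res o) X) X) S.ops

/-- The data of a model of the effect handler calculus. -/
structure ModelData (Op : Type u) (C : Type v) [Category.{w} C] [CartesianMonoidalCategory C]
    extends ClosedData Op C where
  opr (S : Sig Op C) (o : {o // o ∈ S.dom}) : S.arg o ⟶ (T S).obj (S.res o)
  handle (S S' : Sig Op C) (X : C) :
    toClosedData.bundle S S' X ⊗ (T S).obj ((T S').obj X) ⟶ (T S').obj X

namespace ModelData

variable {Op : Type u} [DecidableEq Op] {C : Type v} [Category.{w} C]
  [CartesianMonoidalCategory C] (K : ModelData Op C)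

/-- The projection `π_op : ℋ_S[X] ⟶ (A_op × (B_op ⇒ X) ⇒ X)`. -/
noncomputable def clause (S S' : Sig Op C) (X : C) (o : {o // o ∈ S.dom}) :
    K.bundle S S' X ⟶ K.exp S' (S.arg o ⊗ K.exp S' (S.res o) X) X :=
  listProj (fun o => K.exp S' (S.arg o ⊗ K.exp S' (S.res o) X) X) S.ops o (S.mem_ops o)

/-- The morphism `A_op × (B_op ⇒ X) ⟶ T_S T_{S'} X` induced by the interpretation of `op`. -/
def mixedOp (S S' : Sig Op C) (X : C) (o : {o // o ∈ S.dom}) :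
    S.arg o ⊗ K.exp S' (S.res o) X ⟶ (K.T S).obj ((K.T S').obj X) :=
  K.opr S o ▷ K.exp S' (S.res o) X ≫ lift (snd _ _) (fst _ _) ≫
    (K.T S).str (K.exp S' (S.res o) X) (S.res o) ≫ (K.T S).map (K.ev S' (S.res o) X)

/-- The laws of a model of the effect handler calculus. -/
structure IsModel : Prop where
  strong (S : Sig Op C) : (K.T S).IsStrongKleisliTriple
  curry_ev (S : Sig Op C) {X Y Z : C} (f : X ⊗ Y ⟶ (K.T S).obj Z) :
    K.curry S f ▷ Y ≫ K.ev S Y Z = f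
  curry_uncurry (S : Sig Op C) {X Y Z : C} (g : X ⟶ K.exp S Y Z) :
    K.curry S (g ▷ Y ≫ K.ev S Y Z) = g
  handle_unit (S S' : Sig Op C) (X : C) :
    K.bundle S S' X ◁ (K.T S).unit ((K.T S').obj X) ≫ K.handle S S' X = snd _ _
  handle_mult (S S' : Sig Op C) (X : C) :
    K.bundle S S' X ◁ (K.T S).mu ((K.T S').obj X) ≫ K.handle S S' X =
      lift (fst _ _) ((K.T S).str (K.bundle S S' X) ((K.T S).obj ((K.T S').obj X))) ≫
        K.bundle S S' X ◁ (K.T S).map (K.handle S S' X) ≫ K.handle S S' X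
  handle_op (S S' : Sig Op C) (X : C) (o : {o // o ∈ S.dom}) :
    K.bundle S S' X ◁ K.mixedOp S S' X o ≫ K.handle S S' X =
      K.clause S S' X o ▷ (S.arg o ⊗ K.exp S' (S.res o) X) ≫
        K.ev S' (S.arg o ⊗ K.exp S' (S.res o) X) X

/-! ### Interpretation in a model -/

/-- `⟦A⟧`. -/
def ty : VTy Op → C
  | .fn A B dom arg res => K.exp ⟨dom, fun o => ty (arg o), fun o => ty (res o)⟩ (ty A) (ty B)
  | .prod n A => listProd (fun i => ty (A i)) (List.finRange n)

/-- `⟦Σ⟧`. -/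
def sig (S : Sig Op (VTy Op)) : Sig Op C := S.map K.ty

/-- `T_{⟦Σ⟧} ⟦A⟧`, the object in which computations of type `A ! Σ` are interpreted. -/
def cty (D : CTy Op) : C := (K.T (K.sig D.sig)).obj (K.ty D.ret)

/-- `⟦Γ⟧`. -/
def ctx : Ctx Op → C
  | [] => 𝟙_ C
  | A :: Γ => ctx Γ ⊗ K.ty A

/-- The interpretation of variables. -/
def var : {Γ : Ctx Op} → {A : VTy Op} → Var Γ A → (K.ctx Γ ⟶ K.ty A)
  | _, _, .zero => snd _ _
  | _, _, .succ x => fst _ _ ≫ var x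

mutual
/-- The interpretation `⟦Γ ⊢ V : A⟧ : ⟦Γ⟧ ⟶ ⟦A⟧` of value terms. -/
noncomputable def val : {Γ : Ctx Op} → {A : VTy Op} → Val Γ A → (K.ctx Γ ⟶ K.ty A)
  | _, _, .var x => K.var x
  | _, _, .lam (A := A) (C := D) M =>
      K.curry (K.sig D.sig) (Y := K.ty A) (Z := K.ty D.ret) (comp M)
  | _, _, .tuple (n := n) V => listTuple (fun i => val (V i)) (List.finRange n)
  | _, _, .proj (n := n) (A := A) V i =>
      val V ≫ listProj (fun i => K.ty (A i)) (List.finRange n) i (List.mem_finRange i)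
/-- The interpretation `⟦Γ ⊢ M : A ! Σ⟧ : ⟦Γ⟧ ⟶ T_{⟦Σ⟧} ⟦A⟧` of computation terms. In the last
clause, the first component of the outer pairing is the interpretation of the handler, see
`ModelData.handler`. -/
noncomputable def comp : {Γ : Ctx Op} → {D : CTy Op} → Comp Γ D → (K.ctx Γ ⟶ K.cty D)
  | _, _, .app (A := A) (C := D) V W =>
      lift (val V) (val W) ≫ K.ev (K.sig D.sig) (K.ty A) (K.ty D.ret)
  | _, _, .ret (A := A) (S := S) V => val V ≫ (K.T (K.sig S)).unit (K.ty A)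
  | _, _, .letIn (Γ := Γ) (S := S) M N => lift (𝟙 (K.ctx Γ)) (comp M) ≫ (K.T (K.sig S)).ext (comp N)
  | _, _, .op (S := S) o V => val V ≫ K.opr (K.sig S) o
  | _, _, .handle (Γ := Γ) (A := A) (S := S) (C := D) M H N =>
      lift
        (listTuple (fun o : {o // o ∈ S.dom} =>
          K.curry (K.sig D.sig) ((α_ (K.ctx Γ) (K.ty (S.arg o)) (K.ty ((S.res o).arr D))).inv ≫
            comp (H o))) (K.sig S).ops)
        (lift (𝟙 (K.ctx Γ)) (comp M) ≫ (K.T (K.sig S)).str (K.ctx Γ) (K.ty A) ≫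
          (K.T (K.sig S)).map (comp N)) ≫
      K.handle (K.sig S) (K.sig D.sig) (K.ty D.ret)
end

/-- The interpretation `⟦Γ ⊢ H : Σ ⇒ C⟧ : ⟦Γ⟧ ⟶ ℋ_{⟦Σ⟧}[⟦C⟧]` of handlers. -/
noncomputable def handler {Γ : Ctx Op} {S : Sig Op (VTy Op)} {D : CTy Op} (H : Handler Γ S D) :
    K.ctx Γ ⟶ K.bundle (K.sig S) (K.sig D.sig) (K.ty D.ret) :=
  listTuple (fun o : {o // o ∈ S.dom} =>
    K.curry (K.sig D.sig) ((α_ (K.ctx Γ) (K.ty (S.arg o)) (K.ty ((S.res o).arr D))).inv ≫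
      K.comp (H o))) (K.sig S).ops

end ModelData

end LamEff

/-! ### The typed CPS transformation -/

namespace SysF

open LamEff

/-- The product type `A i₁ × (A i₂ × ⋯ × 1)` of a family over a list of indices. -/
def Ty.listProd {m : ℕ} {ι : Type u} (A : ι → Ty m) (l : List ι) : Ty m :=
  l.foldr (fun i P => .prod (A i) P) .unit

/-- The tuple `⟨t i₁, ⟨t i₂, …⟩⟩` of a family over a list of indices. -/
def Tm.listTuple {m : ℕ} {ι : Type u} (t : ι → Tm m) (l : List ι) : Tm m :=
  l.foldr (fun i r => .pair (t i) r) .star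

/-- The projection at the index `i` out of `Ty.listProd A l`. -/
def Tm.listProj {m : ℕ} {ι : Type u} [DecidableEq ι] : List ι → ι → Tm m → Tm m
  | [], _, t => t
  | j :: l, i, t => if i = j then .fst t else Tm.listProj l i (.snd t)

/-- The type `ℋ_S[β] = ∏_{(op : A ⇀ B) ∈ S} (A × (B → β) → β)`. -/
noncomputable def hTy {m : ℕ} {Op : Type u} (S : Sig Op (Ty m)) (β : Ty m) : Ty m :=
  Ty.listProd (fun o => .arr (.prod (S.arg o) (.arr (S.res o) β)) β) S.ops

/-- The type `D_S X = ∀ β. (X → β) → ℋ_S[β] → β`. -/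
noncomputable def dTy {m : ℕ} {Op : Type u} (S : Sig Op (Ty m)) (X : Ty m) : Ty m :=
  .all (.arr (.arr X.wk (.var 0)) (.arr (hTy (S.map Ty.wk) (.var 0)) (.var 0)))

/-- The term `Λ β. λ k : X → β. λ h : ℋ_S[β]. t`; in `t`, `h` is the variable `0`, `k` is the
variable `1`, and the free variables of the whole term are shifted by `2`. -/
noncomputable def dLam {m : ℕ} {Op : Type u} (S : Sig Op (Ty m)) (X : Ty m) (t : Tm (m + 1)) :
    Tm m :=
  .tlam (.lam (.arr X.wk (.var 0)) (.lam (hTy (S.map Ty.wk) (.var 0)) t))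

/-- Weakening of a term under `Λ β. λ k. λ h.` -/
def Tm.wk2 {m : ℕ} (t : Tm m) : Tm (m + 1) := t.ren Fin.succ (· + 2)

/-- `Λ β. λ k. λ h. k t` -/
noncomputable def dRet {m : ℕ} {Op : Type u} (S : Sig Op (Ty m)) (X : Ty m) (t : Tm m) : Tm m :=
  dLam S X (.app (.var 1) t.wk2)

/-- `Λ β. λ k. λ h. t β (λ x : X. s β k h) h`, where `s` is given in the context extended by
`k`, `h` and `x`. -/
noncomputable def dBind {m : ℕ} {Op : Type u} (S : Sig Op (Ty m)) (X Y : Ty m) (t : Tm m)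
    (s : Tm (m + 1)) : Tm m :=
  dLam S Y (.app (.app (.tapp t.wk2 (.var 0))
    (.lam X.wk (.app (.app (.tapp s (.var 0)) (.var 2)) (.var 1)))) (.var 0))

/-- `Λ β. λ k. λ h. π_op h ⟨t, k⟩` -/
noncomputable def dOp {m : ℕ} {Op : Type u} [DecidableEq Op] (S : Sig Op (Ty m))
    (o : {o // o ∈ S.dom}) (t : Tm m) : Tm m :=
  dLam S (S.res o) (.app (Tm.listProj S.ops o (.var 0)) (.pair t.wk2 (.var 1)))

theorem Ty.listProd_subst {m n : ℕ} {ι : Type u} (A : ι → Ty m) (l : List ι) (θ : Fin m → Ty n) :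
    (Ty.listProd A l).subst θ = Ty.listProd (fun i => (A i).subst θ) l := by
  induction l with
  | nil => rfl
  | cons i l ih => exact congrArg _ ih

theorem hTy_subst {m n : ℕ} {Op : Type u} (S : Sig Op (Ty m)) (β : Ty m) (θ : Fin m → Ty n) :
    (hTy S β).subst θ = hTy (S.map (fun A => A.subst θ)) (β.subst θ) := by
  rw [hTy, Ty.listProd_subst]; rfl

theorem hTy_wk_inst {m : ℕ} {Op : Type u} (S : Sig Op (Ty m)) (B : Ty m) :
    (hTy (S.map Ty.wk) (.var 0)).inst B = hTy S B := by
  rw [Ty.inst, hTy_subst]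
  have : (S.map Ty.wk).map (fun A => A.subst (instT B)) = S := by
    simp only [Sig.map]
    exact congrArg₂ (Sig.mk S.dom) (funext fun o => Ty.wk_inst _ B) (funext fun o => Ty.wk_inst _ B)
  rw [this]; rfl

theorem HasType.listTuple {m : ℕ} {Γ : List (Ty m)} {ι : Type u} {t : ι → Tm m} {A : ι → Ty m}
    (h : ∀ i, HasType Γ (t i) (A i)) (l : List ι) :
    HasType Γ (Tm.listTuple t l) (Ty.listProd A l) := by
  induction l with
  | nil => exact .star
  | cons i l ih => exact .pair (h i) ih

theorem HasType.listProj {m : ℕ} {Γ : List (Ty m)} {ι : Type u} [DecidableEq ι] {A : ι → Ty m}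
    {i : ι} {l : List ι} (hi : i ∈ l) {t : Tm m} (h : HasType Γ t (Ty.listProd A l)) :
    HasType Γ (Tm.listProj l i t) (A i) := by
  induction l generalizing t with
  | nil => simp at hi
  | cons j l ih =>
    rw [Tm.listProj]
    split
    · next e => subst e; exact .fst h
    · next e => exact ih ((List.mem_cons.mp hi).resolve_left e) (.snd h)

theorem HasType.dLam {m : ℕ} {Op : Type u} {S : Sig Op (Ty m)} {X : Ty m} {t : Tm (m + 1)}
    {Γ : List (Ty m)}
    (h : HasType (hTy (S.map Ty.wk) (.var 0) :: .arr X.wk (.var 0) :: Γ.map Ty.wk) t (.var 0)) :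
    HasType Γ (SysF.dLam S X t) (dTy S X) := .tlam (.lam (.lam h))

theorem BEq.dLam {m : ℕ} {Op : Type u} {S : Sig Op (Ty m)} {X : Ty m} {t t' : Tm (m + 1)}
    {Γ : List (Ty m)}
    (h : BEq (hTy (S.map Ty.wk) (.var 0) :: .arr X.wk (.var 0) :: Γ.map Ty.wk) t t' (.var 0)) :
    BEq Γ (SysF.dLam S X t) (SysF.dLam S X t') (dTy S X) := .tlam (.lam (.lam h))

theorem HasType.wk2 {m : ℕ} {Γ : List (Ty m)} {t : Tm m} {A : Ty m} (h : HasType Γ t A)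
    (B C : Ty (m + 1)) : HasType (B :: C :: Γ.map Ty.wk) t.wk2 A.wk :=
  h.ren (fun i D hD => by simp [hD, Ty.wk])

theorem dTy_body_inst {m : ℕ} {Op : Type u} (S : Sig Op (Ty m)) (X B : Ty m) :
    (Ty.arr (.arr X.wk (.var 0)) (.arr (hTy (S.map Ty.wk) (.var 0)) (.var 0))).inst B =
      .arr (.arr X B) (.arr (hTy S B) B) := by
  rw [← hTy_wk_inst S B]
  conv_rhs => rw [← Ty.wk_inst X B]
  rfl

theorem HasType.tapp_dTy {m : ℕ} {Op : Type u} {S : Sig Op (Ty m)} {X : Ty m} {t : Tm m}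
    {Γ : List (Ty m)} (h : HasType Γ t (dTy S X)) (B : Ty m) :
    HasType Γ (.tapp t B) (.arr (.arr X B) (.arr (hTy S B) B)) :=
  dTy_body_inst S X B ▸ HasType.tapp B h

theorem BEq.tapp_dTy {m : ℕ} {Op : Type u} {S : Sig Op (Ty m)} {X : Ty m} {t t' : Tm m}
    {Γ : List (Ty m)} (h : BEq Γ t t' (dTy S X)) (B : Ty m) :
    BEq Γ (.tapp t B) (.tapp t' B) (.arr (.arr X B) (.arr (hTy S B) B)) :=
  dTy_body_inst S X B ▸ BEq.tapp B h

theorem dTy_wk {m : ℕ} {Op : Type u} (S : Sig Op (Ty m)) (X : Ty m) :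
    (dTy S X).wk = dTy (S.map Ty.wk) X.wk := by
  have e : ∀ A : Ty m, A.wk.wk = A.wk.ren (upR Fin.succ) := fun A => Ty.ren_wk _ A
  have e' : (hTy (S.map Ty.wk) (.var 0)).ren (upR Fin.succ) =
      hTy ((S.map Ty.wk).map Ty.wk) (.var 0) := by
    rw [Ty.ren_eq, hTy_subst]
    simp only [Sig.map, ← Ty.ren_eq, ← e]
    rfl
  show Ty.all (.arr (.arr (X.wk.ren (upR Fin.succ)) (.var 0))
    (.arr ((hTy (S.map Ty.wk) (.var 0)).ren (upR Fin.succ)) (.var 0))) = _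
  rw [e', ← e]; rfl

theorem HasType.dRet {m : ℕ} {Op : Type u} (S : Sig Op (Ty m)) {X : Ty m} {t : Tm m}
    {Γ : List (Ty m)} (h : HasType Γ t X) : HasType Γ (SysF.dRet S X t) (dTy S X) :=
  .dLam (.app (.var rfl) (h.wk2 _ _))

theorem HasType.dBind {m : ℕ} {Op : Type u} {S : Sig Op (Ty m)} {X Y : Ty m} {t : Tm m}
    {s : Tm (m + 1)} {Γ : List (Ty m)} (ht : HasType Γ t (dTy S X))
    (hs : HasType (X.wk :: hTy (S.map Ty.wk) (.var 0) :: .arr Y.wk (.var 0) :: Γ.map Ty.wk) s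
      (dTy S Y).wk) :
    HasType Γ (SysF.dBind S X Y t s) (dTy S Y) := by
  refine .dLam (.app (.app (HasType.tapp_dTy (S := S.map Ty.wk) (X := X.wk) ?_ _)
    (.lam (.app (.app (HasType.tapp_dTy (S := S.map Ty.wk) (X := Y.wk) ?_ _)
      (.var rfl)) (.var rfl)))) (.var rfl))
  · rw [← dTy_wk]; exact ht.wk2 _ _
  · rw [← dTy_wk]; exact hs

theorem HasType.dOp {m : ℕ} {Op : Type u} [DecidableEq Op] {S : Sig Op (Ty m)}
    (o : {o // o ∈ S.dom}) {t : Tm m} {Γ : List (Ty m)} (h : HasType Γ t (S.arg o)) :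
    HasType Γ (SysF.dOp S o t) (dTy S (S.res o)) := by
  refine .dLam (.app (A := .prod (S.arg o).wk (.arr (S.res o).wk (.var 0))) ?_
    (.pair (h.wk2 _ _) (.var rfl)))
  exact HasType.listProj (ι := {o // o ∈ S.dom})
    (A := fun o => .arr (.prod (S.arg o).wk (.arr (S.res o).wk (.var 0))) (.var 0))
    (S.mem_ops o) (.var rfl)

end SysF

namespace LamEff

open SysF

/-- The CPS transformation of value types. -/
noncomputable def VTy.cps {Op : Type u} : VTy Op → Ty 0
  | .fn A B dom arg res =>
      .arr A.cps (dTy ⟨dom, fun o => (arg o).cps, fun o => (res o).cps⟩ B.cps)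
  | .prod n A => Ty.listProd (fun i => (A i).cps) (List.finRange n)

/-- The CPS transformation of signatures. -/
noncomputable def Sig.cps {Op : Type u} (S : Sig Op (VTy Op)) : Sig Op (Ty 0) := S.map VTy.cps

/-- The CPS transformation of computation types:
`A ! Σ` is sent to `∀ β. (A.cps → β) → ℋ_Σ[β] → β`. -/
noncomputable def CTy.cps {Op : Type u} (C : CTy Op) : Ty 0 := dTy C.sig.cps C.ret.cps

/-- The CPS transformation of contexts. -/
noncomputable def Ctx.cps {Op : Type u} (Γ : Ctx Op) : List (Ty 0) := Γ.map VTy.cps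

/-- The de Bruijn index of a variable. -/
def Var.idx {Op : Type u} : {Γ : Ctx Op} → {A : VTy Op} → Var Γ A → ℕ
  | _, _, .zero => 0
  | _, _, .succ x => x.idx + 1

/-- The substitution `[π₁ z / x, π₂ z / k]` turning a term with innermost variables `x`, `k` into
one with innermost variable `z`. -/
def unpair : ℕ → Tm 0
  | 0 => .snd (.var 0)
  | 1 => .fst (.var 0)
  | i + 2 => .var (i + 1)

mutual
/-- The CPS transformation of value terms. -/
noncomputable def Val.cps {Op : Type u} [DecidableEq Op] :
    {Γ : Ctx Op} → {A : VTy Op} → Val Γ A → Tm 0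
  | _, _, .var x => .var x.idx
  | _, _, .lam (A := A) M => .lam A.cps M.cps
  | _, _, .tuple (n := n) V => Tm.listTuple (fun i => (V i).cps) (List.finRange n)
  | _, _, .proj (n := n) (A := _) V i => Tm.listProj (List.finRange n) i V.cps
/-- The CPS transformation of computation terms. -/
noncomputable def Comp.cps {Op : Type u} [DecidableEq Op] :
    {Γ : Ctx Op} → {C : CTy Op} → Comp Γ C → Tm 0
  | _, _, .app V W => .app V.cps W.cps
  | _, _, .ret (A := A) (S := S) V => dRet S.cps A.cps V.cps
  | _, _, .letIn (A := A) (B := B) (S := S) M N =>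
      dBind S.cps A.cps B.cps M.cps (N.cps.ren Fin.succ (upV (· + 2)))
  | _, _, .op (S := S) o V => dOp S.cps o V.cps
  | _, _, .handle (A := A) (S := S) (C := C) M H N =>
      .app (.app (.tapp M.cps C.cps) (.lam A.cps N.cps))
        (Tm.listTuple (fun o : {o // o ∈ S.dom} =>
          .lam (.prod (S.arg o).cps (.arr (S.res o).cps C.cps))
            ((H o).cps.subst Ty.var unpair)) S.cps.ops)
end

/-- The CPS transformation of handlers: the tuple of the terms `λ ⟨x, k⟩. M_op`. -/
noncomputable def Handler.cps {Op : Type u} [DecidableEq Op] {Γ : Ctx Op} {S : Sig Op (VTy Op)}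
    {C : CTy Op} (H : Handler Γ S C) : Tm 0 :=
  Tm.listTuple (fun o : {o // o ∈ S.dom} =>
    .lam (.prod (S.arg o).cps (.arr (S.res o).cps C.cps)) ((H o).cps.subst Ty.var unpair))
    S.cps.ops

theorem Var.idx_get {Op : Type u} {Γ : Ctx Op} {A : VTy Op} (x : Var Γ A) :
    (Ctx.cps Γ)[x.idx]? = some A.cps := by
  induction x with
  | zero => rfl
  | succ x ih => exact ih

theorem hasType_clause {Γ : List (Ty 0)} {A B C : Ty 0} {t : Tm 0}
    (h : HasType (.arr B C :: A :: Γ) t C) :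
    HasType Γ (.lam (.prod A (.arr B C)) (t.subst Ty.var unpair)) (.arr (.prod A (.arr B C)) C) := by
  refine .lam (h.subst₀ (fun i D hD => ?_))
  match i with
  | 0 => simp only [List.getElem?_cons_zero, Option.some.injEq] at hD; subst hD
         exact .snd (.var rfl)
  | 1 => simp only [List.getElem?_cons_succ, List.getElem?_cons_zero, Option.some.injEq] at hD
         subst hD; exact .fst (.var rfl)
  | i + 2 => exact .var hD

mutual
/-- The CPS transform of `Γ ⊢ V : A` is of type `A.cps` in context `Γ.cps`. -/
theorem Val.cps_hasType {Op : Type u} [DecidableEq Op] : {Γ : Ctx Op} → {A : VTy Op} →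
    (V : Val Γ A) → HasType (Ctx.cps Γ) V.cps A.cps
  | _, _, .var x => .var x.idx_get
  | _, _, .lam M => .lam M.cps_hasType
  | _, _, .tuple V => .listTuple (fun i => (V i).cps_hasType) _
  | _, _, .proj (A := A) V i =>
      HasType.listProj (A := fun i => (A i).cps) (List.mem_finRange i) V.cps_hasType
/-- The CPS transform of `Γ ⊢ M : C` is of type `C.cps` in context `Γ.cps`. -/
theorem Comp.cps_hasType {Op : Type u} [DecidableEq Op] : {Γ : Ctx Op} → {C : CTy Op} →
    (M : Comp Γ C) → HasType (Ctx.cps Γ) M.cps C.cps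
  | _, _, .app V W => .app V.cps_hasType W.cps_hasType
  | _, _, .ret V => .dRet _ V.cps_hasType
  | _, _, .letIn M N => .dBind M.cps_hasType (N.cps_hasType.ren (fun i D hD => by
      match i with
      | 0 => simp_all [upV, Ctx.cps, Ty.wk]
      | i + 1 =>
        simp only [upV, Ctx.cps, List.getElem?_cons_succ, List.map_cons, List.getElem?_map,
          Option.map_eq_some_iff] at hD ⊢
        obtain ⟨B, hB, rfl⟩ := hD
        exact ⟨_, ⟨B, hB, rfl⟩, rfl⟩))
  | _, _, .op (S := S) o V => HasType.dOp (S := S.cps) o V.cps_hasType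
  | _, _, .handle (S := S) (C := C) M H N =>
      .app (.app (HasType.tapp_dTy M.cps_hasType C.cps) (.lam N.cps_hasType))
        (HasType.listTuple (fun o => hasType_clause (H o).cps_hasType) _)
end

/-- The CPS transform of `Γ ⊢ H : Σ ⇒ C` is of type `ℋ_Σ[C.cps]` in context `Γ.cps`. -/
theorem Handler.cps_hasType {Op : Type u} [DecidableEq Op] {Γ : Ctx Op} {S : Sig Op (VTy Op)}
    {C : CTy Op} (H : Handler Γ S C) : HasType (Ctx.cps Γ) (Handler.cps H) (hTy S.cps C.cps) :=
  HasType.listTuple (fun o => hasType_clause (H o).cps_hasType) _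

/-! ### The CPS model -/

/-- The body of the strong Kleisli extension: `t[⟨x₁, x₂⟩]` in a context with innermost variable
`x₂` where `x₁` is the first component of the variable `3`. -/
def extBody (t : Tm 0) : Tm 1 := t.twk.subst Ty.var (fun _ => .pair (.fst (.var 3)) (.var 0))

theorem hasType_extBody {A B C : Ty 0} {t : Tm 0} {X Y : Ty 1} {P : Ty 0}
    (h : HasType [.prod A B] t C) :
    HasType [B.wk, X, Y, (Ty.prod A P).wk] (extBody t) C.wk :=
  h.twk.subst₀ (forall_single (P := fun D => HasType [B.wk, X, Y, (Ty.prod A P).wk] _ D)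
    (.pair (.fst (B := P.wk) (.var rfl)) (.var rfl)))

theorem beq_extBody {A B C : Ty 0} {t t' : Tm 0} {X Y : Ty 1} {P : Ty 0}
    (h : BEq [.prod A B] t t' C) :
    BEq [B.wk, X, Y, (Ty.prod A P).wk] (extBody t) (extBody t') C.wk := by
  have := h.twk.subst (θ := Ty.var) (Δ := [B.wk, X, Y, (Ty.prod A P).wk])
    (σ := fun _ => .pair (.fst (.var 3)) (.var 0)) (by
      simp only [Ty.subst_var]
      exact forall_single (P := fun D => HasType [B.wk, X, Y, (Ty.prod A P).wk] _ D)
        (.pair (.fst (B := P.wk) (.var rfl)) (.var rfl)))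
  rwa [Ty.subst_var] at this

theorem beq_dBind {Op : Type u} {S : Sig Op (Ty 0)} {X Y : Ty 0} {t : Tm 0}
    {s s' : Tm 1} {Γ : List (Ty 0)} (ht : HasType Γ t (dTy S X))
    (hs : BEq (X.wk :: hTy (S.map Ty.wk) (.var 0) :: .arr Y.wk (.var 0) :: Γ.map Ty.wk) s s'
      (dTy S Y).wk) :
    BEq Γ (dBind S X Y t s) (dBind S X Y t s') (dTy S Y) := by
  refine .dLam (.app (.app (.refl (HasType.tapp_dTy (S := S.map Ty.wk) (X := X.wk) ?_ _))
    (.lam (.app (.app (BEq.tapp_dTy (S := S.map Ty.wk) (X := Y.wk) ?_ _)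
      (.refl (.var rfl))) (.refl (.var rfl))))) (.refl (.var rfl)))
  · rw [← dTy_wk]; exact ht.wk2 _ _
  · rw [← dTy_wk]; exact hs

/-- `t[⟨x, y⟩]` where `x` is the variable `1` and `y` the variable `0`. -/
def curBody (t : Tm 0) : Tm 0 := t.subst Ty.var (fun _ => .pair (.var 1) (.var 0))

/-- The strong monad `D_S` as a strong Kleisli triple on the category of closed System F types. -/
noncomputable def dKleisli {Op : Type u} (S : Sig Op (Ty 0)) : KleisliData (Ty 0) where
  obj X := dTy S X
  unit X := mk (dRet S X (.var 0)) (.dRet S (.var rfl))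
  ext {X Y Z} := Quotient.map (sa := TTm.setoid [.prod X Y] (dTy S Z))
    (sb := TTm.setoid [.prod X (dTy S Y)] (dTy S Z))
    (fun t => ⟨dBind S Y Z (.snd (.var 0)) (extBody t.1),
      .dBind (.snd (.var rfl)) (hasType_extBody t.2)⟩)
    (fun _ _ h => beq_dBind (.snd (.var rfl)) (beq_extBody h))

/-- The CPS model on the category of closed System F types. -/
noncomputable def cpsModel (Op : Type u) [DecidableEq Op] : ModelData Op (Ty 0) where
  T := dKleisli
  exp S Y Z := .arr Y (dTy S Z)
  curry S {X Y Z} := Quotient.map (sa := TTm.setoid [.prod X Y] (dTy S Z))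
    (sb := TTm.setoid [X] (.arr Y (dTy S Z)))
    (fun t => ⟨.lam Y (curBody t.1), .lam (t.2.subst₀
      (forall_single (P := fun D => HasType [Y, X] _ D) (.pair (.var rfl) (.var rfl))))⟩)
    (fun t _ h => .lam (BEq.subst₀ h t.2
      (forall_single (P := fun D => HasType [Y, X] _ D) (.pair (.var rfl) (.var rfl)))
      (forall_single (P := fun D => BEq [Y, X] _ _ D) (.refl (.pair (.var rfl) (.var rfl))))))
  ev S Y Z := mk (A := .prod (.arr Y (dTy S Z)) Y) (.app (.fst (.var 0)) (.snd (.var 0)))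
    (.app (.fst (.var rfl)) (.snd (.var rfl)))
  opr S o := mk (dOp S o (.var 0)) (.dOp o (.var rfl))
  handle S S' X := mk (A := .prod (hTy S (dTy S' X)) (dTy S (dTy S' X))) (B := dTy S' X)
    (.app (.app (.tapp (.snd (.var 0)) (dTy S' X)) (.lam (dTy S' X) (.var 0))) (.fst (.var 0)))
    (.app (.app (HasType.tapp_dTy (.snd (.var rfl)) _) (.lam (.var rfl))) (.fst (.var rfl)))

/-- In the CPS model, value types are interpreted as their CPS transforms. -/
theorem cpsModel_ty {Op : Type u} [DecidableEq Op] :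
    (A : VTy Op) → (cpsModel Op).ty A = A.cps
  | .fn A B dom arg res => by
      have h₁ : (fun o => (cpsModel Op).ty (arg o)) = fun o => (arg o).cps :=
        funext fun o => cpsModel_ty (arg o)
      have h₂ : (fun o => (cpsModel Op).ty (res o)) = fun o => (res o).cps :=
        funext fun o => cpsModel_ty (res o)
      show Ty.arr ((cpsModel Op).ty A) (dTy ⟨dom, fun o => (cpsModel Op).ty (arg o),
        fun o => (cpsModel Op).ty (res o)⟩ ((cpsModel Op).ty B)) = _
      rw [h₁, h₂, cpsModel_ty A, cpsModel_ty B]; rfl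
  | .prod n A => by
      have h : (fun i => (cpsModel Op).ty (A i)) = fun i => (A i).cps :=
        funext fun i => cpsModel_ty (A i)
      show Ty.listProd (fun i => (cpsModel Op).ty (A i)) (List.finRange n) = _
      rw [h]; rfl

theorem cpsModel_sig {Op : Type u} [DecidableEq Op] (S : Sig Op (VTy Op)) :
    (cpsModel Op).sig S = S.cps :=
  congrArg (fun f => S.map f) (funext cpsModel_ty)

theorem cpsModel_cty {Op : Type u} [DecidableEq Op] (C : CTy Op) :
    (cpsModel Op).cty C = C.cps := by
  show dTy ((cpsModel Op).sig C.sig) ((cpsModel Op).ty C.ret) = dTy C.sig.cps C.ret.cps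
  rw [cpsModel_sig, cpsModel_ty]

theorem cpsModel_bundle {Op : Type u} [DecidableEq Op] (S : Sig Op (VTy Op)) (C : CTy Op) :
    (cpsModel Op).bundle ((cpsModel Op).sig S) ((cpsModel Op).sig C.sig) ((cpsModel Op).ty C.ret) =
      hTy S.cps C.cps := by
  show hTy ((cpsModel Op).sig S) (dTy ((cpsModel Op).sig C.sig) ((cpsModel Op).ty C.ret)) =
    hTy S.cps (dTy C.sig.cps C.ret.cps)
  rw [cpsModel_sig, cpsModel_sig, cpsModel_ty]

theorem cpsModel_ctx {Op : Type u} [DecidableEq Op] :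
    (Γ : Ctx Op) → (cpsModel Op).ctx Γ = ctxTy (Ctx.cps Γ)
  | [] => rfl
  | A :: Γ => by
      show Ty.prod ((cpsModel Op).ctx Γ) ((cpsModel Op).ty A) =
        Ty.prod (ctxTy (Ctx.cps Γ)) A.cps
      rw [cpsModel_ctx Γ, cpsModel_ty A]

end LamEff

open LamEff

/-!
A morphism of the term model acts on the System F terms of its domain, and equality of morphisms
can be tested on a pairing of variables. A term of type `D_S X` is determined up to `βη` by its
runs `t β k h`, and running a unit, an operation or a `let` is a short `β`-computation, so every
law of a `λ_eff`-model reduces to comparing two runs.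

By induction on typing, the interpretation of a term sends the tuple of the variables of its
context to its CPS transform, which identifies it with the class of the latter. The transformation
commutes with substitution, and each equational law of `λ_eff` becomes one of the same
`β`-computations. Reduction is contained in derivable equality: a handle-free evaluation context
around `M` is derivably equal to a `let` that runs `M` first, which turns the reduction of a
handled operation into the two handler equations.
-/

namespace SysF

variable {m n : ℕ} {Op : Type u}

/-! ### Substitutions -/

section Substitution

theorem forall_getElem?_cons {α : Type u} {a : α} {l : List α} {P : ℕ → α → Prop}
    (h₀ : P 0 a) (h : ∀ i b, l[i]? = some b → P (i + 1) b) :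
    ∀ i b, (a :: l)[i]? = some b → P i b
  | 0, _, hb => by
    simp only [List.getElem?_cons_zero, Option.some.injEq] at hb
    exact hb ▸ h₀
  | i + 1, b, hb => h i b hb

theorem forall_getElem?_map {α : Type u} {β : Type v} {f : α → β} {l : List α}
    {P : ℕ → β → Prop} (h : ∀ i a, l[i]? = some a → P i (f a)) :
    ∀ i b, (l.map f)[i]? = some b → P i b := by
  intro i b hb
  simp only [List.getElem?_map, Option.map_eq_some_iff] at hb
  obtain ⟨a, ha, rfl⟩ := hb
  exact h i a ha

/-- `σ` is a well-typed substitution of terms in context `Δ` for the variables of `Γ`. -/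
abbrev IsSubst (Γ Δ : List (Ty m)) (σ : ℕ → Tm m) : Prop :=
  ∀ i A, Γ[i]? = some A → HasType Δ (σ i) A

/-- The substitution `s, σ 0, σ 1, …`. -/
def scons (s : Tm m) (σ : ℕ → Tm m) : ℕ → Tm m
  | 0 => s
  | i + 1 => σ i

variable {Γ Δ : List (Ty m)} {A B C : Ty m} {s t : Tm m} {σ : ℕ → Tm m}

theorem IsSubst.id (Γ : List (Ty m)) : IsSubst Γ Γ Tm.var := fun _ _ h => .var h

theorem IsSubst.scons (hs : HasType Δ s A) (hσ : IsSubst Γ Δ σ) :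
    IsSubst (A :: Γ) Δ (scons s σ) :=
  forall_getElem?_cons hs hσ

theorem IsSubst.upS (hσ : IsSubst Γ Δ σ) (A : Ty m) : IsSubst (A :: Γ) (A :: Δ) (upS σ) :=
  forall_getElem?_cons (.var rfl) fun i C hC => (hσ i C hC).wk A

theorem IsSubst.single (hs : HasType Δ s A) : IsSubst [A] Δ fun _ => s :=
  forall_single (P := fun D => HasType Δ s D) hs

theorem IsSubst.instS (hs : HasType Γ s A) : IsSubst (A :: Γ) Γ (instS s) :=
  forall_getElem?_cons hs fun _ _ h => .var h

theorem IsSubst.ctxProj (ht : HasType Δ t (ctxTy Γ)) : IsSubst Γ Δ fun i => ctxProj i t :=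
  fun i A hA => hasType_ctxProj Γ i A hA ht

theorem instS_eq_scons (s : Tm m) : instS s = scons s Tm.var := by
  funext i; cases i <;> rfl

theorem Tm.inst_eq_subst (t s : Tm m) : t.inst s = t.subst Ty.var (scons s Tm.var) := by
  rw [Tm.inst, instS_eq_scons]

theorem Tm.subst_eq_self (t : Tm m) {θ : Fin m → Ty m} {σ : ℕ → Tm m} (hθ : θ = Ty.var)
    (hσ : σ = Tm.var) : t.subst θ σ = t := by
  rw [hθ, hσ, Tm.subst_var]

theorem Tm.wk_subst (t : Tm m) (θ : Fin m → Ty n) (σ : ℕ → Tm n) :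
    t.wk.subst θ σ = t.subst θ fun i => σ (i + 1) := Tm.subst_ren _ _ _ _ _

theorem Tm.wk_eq_subst (t : Tm m) : t.wk = t.subst Ty.var fun i => .var (i + 1) :=
  Tm.ren_eq _ _ _

theorem Tm.wk_subst_scons (t s : Tm m) (σ : ℕ → Tm m) :
    t.wk.subst Ty.var (scons s σ) = t.subst Ty.var σ := t.wk_subst _ _

theorem Tm.wk2_subst (t : Tm m) (θ : Fin (m + 1) → Ty n) (σ : ℕ → Tm n) :
    t.wk2.subst θ σ = t.subst (θ ∘ Fin.succ) fun i => σ (i + 2) := Tm.subst_ren _ _ _ _ _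

theorem Tm.wk2_subst_instT (t : Tm m) (B : Ty m) (k h : Tm m) :
    t.wk2.subst (instT B) (scons h (scons k Tm.var)) = t := by
  rw [Tm.wk2_subst]; exact t.subst_eq_self rfl rfl

theorem Tm.subst_wk2 (t : Tm m) (θ : Fin m → Ty n) (σ : ℕ → Tm n) :
    (t.subst θ σ).wk2 = t.wk2.subst (upT θ) (upS (upS fun i => (σ i).twk)) := by
  simp only [Tm.wk2, Tm.ren_subst, Tm.subst_ren]
  congr 1; funext i
  simp only [SysF.upS, Tm.wk, Tm.twk, Tm.ren_ren, Function.comp_def, id_eq]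

theorem Ty.ren_upR_succ_inst (A : Ty (m + 1)) : (A.ren (upR Fin.succ)).inst (.var 0) = A := by
  have e : instT (.var 0) ∘ upR Fin.succ = (Ty.var : Fin (m + 1) → Ty (m + 1)) :=
    funext fun i => Fin.cases rfl (fun _ => rfl) i
  rw [Ty.inst, Ty.subst_ren, e, Ty.subst_var]

theorem BEq.hasType {t' : Tm m} (h : BEq Γ t t' A) : HasType Γ t A ∧ HasType Γ t' A := by
  induction h with
  | refl h => exact ⟨h, h⟩
  | symm _ ih => exact ih.symm
  | trans _ _ ih₁ ih₂ => exact ⟨ih₁.1, ih₂.2⟩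
  | pair _ _ ih₁ ih₂ => exact ⟨.pair ih₁.1 ih₂.1, .pair ih₁.2 ih₂.2⟩
  | fst _ ih => exact ⟨.fst ih.1, .fst ih.2⟩
  | snd _ ih => exact ⟨.snd ih.1, .snd ih.2⟩
  | lam _ ih => exact ⟨.lam ih.1, .lam ih.2⟩
  | app _ _ ih₁ ih₂ => exact ⟨.app ih₁.1 ih₂.1, .app ih₁.2 ih₂.2⟩
  | tlam _ ih => exact ⟨.tlam ih.1, .tlam ih.2⟩
  | tapp B _ ih => exact ⟨.tapp B ih.1, .tapp B ih.2⟩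
  | unit_eta h => exact ⟨h, .star⟩
  | fst_beta h₁ h₂ => exact ⟨.fst (.pair h₁ h₂), h₁⟩
  | snd_beta h₁ h₂ => exact ⟨.snd (.pair h₁ h₂), h₂⟩
  | pair_eta h => exact ⟨h, .pair (.fst h) (.snd h)⟩
  | lam_beta h₁ h₂ => exact ⟨.app (.lam h₁) h₂, h₁.subst₀ (IsSubst.instS h₂)⟩
  | lam_eta h => exact ⟨h, .lam (.app (h.wk _) (.var rfl))⟩
  | tlam_beta B h =>
    refine ⟨.tapp B (.tlam h), h.subst (forall_getElem?_map fun i C hC => .var ?_)⟩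
    exact hC.trans (congrArg some (Ty.wk_inst C B).symm)
  | @tlam_eta _ _ _ A h =>
    have h' := HasType.tapp (A := A.ren (upR Fin.succ)) (.var 0) h.twk
    rw [Ty.ren_upR_succ_inst] at h'
    exact ⟨h, .tlam h'⟩

end Substitution

/-! ### Finite products -/

section ListProd

variable {ι : Type w} {Γ : List (Ty m)} {A : ι → Ty m} {l : List ι}

theorem Tm.listTuple_subst (t : ι → Tm m) (l : List ι) (θ : Fin m → Ty n) (σ : ℕ → Tm n) :
    (Tm.listTuple t l).subst θ σ = Tm.listTuple (fun i => (t i).subst θ σ) l := by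
  induction l with
  | nil => rfl
  | cons i l ih => exact congrArg (Tm.pair _) ih

protected theorem BEq.listTuple {t t' : ι → Tm m} (h : ∀ i ∈ l, BEq Γ (t i) (t' i) (A i)) :
    BEq Γ (Tm.listTuple t l) (Tm.listTuple t' l) (Ty.listProd A l) := by
  induction l with
  | nil => exact .refl .star
  | cons i l ih =>
    exact .pair (h i List.mem_cons_self) (ih fun j hj => h j (List.mem_cons_of_mem i hj))

variable [DecidableEq ι] {i : ι}

theorem Tm.listProj_subst (l : List ι) (i : ι) (t : Tm m) (θ : Fin m → Ty n) (σ : ℕ → Tm n) :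
    (Tm.listProj l i t).subst θ σ = Tm.listProj l i (t.subst θ σ) := by
  induction l generalizing t with
  | nil => rfl
  | cons j l ih =>
    simp only [Tm.listProj]
    split
    · rfl
    · rw [ih]; rfl

protected theorem BEq.listProj (hi : i ∈ l) {t t' : Tm m} (h : BEq Γ t t' (Ty.listProd A l)) :
    BEq Γ (Tm.listProj l i t) (Tm.listProj l i t') (A i) := by
  induction l generalizing t t' with
  | nil => cases hi
  | cons j l ih =>
    simp only [Tm.listProj]
    split
    · next e => subst e; exact .fst h
    · next e => exact ih ((List.mem_cons.mp hi).resolve_left e) (.snd h)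

theorem BEq.listProj_listTuple {t : ι → Tm m} (h : ∀ i, HasType Γ (t i) (A i)) (hi : i ∈ l) :
    BEq Γ (Tm.listProj l i (Tm.listTuple t l)) (t i) (A i) := by
  induction l with
  | nil => cases hi
  | cons j l ih =>
    simp only [Tm.listProj]
    split
    · next e => subst e; exact .fst_beta (h _) (.listTuple h l)
    · next e =>
      have hl := (List.mem_cons.mp hi).resolve_left e
      exact (BEq.listProj hl (.snd_beta (h j) (.listTuple h l))).trans (ih hl)

theorem BEq.listTuple_listProj (hl : l.Nodup) {t : Tm m} (h : HasType Γ t (Ty.listProd A l)) :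
    BEq Γ (Tm.listTuple (fun i => Tm.listProj l i t) l) t (Ty.listProd A l) := by
  induction l generalizing t with
  | nil => exact (BEq.unit_eta h).symm
  | cons j l ih =>
    rw [List.nodup_cons] at hl
    refine BEq.trans (.pair ?_ (.trans (BEq.listTuple fun i hi => ?_) (ih hl.2 (.snd h))))
      (BEq.pair_eta h).symm
    · simp only [Tm.listProj, if_true]
      exact .refl (.fst h)
    · have hij : i ≠ j := fun e => hl.1 (e ▸ hi)
      simp only [Tm.listProj, if_neg hij]
      exact .refl (.listProj hi (.snd h))

end ListProd

end SysF

namespace SysF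

variable {m n : ℕ} {Op : Type u}

/-! ### Terms of type `D_S X` -/

section Signatures

variable (S : Sig Op (Ty m))

theorem sig_map_subst_var : S.map (fun A => A.subst Ty.var) = S := by
  simp only [Sig.map, Ty.subst_var]

theorem sig_map_subst_succ : S.map (fun A => A.subst fun i => .var i.succ) = S.map Ty.wk := by
  simp only [Sig.map, Ty.wk, Ty.ren_eq]

theorem sig_map_wk_subst_upT (θ : Fin m → Ty n) :
    (S.map Ty.wk).map (fun A => A.subst (upT θ)) = (S.map fun A => A.subst θ).map Ty.wk := by
  simp only [Sig.map, Ty.subst_wk]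

theorem hTy_wk_subst_upT (θ : Fin m → Ty n) :
    (hTy (S.map Ty.wk) (.var 0)).subst (upT θ) =
      hTy ((S.map fun A => A.subst θ).map Ty.wk) (.var 0) := by
  rw [hTy_subst, sig_map_wk_subst_upT]
  rfl

end Signatures

section Weakening

variable {Γ : List (Ty m)} {t t' : Tm m} {A B : Ty m}

/-- Weakening by a variable inserted just after the innermost one. -/
def Tm.wkUp (t : Tm m) : Tm m := t.ren id (upV (· + 1))

/-- `Tm.wk2` for a term under one more binder, whose variable is kept innermost. -/
def Tm.wk2Up (t : Tm m) : Tm (m + 1) := t.ren Fin.succ (upV (· + 2))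

theorem HasType.wkUp (h : HasType (A :: Γ) t B) (C : Ty m) : HasType (A :: C :: Γ) t.wkUp B := by
  have h' := h.ren (Δ := A :: C :: Γ) (ξ := id) (ρ := upV (· + 1)) fun i D hD => by
    rw [Ty.ren_id]
    cases i <;> exact hD
  rwa [Ty.ren_id] at h'

theorem getElem?_wk2Up (C D : Ty (m + 1)) : ∀ i E, (A :: Γ)[i]? = some E →
    (A.wk :: C :: D :: Γ.map Ty.wk)[upV (· + 2) i]? = some E.wk :=
  forall_getElem?_cons rfl fun i E hE => by
    simp only [upV, List.getElem?_cons_succ, List.getElem?_map, hE, Option.map_some]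

theorem HasType.wk2Up (h : HasType (A :: Γ) t B) (C D : Ty (m + 1)) :
    HasType (A.wk :: C :: D :: Γ.map Ty.wk) t.wk2Up B.wk :=
  h.ren (getElem?_wk2Up C D)

protected theorem BEq.wk2Up (h : BEq (A :: Γ) t t' B) (C D : Ty (m + 1)) :
    BEq (A.wk :: C :: D :: Γ.map Ty.wk) t.wk2Up t'.wk2Up B.wk :=
  h.ren (getElem?_wk2Up C D)

protected theorem BEq.wk2 (h : BEq Γ t t' A) (C D : Ty (m + 1)) :
    BEq (C :: D :: Γ.map Ty.wk) t.wk2 t'.wk2 A.wk :=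
  h.ren fun i E hE => by
    simp only [List.getElem?_cons_succ, List.getElem?_map, hE, Option.map_some, Ty.wk]

theorem Tm.wk2Up_subst_instT (t : Tm m) (B : Ty m) (k h : Tm m) :
    t.wk2Up.subst (instT B) (upS (scons h (scons k Tm.var))) = t := by
  rw [Tm.wk2Up, Tm.subst_ren]
  exact t.subst_eq_self rfl (funext fun i => by cases i <;> rfl)

theorem Tm.wk2Up_inst (t s : Tm m) : t.wk2Up.inst s.wk2 = (t.inst s).wk2 := by
  rw [Tm.inst_eq_subst, Tm.inst_eq_subst, Tm.wk2Up, Tm.subst_ren, Tm.wk2, Tm.wk2, Tm.ren_subst]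
  congr 1
  funext i
  cases i <;> rfl

theorem Tm.wkUp_wk2Up (t : Tm m) : t.wk2Up.wkUp = t.wkUp.ren Fin.succ (upV (upV (· + 2))) := by
  rw [Tm.wk2Up, Tm.wkUp, Tm.wkUp, Tm.ren_ren, Tm.ren_ren]
  congr 1
  funext i
  cases i <;> rfl

theorem lam_wk (A : Ty m) (t : Tm m) : (Tm.lam A t).wk = .lam A t.wkUp :=
  congrArg (Tm.lam · _) (Ty.ren_id A)

end Weakening

section Runs

/-- The context of the body of `Λ β. λ k : X → β. λ h : ℋ_S[β]. t : D_S X`. -/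
noncomputable abbrev dCtx (S : Sig Op (Ty m)) (X : Ty m) (Γ : List (Ty m)) : List (Ty (m + 1)) :=
  hTy (S.map Ty.wk) (.var 0) :: .arr X.wk (.var 0) :: Γ.map Ty.wk

/-- The application `t B k h` of a term `t` of type `D_S X` to a result type, a continuation and a
tuple of operations. -/
def dRun (t : Tm m) (B : Ty m) (k h : Tm m) : Tm m := .app (.app (.tapp t B) k) h

variable {Γ : List (Ty m)} {S : Sig Op (Ty m)} {X A B C : Ty m} {t t' k k' h h' : Tm m}

theorem HasType.dRun (ht : HasType Γ t (dTy S X)) (hk : HasType Γ k (.arr X B))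
    (hh : HasType Γ h (hTy S B)) : HasType Γ (SysF.dRun t B k h) B :=
  .app (.app (ht.tapp_dTy B) hk) hh

protected theorem BEq.dRun (ht : BEq Γ t t' (dTy S X)) (hk : BEq Γ k k' (.arr X B))
    (hh : BEq Γ h h' (hTy S B)) : BEq Γ (dRun t B k h) (dRun t' B k' h') B :=
  .app (.app (ht.tapp_dTy B) hk) hh

theorem dRun_subst (t : Tm m) (B : Ty m) (k h : Tm m) (θ : Fin m → Ty n) (σ : ℕ → Tm n) :
    (dRun t B k h).subst θ σ =
      dRun (t.subst θ σ) (B.subst θ) (k.subst θ σ) (h.subst θ σ) := rfl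

theorem dRun_ren_id (t : Tm m) (B : Ty m) (k h : Tm m) (ρ : ℕ → ℕ) :
    (dRun t B k h).ren id ρ = dRun (t.ren id ρ) B (k.ren id ρ) (h.ren id ρ) :=
  congrArg (dRun _ · _ _) (Ty.ren_id B)

theorem dLam_subst (S : Sig Op (Ty m)) (X : Ty m) (t : Tm (m + 1)) (θ : Fin m → Ty n)
    (σ : ℕ → Tm n) :
    (dLam S X t).subst θ σ = dLam (S.map fun A => A.subst θ) (X.subst θ)
      (t.subst (upT θ) (upS (upS fun i => (σ i).twk))) := by
  change Tm.tlam (.lam (.arr (X.wk.subst (upT θ)) (.var 0))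
    (.lam ((hTy (S.map Ty.wk) (.var 0)).subst (upT θ)) _)) = _
  rw [hTy_wk_subst_upT, ← Ty.subst_wk]
  rfl

theorem BEq.lam_lam_beta (ht : HasType (B :: A :: Γ) t C) (hk : HasType Γ k A)
    (hh : HasType Γ h B) : BEq Γ (.app (.app (.lam A (.lam B t)) k) h)
      (t.subst Ty.var (scons h (scons k Tm.var))) C := by
  have outer := BEq.lam_beta (HasType.lam ht) hk
  have inner := BEq.lam_beta (ht.subst₀ ((IsSubst.instS hk).upS B)) hh
  rw [show (Tm.lam B t).inst k = .lam B (t.subst Ty.var (upS (instS k))) from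
    congrArg (Tm.lam · _) (Ty.subst_var B)] at outer
  have e : (t.subst Ty.var (upS (instS k))).inst h =
      t.subst Ty.var (scons h (scons k Tm.var)) := by
    rw [Tm.inst_eq_subst, Tm.subst_subst]
    congr 1
    funext i
    match i with
    | 0 => rfl
    | 1 => exact (k.wk_subst_scons h Tm.var).trans k.subst_var
    | i + 2 => rfl
  exact (BEq.app outer (.refl hh)).trans (e ▸ inner)

theorem HasType.tinst_dCtx {t : Tm (m + 1)} (ht : HasType (dCtx S X Γ) t (.var 0)) (B : Ty m) :
    HasType (hTy S B :: .arr X B :: Γ) (t.tinst B) B := by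
  refine ht.subst (θ := instT B) (σ := Tm.var) (forall_getElem?_cons (.var ?_)
    (forall_getElem?_cons (.var ?_) (forall_getElem?_map fun i D hD => .var ?_)))
  · exact congrArg some (hTy_wk_inst S B).symm
  · exact congrArg (fun Y => some (Ty.arr Y B)) (Ty.wk_inst X B).symm
  · exact hD.trans (congrArg some (Ty.wk_inst D B).symm)

theorem BEq.tapp_dLam {t : Tm (m + 1)} (ht : HasType (dCtx S X Γ) t (.var 0)) (B : Ty m) :
    BEq Γ (.tapp (SysF.dLam S X t) B) (.lam (.arr X B) (.lam (hTy S B) (t.tinst B)))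
      (.arr (.arr X B) (.arr (hTy S B) B)) := by
  have e : (Tm.lam (.arr X.wk (.var 0)) (.lam (hTy (S.map Ty.wk) (.var 0)) t)).tinst B =
      .lam (.arr X B) (.lam (hTy S B) (t.tinst B)) := by
    change Tm.lam (.arr (X.wk.inst B) B) (.lam ((hTy (S.map Ty.wk) (.var 0)).inst B)
      (t.subst (instT B) (upS (upS Tm.var)))) = _
    rw [Ty.wk_inst, hTy_wk_inst, upS_var, upS_var, Tm.tinst]
  have beta := BEq.tlam_beta B (HasType.lam (HasType.lam ht))
  rwa [e, dTy_body_inst] at beta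

theorem BEq.dRun_dLam {t : Tm (m + 1)} (ht : HasType (dCtx S X Γ) t (.var 0))
    (hk : HasType Γ k (.arr X B)) (hh : HasType Γ h (hTy S B)) :
    BEq Γ (dRun (SysF.dLam S X t) B k h) (t.subst (instT B) (scons h (scons k Tm.var))) B := by
  have e : (t.tinst B).subst Ty.var (scons h (scons k Tm.var)) =
      t.subst (instT B) (scons h (scons k Tm.var)) := by
    rw [Tm.tinst, Tm.subst_subst]
    exact congrArg₂ (Tm.subst · · t) (funext fun i => Ty.subst_var _) rfl
  exact (BEq.app (.app (.tapp_dLam ht B) (.refl hk)) (.refl hh)).trans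
    (e ▸ BEq.lam_lam_beta (ht.tinst_dCtx B) hk hh)

theorem BEq.dTy_eta (ht : HasType Γ t (dTy S X)) :
    BEq Γ t (SysF.dLam S X (dRun t.wk2 (.var 0) (.var 1) (.var 0))) (dTy S X) := by
  have ht_wk := ht.twk
  rw [dTy_wk] at ht_wk
  have ht_app := ht_wk.tapp_dTy (.var 0)
  have eta_k := BEq.lam_eta ht_app
  have eta_h := BEq.lam_eta (HasType.app (ht_app.wk (.arr X.wk (.var 0))) (.var (i := 0) rfl))
  have e : t.twk.wk.wk = t.wk2 := by
    simp only [Tm.twk, Tm.wk, Tm.wk2, Tm.ren_ren]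
    rfl
  refine (BEq.tlam_eta ht).trans (.tlam (eta_k.trans (.lam (eta_h.trans ?_))))
  rw [dRun, ← e]
  exact .refl (.lam (.app (.app ((ht_app.wk _).wk _) (.var rfl)) (.var rfl)))

theorem BEq.dTy_ext (ht : HasType Γ t (dTy S X)) (ht' : HasType Γ t' (dTy S X))
    (h : BEq (dCtx S X Γ) (SysF.dRun t.wk2 (.var 0) (.var 1) (.var 0))
      (SysF.dRun t'.wk2 (.var 0) (.var 1) (.var 0)) (.var 0)) : BEq Γ t t' (dTy S X) :=
  (BEq.dTy_eta ht).trans ((BEq.dLam h).trans (BEq.dTy_eta ht').symm)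

end Runs

/-! ### The operators of the monads `D_S` -/

section Operators

/-- The term `Λ β. λ k. λ h. t β (λ x : X. s β k h) h`: this is `dBind` for a term `s` that depends
on `x` only, and not on `k` and `h`. -/
noncomputable def dLet (S : Sig Op (Ty m)) (X Y : Ty m) (t s : Tm m) : Tm m :=
  dBind S X Y t s.wk2Up

variable {Γ : List (Ty m)} {S : Sig Op (Ty m)} {X Y Z B : Ty m} {t t' s s' r k h : Tm m}

theorem HasType.dTy_wk2 (ht : HasType Γ t (dTy S X)) (C D : Ty (m + 1)) :
    HasType (C :: D :: Γ.map Ty.wk) t.wk2 (dTy (S.map Ty.wk) X.wk) :=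
  dTy_wk S X ▸ ht.wk2 C D

theorem HasType.dTy_wk2Up (hs : HasType (X :: Γ) s (dTy S Y)) (C D : Ty (m + 1)) :
    HasType (X.wk :: C :: D :: Γ.map Ty.wk) s.wk2Up (dTy (S.map Ty.wk) Y.wk) :=
  dTy_wk S Y ▸ hs.wk2Up C D

theorem HasType.dLet (ht : HasType Γ t (dTy S X)) (hs : HasType (X :: Γ) s (dTy S Y)) :
    HasType Γ (SysF.dLet S X Y t s) (dTy S Y) :=
  .dBind ht (hs.wk2Up _ _)

theorem HasType.dLet_body (ht : HasType Γ t (dTy S X)) (hs : HasType (X :: Γ) s (dTy S Y)) :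
    HasType (dCtx S Y Γ) (SysF.dRun t.wk2 (.var 0) (.lam X.wk
      (SysF.dRun s.wk2Up (.var 0) (.var 2) (.var 1))) (.var 0)) (.var 0) :=
  .dRun (ht.dTy_wk2 _ _) (.lam (.dRun (hs.dTy_wk2Up _ _) (.var rfl) (.var rfl))) (.var rfl)

theorem HasType.dOp_body [DecidableEq Op] (o : {o // o ∈ S.dom}) (ht : HasType Γ t (S.arg o)) :
    HasType (dCtx S (S.res o) Γ) (.app (Tm.listProj S.ops o (.var 0)) (.pair t.wk2 (.var 1)))
      (.var 0) :=
  .app (A := .prod (S.arg o).wk (.arr (S.res o).wk (.var 0)))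
    (HasType.listProj
      (A := fun o => .arr (.prod (S.arg o).wk (.arr (S.res o).wk (.var 0))) (.var 0))
      (S.mem_ops o) (.var rfl)) (.pair (ht.wk2 _ _) (.var rfl))

protected theorem BEq.dRet (S : Sig Op (Ty m)) (h : BEq Γ t t' X) :
    BEq Γ (dRet S X t) (dRet S X t') (dTy S X) :=
  .dLam (.app (.refl (.var rfl)) (h.wk2 _ _))

protected theorem BEq.dLet (ht : BEq Γ t t' (dTy S X)) (hs : BEq (X :: Γ) s s' (dTy S Y)) :
    BEq Γ (dLet S X Y t s) (dLet S X Y t' s') (dTy S Y) :=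
  .dLam (.dRun (dTy_wk S X ▸ ht.wk2 _ _)
    (.lam (.dRun (dTy_wk S Y ▸ hs.wk2Up _ _) (.refl (.var rfl)) (.refl (.var rfl))))
    (.refl (.var rfl)))

protected theorem BEq.dOp [DecidableEq Op] (o : {o // o ∈ S.dom}) (h : BEq Γ t t' (S.arg o)) :
    BEq Γ (dOp S o t) (dOp S o t') (dTy S (S.res o)) :=
  .dLam (.app (A := .prod (S.arg o).wk (.arr (S.res o).wk (.var 0)))
    (.refl (HasType.listProj
      (A := fun o => .arr (.prod (S.arg o).wk (.arr (S.res o).wk (.var 0))) (.var 0))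
      (S.mem_ops o) (.var rfl)))
    (.pair (h.wk2 _ _) (.refl (.var rfl))))

section Substitution

variable (S X Y) (t s : Tm m) (θ : Fin m → Ty n) (σ : ℕ → Tm n) (τ : ℕ → Tm m)

theorem dRet_subst : (dRet S X t).subst θ σ =
    dRet (S.map fun A => A.subst θ) (X.subst θ) (t.subst θ σ) := by
  rw [dRet, dLam_subst, dRet, Tm.subst_wk2]
  rfl

theorem dOp_subst [DecidableEq Op] (o : {o // o ∈ S.dom}) : (dOp S o t).subst θ σ =
    dOp (m := n) (S := S.map fun A => A.subst θ) o (t.subst θ σ) := by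
  unfold dOp
  rw [dLam_subst, Tm.subst_wk2]
  simp only [Tm.subst, Tm.listProj_subst]
  rfl

theorem Tm.wk2Up_subst_up : s.wk2Up.subst (upT θ) (upS (upS (upS fun i => (σ i).twk))) =
    (s.subst θ (upS σ)).wk2Up := by
  rw [Tm.wk2Up, Tm.wk2Up, Tm.ren_subst, Tm.subst_ren]
  congr 1
  funext i
  cases i with
  | zero => rfl
  | succ i =>
    simp only [Function.comp_apply, SysF.upS, upV, Tm.wk, Tm.twk, Tm.ren_ren]
    rfl

theorem dLet_subst : (dLet S X Y t s).subst θ σ =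
    dLet (S.map fun A => A.subst θ) (X.subst θ) (Y.subst θ) (t.subst θ σ)
      (s.subst θ (upS σ)) := by
  rw [dLet, dBind, dLam_subst, dLet, dBind, ← Tm.wk2Up_subst_up, Tm.subst_wk2, Ty.subst_wk]
  rfl

theorem dRet_subst_var : (dRet S X t).subst Ty.var τ = dRet S X (t.subst Ty.var τ) := by
  rw [dRet_subst, sig_map_subst_var, Ty.subst_var]

theorem dOp_subst_var [DecidableEq Op] (o : {o // o ∈ S.dom}) :
    (dOp S o t).subst Ty.var τ = dOp S o (t.subst Ty.var τ) := by
  have e : (fun A : Ty m => A.subst Ty.var) = id := funext Ty.subst_var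
  rw [dOp_subst, e]
  rfl

theorem dLet_subst_var : (dLet S X Y t s).subst Ty.var τ =
    dLet S X Y (t.subst Ty.var τ) (s.subst Ty.var (upS τ)) := by
  rw [dLet_subst, sig_map_subst_var, Ty.subst_var, Ty.subst_var]

theorem dRet_ren_succ (ρ : ℕ → ℕ) :
    (dRet S X t).ren Fin.succ ρ = dRet (S.map Ty.wk) X.wk (t.ren Fin.succ ρ) := by
  rw [Tm.ren_eq, dRet_subst, sig_map_subst_succ, ← Ty.ren_eq, ← Tm.ren_eq]
  rfl

theorem dLet_ren_succ (ρ : ℕ → ℕ) : (dLet S X Y t s).ren Fin.succ ρ =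
    dLet (S.map Ty.wk) X.wk Y.wk (t.ren Fin.succ ρ) (s.ren Fin.succ (upV ρ)) := by
  rw [Tm.ren_eq, dLet_subst, sig_map_subst_succ, ← Ty.ren_eq, ← Ty.ren_eq, ← Tm.ren_eq,
    Tm.ren_eq Fin.succ (upV ρ)]
  congr 2
  funext i
  cases i <;> rfl

theorem dLet_wk2 : (dLet S X Y t s).wk2 = dLet (S.map Ty.wk) X.wk Y.wk t.wk2 s.wk2Up :=
  dLet_ren_succ S X Y t s _

end Substitution

theorem BEq.dRun_dRet (ht : HasType Γ t X) (hk : HasType Γ k (.arr X B))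
    (hh : HasType Γ h (hTy S B)) : BEq Γ (dRun (SysF.dRet S X t) B k h) (.app k t) B := by
  have run := BEq.dRun_dLam (t := .app (.var 1) t.wk2) (.app (.var rfl) (ht.wk2 _ _)) hk hh
  rwa [Tm.subst, Tm.wk2_subst_instT] at run

theorem BEq.dRun_dOp [DecidableEq Op] (o : {o // o ∈ S.dom}) (ht : HasType Γ t (S.arg o))
    (hk : HasType Γ k (.arr (S.res o) B)) (hh : HasType Γ h (hTy S B)) :
    BEq Γ (dRun (SysF.dOp S o t) B k h) (.app (Tm.listProj S.ops o h) (.pair t k)) B := by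
  have run := BEq.dRun_dLam (ht.dOp_body o) hk hh
  rwa [Tm.subst, Tm.subst, Tm.wk2_subst_instT, Tm.listProj_subst] at run

theorem BEq.dRun_dLet (ht : HasType Γ t (dTy S X)) (hs : HasType (X :: Γ) s (dTy S Y))
    (hk : HasType Γ k (.arr Y B)) (hh : HasType Γ h (hTy S B)) :
    BEq Γ (dRun (dLet S X Y t s) B k h) (dRun t B (.lam X (dRun s B k.wk h.wk)) h) B := by
  have run := BEq.dRun_dLam (ht.dLet_body hs) hk hh
  simp only [dRun_subst, Tm.subst, Tm.wk2_subst_instT, Tm.wk2Up_subst_instT] at run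
  rwa [show X.wk.subst (instT B) = X from Ty.wk_inst X B] at run

theorem BEq.dRun_dLet_dRet (ht : HasType Γ t (dTy S X)) (hs : HasType (X :: Γ) s Y)
    (hk : HasType Γ k (.arr Y B)) (hh : HasType Γ h (hTy S B)) :
    BEq Γ (dRun (dLet S X Y t (SysF.dRet S Y s)) B k h)
      (dRun t B (.lam X (.app k.wk s)) h) B :=
  (BEq.dRun_dLet ht (.dRet S hs) hk hh).trans
    (.dRun (.refl ht) (.lam (.dRun_dRet hs (hk.wk X) (hh.wk X))) (.refl hh))

theorem BEq.dLet_dRet_left (ht : HasType Γ t X) (hs : HasType (X :: Γ) s (dTy S Y)) :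
    BEq Γ (dLet S X Y (SysF.dRet S X t) s) (s.inst t) (dTy S Y) := by
  have hs_inst : HasType Γ (s.inst t) (dTy S Y) := hs.subst₀ (IsSubst.instS ht)
  refine .dTy_ext (.dLet (.dRet S ht) hs) hs_inst ?_
  have ht_wk := ht.wk2 (hTy (S.map Ty.wk) (.var 0)) (.arr Y.wk (.var 0))
  have hs_wk := hs.dTy_wk2Up (hTy (S.map Ty.wk) (.var 0)) (.arr Y.wk (.var 0))
  have body : HasType (X.wk :: dCtx S Y Γ) (SysF.dRun s.wk2Up (.var 0) (.var 2) (.var 1))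
      (.var 0) := .dRun hs_wk (.var rfl) (.var rfl)
  have e : (SysF.dRun s.wk2Up (.var 0) (.var 2) (.var 1)).inst t.wk2 =
      SysF.dRun (s.inst t).wk2 (.var 0) (.var 1) (.var 0) :=
    congrArg (SysF.dRun · _ _ _) (Tm.wk2Up_inst s t)
  rw [dLet_wk2, Tm.wk2, dRet_ren_succ, ← e]
  exact (BEq.dRun_dLet (.dRet _ ht_wk) hs_wk (.var rfl) (.var rfl)).trans
    ((BEq.dRun_dRet ht_wk (.lam body) (.var rfl)).trans (.lam_beta body ht_wk))

theorem BEq.dLet_dRet_right (ht : HasType Γ t (dTy S X)) :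
    BEq Γ (dLet S X X t (SysF.dRet S X (.var 0))) t (dTy S X) := by
  refine .dTy_ext (.dLet ht (.dRet S (.var rfl))) ht ?_
  rw [dLet_wk2, Tm.wk2Up, dRet_ren_succ]
  refine (BEq.dRun_dLet_dRet (ht.dTy_wk2 _ _) (.var rfl) (.var rfl) (.var rfl)).trans
    (.dRun (.refl (ht.dTy_wk2 _ _)) ?_ (.refl (.var rfl)))
  exact (BEq.lam_eta (t := .var 1) (.var rfl)).symm

theorem BEq.dRun_dLet_dLet (ht : HasType Γ t (dTy S X)) (hs : HasType (X :: Γ) s (dTy S Y))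
    (hr : HasType (Y :: Γ) r (dTy S Z)) (hk : HasType Γ k (.arr Z B))
    (hh : HasType Γ h (hTy S B)) :
    BEq Γ (dRun (dLet S Y Z (dLet S X Y t s) r) B k h)
      (dRun (dLet S X Z t (dLet S Y Z s r.wkUp)) B k h) B := by
  have hl : HasType Γ (.lam Y (SysF.dRun r B k.wk h.wk)) (.arr Y B) :=
    .lam (.dRun hr (hk.wk _) (hh.wk _))
  have left := (BEq.dRun_dLet (.dLet ht hs) hr hk hh).trans (.dRun_dLet ht hs hl hh)
  have right := BEq.dRun_dLet ht (.dLet hs (hr.wkUp X)) hk hh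
  have e : (Tm.lam Y (SysF.dRun r B k.wk h.wk)).wk =
      .lam Y (SysF.dRun r.wkUp B k.wk.wk h.wk.wk) := by
    rw [lam_wk, Tm.wkUp, dRun_ren_id]
    simp only [Tm.wk, Tm.wkUp, Tm.ren_ren]
    rfl
  rw [e] at left
  exact left.trans (right.trans (.dRun (.refl ht)
    (.lam (.dRun_dLet hs (hr.wkUp X) (hk.wk _) (hh.wk _))) (.refl hh))).symm

theorem BEq.dLet_assoc (ht : HasType Γ t (dTy S X)) (hs : HasType (X :: Γ) s (dTy S Y))
    (hr : HasType (Y :: Γ) r (dTy S Z)) :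
    BEq Γ (dLet S Y Z (dLet S X Y t s) r) (dLet S X Z t (dLet S Y Z s r.wkUp)) (dTy S Z) := by
  refine .dTy_ext (.dLet (.dLet ht hs) hr) (.dLet ht (.dLet hs (hr.wkUp X))) ?_
  have e : (SysF.dLet S Y Z s r.wkUp).wk2Up =
      SysF.dLet (S.map Ty.wk) Y.wk Z.wk s.wk2Up r.wk2Up.wkUp := by
    rw [Tm.wk2Up, dLet_ren_succ, ← Tm.wkUp_wk2Up, ← Tm.wk2Up]
  rw [dLet_wk2, dLet_wk2, dLet_wk2, e]
  exact .dRun_dLet_dLet (ht.dTy_wk2 _ _) (hs.dTy_wk2Up _ _) (hr.dTy_wk2Up _ _) (.var rfl)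
    (.var rfl)

end Operators

end SysF

namespace SysF

variable {m : ℕ}

/-! ### Morphisms of the term model as functions on terms -/

/-- The term `t[s / x]`, for a term `t` with a single variable `x`. -/
def Tm.subst₁ (t s : Tm m) : Tm m := t.subst Ty.var fun _ => s

section

variable {Γ : List (Ty m)} {A B : Ty m} {t t' s s' : Tm m}

theorem Tm.subst₁_subst (t s : Tm m) (σ : ℕ → Tm m) :
    (t.subst₁ s).subst Ty.var σ = t.subst₁ (s.subst Ty.var σ) := Tm.subst_subst _ _ _ _ _

theorem HasType.subst₁ (ht : HasType [A] t B) (hs : HasType Γ s A) : HasType Γ (t.subst₁ s) B :=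
  ht.subst₀ (IsSubst.single hs)

protected theorem BEq.subst₁ (ht : BEq [A] t t' B) (hs : BEq Γ s s' A) :
    BEq Γ (t.subst₁ s) (t'.subst₁ s') B :=
  ht.subst₀ ht.hasType.1 (IsSubst.single hs.hasType.2)
    (forall_single (P := fun D => BEq Γ s s' D) hs)

theorem HasType.subst₁_var (h : HasType [A] t B) : BEq [A] (t.subst₁ (.var 0)) t B := by
  have e := (BEq.refl h).subst₀ (σ := fun _ => .var 0) (σ' := Tm.var) h
    (fun _ _ hC => .var hC) (forall_getElem?_cons (.refl (.var rfl)) fun _ _ hC => nomatch hC)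
  rwa [Tm.subst_var] at e

end

/-- The morphism `f` of the term model sends the term `s` to the term `t`, up to `βη`-equality. -/
def Sends (Γ : List (Ty m)) {A B : Ty m} (f : A ⟶ B) (s t : Tm m) : Prop :=
  HasType Γ s A ∧ ∃ (r : Tm m) (h : HasType [A] r B), f = mk r h ∧ BEq Γ (r.subst₁ s) t B

namespace Sends

variable {Γ Δ : List (Ty m)} {A B C D : Ty m} {s t u : Tm m}

theorem of_mk {r : Tm m} (h : HasType [A] r B) (hs : HasType Γ s A)
    (e : BEq Γ (r.subst₁ s) t B) : Sends Γ (mk r h) s t :=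
  ⟨hs, r, h, rfl, e⟩

theorem left {f : A ⟶ B} (h : Sends Γ f s t) : HasType Γ s A := h.1

theorem right {f : A ⟶ B} (h : Sends Γ f s t) : HasType Γ t B := by
  obtain ⟨_, r, _, _, e⟩ := h
  exact e.hasType.2

theorem conv {f : A ⟶ B} (h : Sends Γ f s t) (e : BEq Γ t u B) : Sends Γ f s u := by
  obtain ⟨hs, r, hr, rfl, e'⟩ := h
  exact ⟨hs, r, hr, rfl, e'.trans e⟩

theorem conv_left {f : A ⟶ B} (h : Sends Γ f s t) (e : BEq Γ s u A) : Sends Γ f u t := by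
  obtain ⟨_, r, hr, rfl, e'⟩ := h
  exact ⟨e.hasType.2, r, hr, rfl, ((BEq.refl hr).subst₁ e.symm).trans e'⟩

theorem subst {f : A ⟶ B} (h : Sends Γ f s t) {σ : ℕ → Tm m} (hσ : IsSubst Γ Δ σ) :
    Sends Δ f (s.subst Ty.var σ) (t.subst Ty.var σ) := by
  obtain ⟨hs, r, hr, rfl, e⟩ := h
  refine ⟨hs.subst₀ hσ, r, hr, rfl, ?_⟩
  rw [← Tm.subst₁_subst]
  exact e.subst₀ e.hasType.1 hσ fun i C hC => .refl (hσ i C hC)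

theorem ren {f : A ⟶ B} (h : Sends Γ f s t) {ρ : ℕ → ℕ}
    (hρ : ∀ i C, Γ[i]? = some C → Δ[ρ i]? = some C) :
    Sends Δ f (s.ren _root_.id ρ) (t.ren _root_.id ρ) := by
  rw [Tm.ren_eq, Tm.ren_eq]
  exact h.subst fun i C hC => .var (hρ i C hC)

theorem wk {f : A ⟶ B} (h : Sends Γ f s t) : Sends (C :: Γ) f s.wk t.wk :=
  h.ren fun _ _ hC => hC

theorem wkUp {f : A ⟶ B} (h : Sends (C :: Γ) f s t) (D : Ty m) :
    Sends (C :: D :: Γ) f s.wkUp t.wkUp :=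
  h.ren (forall_getElem?_cons rfl fun _ _ hE => hE)

theorem inst {f : A ⟶ B} (h : Sends (C :: Γ) f s t) (hu : HasType Γ u C) :
    Sends Γ f (s.inst u) (t.inst u) :=
  h.subst (IsSubst.instS hu)

theorem exists_sends (f : A ⟶ B) (hs : HasType Γ s A) : ∃ t, Sends Γ f s t := by
  obtain ⟨r, hr, rfl⟩ := exists_mk f
  exact ⟨_, hs, r, hr, rfl, .refl (hr.subst₁ hs)⟩

theorem unique {f : A ⟶ B} (h : Sends Γ f s t) (h' : Sends Γ f s u) : BEq Γ t u B := by
  obtain ⟨hs, r, hr, rfl, e⟩ := h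
  obtain ⟨_, r', hr', e_mk, e'⟩ := h'
  have e_r : BEq [A] r r' B := Quotient.exact (s := TTm.setoid [A] B) e_mk
  exact e.symm.trans ((e_r.subst₁ (.refl hs)).trans e')

theorem hom_ext {f g : A ⟶ B} (hf : Sends Γ f s t) (hg : Sends Γ g s u) (e : BEq Γ t u B)
    {σ : ℕ → Tm m} (hσ : IsSubst Γ [A] σ) (hs : BEq [A] (s.subst Ty.var σ) (.var 0) A) :
    f = g := by
  obtain ⟨_, r, hr, rfl, e_r⟩ := ((hf.conv e).subst hσ).conv_left hs
  obtain ⟨_, r', hr', rfl, e_r'⟩ := (hg.subst hσ).conv_left hs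
  exact mk_eq (hr.subst₁_var.symm.trans ((e_r.trans e_r'.symm).trans hr'.subst₁_var))

theorem hom_ext₁ {f g : A ⟶ B} (hf : Sends [A] f (.var 0) t) (hg : Sends [A] g (.var 0) u)
    (e : BEq [A] t u B) : f = g :=
  hom_ext hf hg e (IsSubst.id _) (.refl (.var rfl))

theorem hom_ext₂ {f g : A ⊗ B ⟶ C} (hf : Sends [B, A] f (.pair (.var 1) (.var 0)) t)
    (hg : Sends [B, A] g (.pair (.var 1) (.var 0)) u) (e : BEq [B, A] t u C) : f = g :=
  hom_ext hf hg e
    (IsSubst.scons (.snd (A := A) (.var rfl)) (IsSubst.single (.fst (B := B) (.var rfl))))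
    (BEq.pair_eta (t := .var 0) (.var rfl)).symm

theorem hom_ext_unit_tensor {f g : 𝟙_ (Ty m) ⊗ A ⟶ B} (hf : Sends [A] f (.pair .star (.var 0)) t)
    (hg : Sends [A] g (.pair .star (.var 0)) u) (e : BEq [A] t u B) : f = g := by
  have h : HasType [Ty.prod .unit A] (.fst (.var 0)) .unit := .fst (.var rfl)
  exact hom_ext hf hg e (IsSubst.single (.snd (A := .unit) (.var rfl)))
    ((BEq.pair (BEq.unit_eta h).symm (.refl (.snd (.var rfl)))).trans
      (BEq.pair_eta (t := .var 0) (.var rfl)).symm)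

theorem hom_ext_left₃ {f g : (A ⊗ B) ⊗ C ⟶ D}
    (hf : Sends [C, B, A] f (.pair (.pair (.var 2) (.var 1)) (.var 0)) t)
    (hg : Sends [C, B, A] g (.pair (.pair (.var 2) (.var 1)) (.var 0)) u)
    (e : BEq [C, B, A] t u D) : f = g := by
  have h : HasType [Ty.prod (.prod A B) C] (.fst (.var 0)) (.prod A B) := .fst (.var rfl)
  exact hom_ext hf hg e
    (IsSubst.scons (.snd (A := .prod A B) (.var rfl))
      (IsSubst.scons (.snd h) (IsSubst.single (.fst h))))
    ((BEq.pair (BEq.pair_eta h).symm (.refl (.snd (.var rfl)))).trans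
      (BEq.pair_eta (t := .var 0) (.var rfl)).symm)

theorem hom_ext_right₃ {f g : A ⊗ (B ⊗ C) ⟶ D}
    (hf : Sends [C, B, A] f (.pair (.var 2) (.pair (.var 1) (.var 0))) t)
    (hg : Sends [C, B, A] g (.pair (.var 2) (.pair (.var 1) (.var 0))) u)
    (e : BEq [C, B, A] t u D) : f = g := by
  have h : HasType [Ty.prod A (.prod B C)] (.snd (.var 0)) (.prod B C) := .snd (.var rfl)
  exact hom_ext hf hg e
    (IsSubst.scons (.snd h)
      (IsSubst.scons (.fst h) (IsSubst.single (.fst (B := .prod B C) (.var rfl)))))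
    ((BEq.pair (.refl (.fst (.var rfl))) (BEq.pair_eta h).symm).trans
      (BEq.pair_eta (t := .var 0) (.var rfl)).symm)

theorem id (hs : HasType Γ s A) : Sends Γ (𝟙 A) s s := of_mk (.var rfl) hs (.refl hs)

theorem comp {f : A ⟶ B} {g : B ⟶ C} (hf : Sends Γ f s t) (hg : Sends Γ g t u) :
    Sends Γ (f ≫ g) s u := by
  obtain ⟨hs, r, hr, rfl, e⟩ := hf
  obtain ⟨_, r', hr', rfl, e'⟩ := hg
  refine of_mk (r := r'.subst₁ r) (hr'.subst₁ hr) hs ?_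
  rw [Tm.subst₁, Tm.subst₁_subst]
  exact ((BEq.refl hr').subst₁ e).trans e'

theorem lift {f : A ⟶ B} {g : A ⟶ C} (hf : Sends Γ f s t) (hg : Sends Γ g s u) :
    Sends Γ (CartesianMonoidalCategory.lift f g) s (.pair t u) := by
  obtain ⟨hs, r, hr, rfl, e⟩ := hf
  obtain ⟨_, r', hr', rfl, e'⟩ := hg
  exact of_mk (r := .pair r r') (.pair hr hr') hs (.pair e e')

theorem fst_of (hs : HasType Γ s (.prod A B)) :
    Sends Γ (CartesianMonoidalCategory.fst A B) s (.fst s) :=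
  of_mk (r := .fst (.var 0)) (.fst (.var rfl)) hs (.refl (.fst hs))

theorem snd_of (hs : HasType Γ s (.prod A B)) :
    Sends Γ (CartesianMonoidalCategory.snd A B) s (.snd s) :=
  of_mk (r := .snd (.var 0)) (.snd (.var rfl)) hs (.refl (.snd hs))

theorem fst (hs : HasType Γ s A) (ht : HasType Γ t B) :
    Sends Γ (CartesianMonoidalCategory.fst A B) (.pair s t) s :=
  (fst_of (.pair hs ht)).conv (.fst_beta hs ht)

theorem snd (hs : HasType Γ s A) (ht : HasType Γ t B) :
    Sends Γ (CartesianMonoidalCategory.snd A B) (.pair s t) t :=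
  (snd_of (.pair hs ht)).conv (.snd_beta hs ht)

theorem toUnit (hs : HasType Γ s A) : Sends Γ (CartesianMonoidalCategory.toUnit A) s .star :=
  of_mk (r := .star) .star hs (.refl .star)

theorem whiskerLeft {f : A ⟶ B} (hs : HasType Γ s C) (h : Sends Γ f t u) :
    Sends Γ (C ◁ f) (.pair s t) (.pair s u) := by
  have e : C ◁ f = CartesianMonoidalCategory.lift (CartesianMonoidalCategory.fst C A)
      (CartesianMonoidalCategory.snd C A ≫ f) := by ext <;> simp
  rw [e]
  exact lift (fst hs h.left) ((snd hs h.left).comp h)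

theorem whiskerRight {f : A ⟶ B} (h : Sends Γ f s u) (ht : HasType Γ t C) :
    Sends Γ (f ▷ C) (.pair s t) (.pair u t) := by
  have e : f ▷ C = CartesianMonoidalCategory.lift (CartesianMonoidalCategory.fst A C ≫ f)
      (CartesianMonoidalCategory.snd A C) := by ext <;> simp
  rw [e]
  exact lift ((fst h.left ht).comp h) (snd h.left ht)

theorem leftUnitor_hom (hs : HasType Γ s .unit) (ht : HasType Γ t A) :
    Sends Γ (λ_ A).hom (.pair s t) t := by
  rw [CartesianMonoidalCategory.leftUnitor_hom]
  exact snd hs ht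

theorem leftUnitor_inv (hs : HasType Γ s A) : Sends Γ (λ_ A).inv s (.pair .star s) := by
  have e : (λ_ A).inv =
      CartesianMonoidalCategory.lift (CartesianMonoidalCategory.toUnit A) (𝟙 A) := by
    ext; simp
  rw [e]
  exact lift (toUnit hs) (id hs)

theorem associator_hom (hs : HasType Γ s A) (ht : HasType Γ t B) (hu : HasType Γ u C) :
    Sends Γ (α_ A B C).hom (.pair (.pair s t) u) (.pair s (.pair t u)) := by
  have e : (α_ A B C).hom = CartesianMonoidalCategory.lift
      (CartesianMonoidalCategory.fst (A ⊗ B) C ≫ CartesianMonoidalCategory.fst A B)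
      (CartesianMonoidalCategory.lift
        (CartesianMonoidalCategory.fst (A ⊗ B) C ≫ CartesianMonoidalCategory.snd A B)
        (CartesianMonoidalCategory.snd (A ⊗ B) C)) := by ext <;> simp
  rw [e]
  exact lift ((fst (.pair hs ht) hu).comp (fst hs ht))
    (lift ((fst (.pair hs ht) hu).comp (snd hs ht)) (snd (.pair hs ht) hu))

theorem associator_inv (hs : HasType Γ s A) (ht : HasType Γ t B) (hu : HasType Γ u C) :
    Sends Γ (α_ A B C).inv (.pair s (.pair t u)) (.pair (.pair s t) u) := by
  have e : (α_ A B C).inv = CartesianMonoidalCategory.lift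
      (CartesianMonoidalCategory.lift (CartesianMonoidalCategory.fst A (B ⊗ C))
        (CartesianMonoidalCategory.snd A (B ⊗ C) ≫ CartesianMonoidalCategory.fst B C))
      (CartesianMonoidalCategory.snd A (B ⊗ C) ≫ CartesianMonoidalCategory.snd B C) := by
    ext <;> simp
  rw [e]
  exact lift (lift (fst hs (.pair ht hu)) ((snd hs (.pair ht hu)).comp (fst ht hu)))
    ((snd hs (.pair ht hu)).comp (snd ht hu))

theorem listTuple {ι : Type u} {B : ι → Ty m} {f : ∀ i, A ⟶ B i} {t : ι → Tm m}
    (hs : HasType Γ s A) (h : ∀ i, Sends Γ (f i) s (t i)) (l : List ι) :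
    Sends Γ (LamEff.listTuple f l) s (Tm.listTuple t l) := by
  induction l with
  | nil => exact toUnit hs
  | cons i l ih => exact lift (h i) ih

theorem listProj {ι : Type u} [DecidableEq ι] {A : ι → Ty m} {l : List ι} {i : ι} (hi : i ∈ l)
    (hs : HasType Γ s (Ty.listProd A l)) :
    Sends Γ (LamEff.listProj A l i hi) s (Tm.listProj l i s) := by
  induction l generalizing s with
  | nil => cases hi
  | cons j l ih =>
    rw [LamEff.listProj, Tm.listProj]
    split
    · next e =>
      subst e
      exact comp (B := A i) (fst_of (A := A i) (B := Ty.listProd A l) hs) (id (.fst hs))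
    · exact (snd_of hs).comp (ih _ (.snd hs))

end Sends

end SysF

/-! ### The laws of a `λ_eff`-model -/

namespace SysF

variable {m : ℕ} {Op : Type u} {Γ : List (Ty m)} {S : Sig Op (Ty m)} {X P B : Ty m}
  {t s p q n h : Tm m}

theorem BEq.lam_var_app (ht : HasType Γ t X) : BEq Γ (.app (.lam X (.var 0)) t) t X :=
  .lam_beta (t := .var 0) (.var rfl) ht

theorem BEq.dRun_dLet_dRet_id (ht : HasType Γ t (dTy S X)) (hs : HasType (X :: Γ) s B)
    (hh : HasType Γ h (hTy S B)) :
    BEq Γ (dRun (dLet S X B t (SysF.dRet S B s)) B (.lam B (.var 0)) h)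
      (dRun t B (.lam X s) h) B := by
  refine (BEq.dRun_dLet_dRet ht hs (.lam (.var rfl)) hh).trans
    (.dRun (.refl ht) (.lam ?_) (.refl hh))
  rw [lam_wk]
  exact .lam_var_app hs

theorem Sends.dRun_dLet_dLet {f : P ⟶ B} (hf : Sends (P :: Γ) f (.var 0) n)
    (hp : Sends (X :: Γ) f p q) (ht : HasType Γ t (dTy S X)) (hh : HasType Γ h (hTy S B)) :
    BEq Γ
      (dRun (dLet S P B (dLet S X P t (dRet S P p)) (dRet S B n)) B (.lam B (.var 0)) h)
      (dRun t B (.lam X q) h) B := by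
  refine (BEq.dRun_dLet_dRet_id (.dLet ht (.dRet S hp.left)) hf.right hh).trans
    ((BEq.dRun_dLet_dRet ht hp.left (.lam hf.right) hh).trans
      (.dRun (.refl ht) (.lam ?_) (.refl hh)))
  rw [lam_wk]
  exact (BEq.lam_beta (hf.right.wkUp X) hp.left).trans (((hf.wkUp X).inst hp.left).unique hp)

end SysF

namespace LamEff

open SysF

variable {Op : Type u} {Γ : List (Ty 0)} {S S' : Sig Op (Ty 0)} {X Y Z : Ty 0} {s t n : Tm 0}

theorem sends_unit (S : Sig Op (Ty 0)) (hs : HasType Γ s X) :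
    Sends Γ ((dKleisli S).unit X) s (dRet S X s) := by
  refine Sends.of_mk (r := dRet S X (.var 0)) (.dRet S (.var rfl)) hs ?_
  rw [Tm.subst₁, dRet_subst_var]
  exact .refl (.dRet S hs)

theorem extBody_eq_wk2Up (t : Tm 0) :
    extBody t = (t.subst₁ (.pair (.fst (.var 1)) (.var 0))).wk2Up := by
  rw [extBody, Tm.twk, Tm.subst_ren, Tm.subst₁, Tm.wk2Up, Tm.ren_subst]
  rfl

theorem sends_ext {f : X ⊗ Y ⟶ (dKleisli S).obj Z} (hs : HasType Γ s X)
    (ht : HasType Γ t (dTy S Y)) (hf : Sends (Y :: Γ) f (.pair s.wk (.var 0)) n) :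
    Sends Γ ((dKleisli S).ext f) (.pair s t) (dLet S Y Z t n) := by
  obtain ⟨_, r, hr, rfl, e⟩ := hf
  refine Sends.of_mk (r := dBind S Y Z (.snd (.var 0)) (extBody r))
    (.dBind (.snd (.var rfl)) (hasType_extBody hr)) (.pair hs ht) ?_
  rw [extBody_eq_wk2Up, ← dLet, Tm.subst₁, dLet_subst_var, Tm.subst₁_subst]
  exact .dLet (.snd_beta hs ht) (.trans (.subst₁ (.refl hr)
    (.pair (.fst_beta (hs.wk Y) (ht.wk Y)) (.refl (.var rfl)))) e)

theorem sends_map {f : X ⟶ Y} (hs : HasType Γ s (dTy S X)) (hf : Sends (X :: Γ) f (.var 0) n) :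
    Sends Γ ((dKleisli S).map f) s (dLet S X Y s (dRet S Y n)) :=
  .comp (.leftUnitor_inv hs) (sends_ext (X := .unit) .star hs
    (.comp (.leftUnitor_hom .star (.var rfl)) (.comp hf (sends_unit S hf.right))))

theorem sends_mu (hs : HasType Γ s (dTy S (dTy S X))) :
    Sends Γ ((dKleisli S).mu X) s (dLet S (dTy S X) X s (.var 0)) :=
  .comp (.leftUnitor_inv hs)
    (sends_ext (X := .unit) .star hs (.leftUnitor_hom .star (.var rfl)))

theorem sends_str (hs : HasType Γ s X) (ht : HasType Γ t (dTy S Y)) :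
    Sends Γ ((dKleisli S).str X Y) (.pair s t)
      (dLet S Y (.prod X Y) t (dRet S (.prod X Y) (.pair s.wk (.var 0)))) :=
  sends_ext hs ht (sends_unit S (.pair (hs.wk Y) (.var rfl)))

theorem dKleisli_ext_unit (S : Sig Op (Ty 0)) (X : Ty 0) :
    (dKleisli S).ext ((λ_ X).hom ≫ (dKleisli S).unit X) = (λ_ ((dKleisli S).obj X)).hom :=
  Sends.hom_ext_unit_tensor
    (sends_ext (X := .unit) .star (.var rfl)
      (.comp (.leftUnitor_hom .star (.var rfl)) (sends_unit S (.var rfl))))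
    (.leftUnitor_hom .star (.var rfl)) (.dLet_dRet_right (.var rfl))

theorem dKleisli_unit_ext (f : X ⊗ Y ⟶ (dKleisli S).obj Z) :
    X ◁ (dKleisli S).unit Y ≫ (dKleisli S).ext f = f := by
  obtain ⟨n, hn⟩ := Sends.exists_sends (Γ := [Y, Y, X]) (s := .pair (.var 2) (.var 0)) f
    (.pair (.var rfl) (.var rfl))
  exact Sends.hom_ext₂
    (.comp (.whiskerLeft (.var rfl) (sends_unit S (.var rfl)))
      (sends_ext (.var rfl) (.dRet S (.var rfl)) hn))
    (hn.inst (.var rfl)) (.dLet_dRet_left (.var rfl) hn.right)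

theorem dKleisli_ext_ext {W V : Ty 0} (f : X ⊗ Y ⟶ (dKleisli S).obj Z)
    (g : W ⊗ Z ⟶ (dKleisli S).obj V) :
    (α_ W X ((dKleisli S).obj Y)).hom ≫ W ◁ (dKleisli S).ext f ≫ (dKleisli S).ext g =
      (dKleisli S).ext ((α_ W X Y).hom ≫ W ◁ f ≫ (dKleisli S).ext g) := by
  obtain ⟨n, hn⟩ := Sends.exists_sends (Γ := [Y, dTy S Y, X, W])
    (s := .pair (.var 2) (.var 0)) f (.pair (.var rfl) (.var rfl))
  obtain ⟨r, hr⟩ := Sends.exists_sends (Γ := [Z, dTy S Y, X, W])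
    (s := .pair (.var 3) (.var 0)) g (.pair (.var rfl) (.var rfl))
  have hl : HasType [dTy S Y, X, W] (dLet S Y Z (.var 0) n) (dTy S Z) := .dLet (.var rfl) hn.right
  exact Sends.hom_ext_left₃
    (.comp (.associator_hom (.var rfl) (.var rfl) (.var rfl))
      (.comp (.whiskerLeft (.var rfl) (sends_ext (.var rfl) (.var rfl) hn))
        (sends_ext (.var rfl) hl hr)))
    (sends_ext (X := .prod W X) (.pair (.var rfl) (.var rfl)) (.var rfl)
      (.comp (.associator_hom (.var rfl) (.var rfl) (.var rfl))
        (.comp (.whiskerLeft (.var rfl) hn) (sends_ext (.var rfl) hn.right (hr.wkUp Y)))))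
    (.dLet_assoc (.var rfl) hn.right hr.right)

theorem dKleisli_isStrongKleisliTriple (S : Sig Op (Ty 0)) :
    (dKleisli S).IsStrongKleisliTriple :=
  ⟨dKleisli_ext_unit S, dKleisli_unit_ext, dKleisli_ext_ext⟩

variable [DecidableEq Op]

theorem sends_curry {f : X ⊗ Y ⟶ dTy S Z} (hs : HasType Γ s X)
    (hf : Sends (Y :: Γ) f (.pair s.wk (.var 0)) n) :
    Sends Γ ((cpsModel Op).curry S (X := X) (Y := Y) (Z := Z) f) s (.lam Y n) := by
  obtain ⟨_, r, hr, rfl, e⟩ := hf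
  refine Sends.of_mk (r := .lam Y (curBody r))
    (.lam (hr.subst₁ (.pair (.var rfl) (.var rfl)))) hs ?_
  change SysF.BEq Γ (.lam (Y.subst _) ((r.subst₁ _).subst _ _)) _ _
  rw [Ty.subst_var, Tm.subst₁_subst]
  exact .lam e

theorem sends_ev (hs : HasType Γ s (.arr Y (dTy S Z))) (ht : HasType Γ t Y) :
    Sends Γ ((cpsModel Op).ev S Y Z) (.pair s t) (.app s t) :=
  Sends.of_mk (r := .app (.fst (.var 0)) (.snd (.var 0)))
    (.app (.fst (.var rfl)) (.snd (.var rfl))) (.pair hs ht)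
    (.app (.fst_beta hs ht) (.snd_beta hs ht))

theorem sends_opr (o : {o // o ∈ S.dom}) (hs : HasType Γ s (S.arg o)) :
    Sends Γ ((cpsModel Op).opr S o) s (dOp S o s) := by
  refine Sends.of_mk (r := dOp S o (.var 0)) (.dOp o (.var rfl)) hs ?_
  rw [Tm.subst₁, dOp_subst_var]
  exact .refl (.dOp o hs)

theorem sends_handle (hs : HasType Γ s (hTy S (dTy S' X)))
    (ht : HasType Γ t (dTy S (dTy S' X))) :
    Sends Γ ((cpsModel Op).handle S S' X) (.pair s t)
      (dRun t (dTy S' X) (.lam (dTy S' X) (.var 0)) s) := by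
  refine Sends.of_mk
    (r := dRun (.snd (.var 0)) (dTy S' X) (.lam (dTy S' X) (.var 0)) (.fst (.var 0)))
    (.dRun (.snd (.var rfl)) (.lam (.var rfl)) (.fst (.var rfl))) (.pair hs ht) ?_
  simp only [Tm.subst₁, dRun_subst, Tm.subst, Ty.subst_var]
  exact .dRun (.snd_beta hs ht) (.refl (.lam (.var rfl))) (.fst_beta hs ht)

theorem cpsModel_curry_ev (f : X ⊗ Y ⟶ dTy S Z) :
    (cpsModel Op).curry S (X := X) (Y := Y) (Z := Z) f ▷ Y ≫ (cpsModel Op).ev S Y Z = f := by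
  obtain ⟨n, hn⟩ := Sends.exists_sends (Γ := [Y, Y, X]) (s := .pair (.var 2) (.var 0)) f
    (.pair (.var rfl) (.var rfl))
  exact Sends.hom_ext₂
    (.comp (.whiskerRight (sends_curry (.var rfl) hn) (.var rfl))
      (sends_ev (.lam hn.right) (.var rfl)))
    (hn.inst (.var rfl)) (.lam_beta hn.right (.var rfl))

theorem cpsModel_curry_uncurry (g : X ⟶ (cpsModel Op).exp S Y Z) :
    (cpsModel Op).curry S (g ▷ Y ≫ (cpsModel Op).ev S Y Z) = g := by
  obtain ⟨n, hn⟩ := Sends.exists_sends (Γ := [X]) (s := .var 0) g (.var rfl)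
  exact Sends.hom_ext₁
    (sends_curry (.var rfl)
      (.comp (.whiskerRight hn.wk (.var rfl)) (sends_ev hn.wk.right (.var rfl))))
    hn (SysF.BEq.lam_eta hn.right).symm

theorem cpsModel_handle_unit (S S' : Sig Op (Ty 0)) (X : Ty 0) :
    (cpsModel Op).bundle S S' X ◁ (dKleisli S).unit (dTy S' X) ≫ (cpsModel Op).handle S S' X =
      snd _ _ :=
  Sends.hom_ext₂
    (.comp (.whiskerLeft (.var rfl) (sends_unit S (.var rfl)))
      (sends_handle (.var rfl) (.dRet S (.var rfl))))
    (.snd (.var rfl) (.var rfl))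
    ((SysF.BEq.dRun_dRet (.var rfl) (.lam (.var rfl)) (.var rfl)).trans (.lam_var_app (.var rfl)))

theorem cpsModel_handle_mult (S S' : Sig Op (Ty 0)) (X : Ty 0) :
    (cpsModel Op).bundle S S' X ◁ (dKleisli S).mu (dTy S' X) ≫ (cpsModel Op).handle S S' X =
      lift (fst _ _) ((dKleisli S).str ((cpsModel Op).bundle S S' X) (dTy S (dTy S' X))) ≫
        (cpsModel Op).bundle S S' X ◁ (dKleisli S).map ((cpsModel Op).handle S S' X) ≫
          (cpsModel Op).handle S S' X := by
  let D := dTy S' X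
  let Δ := [dTy S (dTy S D), hTy S D]
  have hh : HasType Δ (.var 1) (hTy S D) := .var rfl
  have ht : HasType Δ (.var 0) (dTy S (dTy S D)) := .var rfl
  obtain ⟨n, hn⟩ := Sends.exists_sends (Γ := Ty.prod (hTy S D) (dTy S D) :: Δ) (s := .var 0)
    ((cpsModel Op).handle S S' X) (.var rfl)
  have h_pair : Sends (dTy S D :: Δ) ((cpsModel Op).handle S S' X) (.pair (.var 2) (.var 0))
      (dRun (.var 0) D (.lam D (.var 0)) (.var 2)) := sends_handle (.var rfl) (.var rfl)
  have h_str := sends_str (S := S) hh ht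
  have h_run : SysF.BEq Δ
      (dRun (dLet S (dTy S D) D (.var 0) (.var 0)) D (.lam D (.var 0)) (.var 1))
      (dRun (.var 0) D (.lam (dTy S D) (dRun (.var 0) D (.lam D (.var 0)) (.var 2))) (.var 1))
      D := by
    have e := SysF.BEq.dRun_dLet ht (Y := D) (B := D) (s := .var 0) (k := .lam D (.var 0))
      (.var rfl) (.lam (.var rfl)) hh
    rwa [lam_wk] at e
  exact Sends.hom_ext₂
    (.comp (.whiskerLeft hh (sends_mu ht)) (sends_handle hh (.dLet ht (.var rfl))))
    (.comp (.lift (.fst hh ht) h_str) (.comp (.whiskerLeft hh (sends_map h_str.right hn))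
      (sends_handle hh (.dLet h_str.right (.dRet S hn.right)))))
    (h_run.trans (hn.dRun_dLet_dLet h_pair ht hh).symm)

theorem cpsModel_handle_op (S S' : Sig Op (Ty 0)) (X : Ty 0) (o : {o // o ∈ S.dom}) :
    (cpsModel Op).bundle S S' X ◁ (cpsModel Op).mixedOp S S' X o ≫ (cpsModel Op).handle S S' X =
      (cpsModel Op).clause S S' X o ▷ (S.arg o ⊗ (cpsModel Op).exp S' (S.res o) X) ≫
        (cpsModel Op).ev S' (S.arg o ⊗ (cpsModel Op).exp S' (S.res o) X) X := by
  let D := dTy S' X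
  let Δ := [Ty.arr (S.res o) D, S.arg o, hTy S D]
  have hk : HasType Δ (.var 0) (.arr (S.res o) D) := .var rfl
  have ha : HasType Δ (.var 1) (S.arg o) := .var rfl
  have hh : HasType Δ (.var 2) (hTy S D) := .var rfl
  have ho := HasType.dOp o ha
  obtain ⟨n, hn⟩ := Sends.exists_sends (Γ := .prod (.arr (S.res o) D) (S.res o) :: Δ)
    (s := .var 0) ((cpsModel Op).ev S' (S.res o) X) (.var rfl)
  have h_pair : Sends (S.res o :: Δ) ((cpsModel Op).ev S' (S.res o) X)
      (.pair (.var 1) (.var 0)) (.app (.var 1) (.var 0)) := sends_ev (.var rfl) (.var rfl)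
  have h_str := sends_str (S := S) hk ho
  have h_proj := Sends.listProj (S.mem_ops o) hh
  exact Sends.hom_ext_right₃
    (.comp (.whiskerLeft hh (.comp (.whiskerRight (sends_opr o ha) hk)
      (.comp (.lift (.snd ho hk) (.fst ho hk)) (.comp h_str (sends_map h_str.right hn)))))
      (sends_handle hh (.dLet h_str.right (.dRet S hn.right))))
    (.comp (.whiskerRight h_proj (.pair ha hk)) (sends_ev h_proj.right (.pair ha hk)))
    ((hn.dRun_dLet_dLet h_pair ho hh).trans
      (.trans (.dRun (.refl ho) (SysF.BEq.lam_eta hk).symm (.refl hh))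
        (.dRun_dOp o ha hk hh)))

theorem cpsModel_isModel : (cpsModel Op).IsModel where
  strong := dKleisli_isStrongKleisliTriple
  curry_ev _ := cpsModel_curry_ev
  curry_uncurry _ := cpsModel_curry_uncurry
  handle_unit := cpsModel_handle_unit
  handle_mult := cpsModel_handle_mult
  handle_op := cpsModel_handle_op

end LamEff

namespace LamEff

open SysF

variable {Op : Type u} {Γ Δ : Ctx Op} {A B : VTy Op} {C : CTy Op} {S : Sig Op (VTy Op)}

/-! ### Reduction implies derivable equality -/

theorem ECtx.plug_congr {D : CTy Op} {M N : Comp Γ D} (h : CEq M N) :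
    {C : CTy Op} → (E : ECtx Γ D C) → CEq (E.plug M) (E.plug N)
  | _, .hole => h
  | _, .letIn E N => .letIn (E.plug_congr h) (.refl N)
  | _, .handle E H N => .handle (E.plug_congr h) (fun o => .refl (H o)) (.refl N)

theorem ECtx.HandleFree.plug_eq_letIn {X : VTy Op} (M : Comp Γ ⟨X, S⟩) :
    {A : VTy Op} → {E : ECtx Γ ⟨X, S⟩ ⟨A, S⟩} → E.HandleFree →
    CEq (E.plug M) (.letIn M ((E.ren Ren.wk).plug (.ret (.var .zero))))
  | _, .hole, _ => (CEq.let_ret M).symm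
  | _, .letIn E N, h =>
    (CEq.letIn (ECtx.HandleFree.plug_eq_letIn M (E := E) h) (.refl N)).trans (.let_let M _ N)
  | _, .handle _ _ _, h => h.elim

theorem Red.ceq {M N : Comp [] C} (h : Red M N) : CEq M N := by
  induction h with
  | ctx E _ ih => exact E.plug_congr ih
  | ret_let V M => exact .ret_let V M
  | lam_beta M V => exact .lam_beta M V
  | handle_ret V H M => exact .handle_ret V H M
  | handle_op o E hE V H M =>
    exact (CEq.handle (hE.plug_eq_letIn (.op o V)) (fun o => .refl (H o)) (.refl M)).trans
      ((CEq.handle_let _ _ H M).trans (.handle_op o V H _))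

end LamEff

namespace SysF

/-! ### Abstraction over a pair -/

/-- The term `λ⟨x, k⟩. t`, as it appears in the transform of a handler clause. -/
def lamPair (A B : Ty 0) (t : Tm 0) : Tm 0 := .lam (.prod A B) (t.subst Ty.var unpair)

variable {Γ : List (Ty 0)} {A B C : Ty 0} {t t' s r : Tm 0}

theorem isSubst_unpair (Γ : List (Ty 0)) (A B : Ty 0) :
    IsSubst (B :: A :: Γ) (.prod A B :: Γ) unpair :=
  forall_getElem?_cons (.snd (A := A) (.var rfl))
    (forall_getElem?_cons (.fst (B := B) (.var rfl)) fun _ _ h => .var h)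

theorem HasType.lamPair (h : HasType (B :: A :: Γ) t C) :
    HasType Γ (lamPair A B t) (.arr (.prod A B) C) :=
  .lam (h.subst₀ (isSubst_unpair Γ A B))

protected theorem BEq.lamPair (h : BEq (B :: A :: Γ) t t' C) :
    BEq Γ (lamPair A B t) (lamPair A B t') (.arr (.prod A B) C) :=
  .lam (h.subst₀ h.hasType.1 (isSubst_unpair Γ A B)
    fun i D hD => .refl (isSubst_unpair Γ A B i D hD))

theorem BEq.lamPair_beta (ht : HasType (B :: A :: Γ) t C) (hs : HasType Γ s A)
    (hr : HasType Γ r B) :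
    BEq Γ (.app (SysF.lamPair A B t) (.pair s r)) (t.subst Ty.var (scons r (scons s Tm.var)))
      C := by
  refine (BEq.lam_beta (ht.subst₀ (isSubst_unpair Γ A B)) (.pair hs hr)).trans ?_
  rw [Tm.inst_eq_subst, Tm.subst_subst]
  exact (BEq.refl ht).subst₀ ht ((IsSubst.id Γ).scons hs |>.scons hr)
    (forall_getElem?_cons (.snd_beta hs hr)
      (forall_getElem?_cons (.fst_beta hs hr) fun _ _ h => .refl (.var h)))

theorem lamPair_subst (A B : Ty 0) (t : Tm 0) (σ : ℕ → Tm 0) :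
    (lamPair A B t).subst Ty.var σ = lamPair A B (t.subst Ty.var (upS (upS σ))) := by
  simp only [lamPair, Tm.subst, Ty.subst_var, Tm.subst_subst]
  congr 2
  funext i
  match i with
  | 0 => rfl
  | 1 => rfl
  | i + 2 =>
    simp only [upS, Tm.wk_subst, unpair, Tm.subst]
    exact Tm.wk_eq_subst (σ i)

end SysF

namespace LamEff

open SysF

variable {Op : Type u} {Γ Δ : Ctx Op} {A B : VTy Op} {C : CTy Op} {S : Sig Op (VTy Op)}
  {ρ : Ren Γ Δ} {σ : ℕ → Tm 0}

/-! ### The CPS transformation and substitution -/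

/-- `σ` acts on the System F variables of `Γ` as `ρ` does on those of the source. -/
def Ren.Realizes (ρ : Ren Γ Δ) (σ : ℕ → Tm 0) : Prop :=
  ∀ A (x : Var Γ A), Tm.var (ρ A x).idx = σ x.idx

theorem Ren.Realizes.lift (h : ρ.Realizes σ) : (ρ.lift (B := B)).Realizes (upS σ)
  | _, .zero => rfl
  | _, .succ x => congrArg Tm.wk (h _ x)

theorem Ren.wk_realizes (Γ : Ctx Op) (B : VTy Op) :
    (Ren.wk (Γ := Γ) (B := B)).Realizes fun i => .var (i + 1) :=
  fun _ _ => rfl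

variable [DecidableEq Op]

theorem Comp.cps_letIn (M : Comp Γ ⟨A, S⟩) (N : Comp (A :: Γ) ⟨B, S⟩) :
    (Comp.letIn M N).cps = dLet S.cps A.cps B.cps M.cps N.cps := by
  rw [Comp.cps]; rfl

theorem Comp.cps_handle (M : Comp Γ ⟨A, S⟩) (H : Handler Γ S C) (N : Comp (A :: Γ) C) :
    (Comp.handle M H N).cps = dRun M.cps C.cps (.lam A.cps N.cps) (Handler.cps H) := by
  rw [Comp.cps]; rfl

theorem Handler.cps_eq_listTuple (H : Handler Γ S C) :
    Handler.cps H = Tm.listTuple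
      (fun o : {o // o ∈ S.dom} => lamPair (S.arg o).cps (.arr (S.res o).cps C.cps) (H o).cps)
      S.cps.ops := rfl

theorem Handler.cps_eq_subst {H : Handler Γ S C} {H' : Handler Δ S C}
    (h : ∀ o, (H' o).cps = (H o).cps.subst Ty.var (upS (upS σ))) :
    Handler.cps H' = (Handler.cps H).subst Ty.var σ := by
  rw [Handler.cps_eq_listTuple, Handler.cps_eq_listTuple]
  refine .trans (congrArg (Tm.listTuple · _) (funext fun o => ?_)) (Tm.listTuple_subst _ _ _ _).symm
  rw [h, lamPair_subst]

mutual
theorem Val.cps_ren : {Γ Δ : Ctx Op} → {A : VTy Op} → (V : Val Γ A) → {ρ : Ren Γ Δ} →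
    {σ : ℕ → Tm 0} → ρ.Realizes σ → (V.ren ρ).cps = V.cps.subst Ty.var σ
  | _, _, _, .var x, _, _, h => h _ x
  | _, _, _, .lam M, _, _, h => by
    simp only [Val.ren, Val.cps, Tm.subst, Ty.subst_var, Comp.cps_ren M h.lift]
  | _, _, _, .tuple V, _, _, h => by
    simp only [Val.ren, Val.cps, Tm.listTuple_subst]
    exact congrArg (Tm.listTuple · _) (funext fun i => Val.cps_ren (V i) h)
  | _, _, _, .proj (A := _) V i, _, _, h => by
    simp only [Val.ren, Val.cps, Tm.listProj_subst, Val.cps_ren V h]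
theorem Comp.cps_ren : {Γ Δ : Ctx Op} → {C : CTy Op} → (M : Comp Γ C) → {ρ : Ren Γ Δ} →
    {σ : ℕ → Tm 0} → ρ.Realizes σ → (M.ren ρ).cps = M.cps.subst Ty.var σ
  | _, _, _, .app V W, _, _, h => by
    simp only [Comp.ren, Comp.cps, Tm.subst, Val.cps_ren V h, Val.cps_ren W h]
  | _, _, _, .ret V, _, _, h => by
    simp only [Comp.ren, Comp.cps, dRet_subst_var, Val.cps_ren V h]
  | _, _, _, .letIn M N, _, _, h => by
    simp only [Comp.ren, Comp.cps_letIn, dLet_subst_var, Comp.cps_ren M h, Comp.cps_ren N h.lift]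
  | _, _, _, .op (S := S) o V, _, _, h => by
    simp only [Comp.ren, Comp.cps, Val.cps_ren V h]
    exact (dOp_subst_var S.cps _ _ o).symm
  | _, _, _, .handle M H N, _, _, h => by
    have hH := Handler.cps_eq_subst (H := H) fun o => Comp.cps_ren (H o) h.lift.lift
    simp only [Comp.ren, Comp.cps_handle, dRun_subst, Tm.subst, Ty.subst_var, Comp.cps_ren M h,
      Comp.cps_ren N h.lift, hH]
end

theorem Val.cps_wk (V : Val Γ A) : (V.ren (Ren.wk (B := B))).cps = V.cps.wk := by
  rw [V.cps_ren (Ren.wk_realizes Γ B), Tm.wk_eq_subst]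

theorem Comp.cps_wkUp (M : Comp (A :: Γ) C) :
    (M.ren (Ren.wk (B := B)).lift).cps = M.cps.wkUp := by
  rw [M.cps_ren (Ren.wk_realizes Γ B).lift, Tm.wkUp, Tm.ren_eq]
  congr 1
  funext i
  cases i <;> rfl

theorem Handler.cps_wk (H : Handler Γ S C) :
    (Handler.cps fun o => (H o).ren (Ren.wk (B := B)).lift.lift) = (Handler.cps H).wk := by
  rw [Tm.wk_eq_subst]
  exact Handler.cps_eq_subst fun o => (H o).cps_ren (Ren.wk_realizes Γ B).lift.lift

/-- `σ` substitutes the CPS transforms of the value terms that `τ` substitutes. -/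
def Subst.Realizes (τ : Subst Γ Δ) (σ : ℕ → Tm 0) : Prop :=
  ∀ A (x : Var Γ A), (τ A x).cps = σ x.idx

theorem Subst.Realizes.lift {τ : Subst Γ Δ} (h : τ.Realizes σ) :
    (τ.lift (B := B)).Realizes (upS σ)
  | _, .zero => rfl
  | _, .succ x => (Val.cps_wk _).trans (congrArg Tm.wk (h _ x))

mutual
theorem Val.cps_subst : {Γ Δ : Ctx Op} → {A : VTy Op} → (V : Val Γ A) → {τ : Subst Γ Δ} →
    {σ : ℕ → Tm 0} → τ.Realizes σ → (V.subst τ).cps = V.cps.subst Ty.var σ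
  | _, _, _, .var x, _, _, h => h _ x
  | _, _, _, .lam M, _, _, h => by
    simp only [Val.subst, Val.cps, Tm.subst, Ty.subst_var, Comp.cps_subst M h.lift]
  | _, _, _, .tuple V, _, _, h => by
    simp only [Val.subst, Val.cps, Tm.listTuple_subst]
    exact congrArg (Tm.listTuple · _) (funext fun i => Val.cps_subst (V i) h)
  | _, _, _, .proj (A := _) V i, _, _, h => by
    simp only [Val.subst, Val.cps, Tm.listProj_subst, Val.cps_subst V h]
theorem Comp.cps_subst : {Γ Δ : Ctx Op} → {C : CTy Op} → (M : Comp Γ C) → {τ : Subst Γ Δ} →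
    {σ : ℕ → Tm 0} → τ.Realizes σ → (M.subst τ).cps = M.cps.subst Ty.var σ
  | _, _, _, .app V W, _, _, h => by
    simp only [Comp.subst, Comp.cps, Tm.subst, Val.cps_subst V h, Val.cps_subst W h]
  | _, _, _, .ret V, _, _, h => by
    simp only [Comp.subst, Comp.cps, dRet_subst_var, Val.cps_subst V h]
  | _, _, _, .letIn M N, _, _, h => by
    simp only [Comp.subst, Comp.cps_letIn, dLet_subst_var, Comp.cps_subst M h,
      Comp.cps_subst N h.lift]
  | _, _, _, .op (S := S) o V, _, _, h => by
    simp only [Comp.subst, Comp.cps, Val.cps_subst V h]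
    exact (dOp_subst_var S.cps _ _ o).symm
  | _, _, _, .handle M H N, _, _, h => by
    have hH := Handler.cps_eq_subst (H := H) fun o => Comp.cps_subst (H o) h.lift.lift
    simp only [Comp.subst, Comp.cps_handle, dRun_subst, Tm.subst, Ty.subst_var,
      Comp.cps_subst M h, Comp.cps_subst N h.lift, hH]
end

theorem Comp.cps_subst_one (M : Comp (A :: Γ) C) (V : Val Γ A) :
    (M.subst (Subst.one V)).cps = M.cps.inst V.cps := by
  rw [Tm.inst_eq_subst]
  refine M.cps_subst fun B x => ?_
  cases x <;> rfl

theorem Comp.cps_subst_two (M : Comp (B :: A :: Γ) C) (V : Val Γ A) (W : Val Γ B) :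
    (M.subst (Subst.two V W)).cps =
      M.cps.subst Ty.var (scons W.cps (scons V.cps Tm.var)) := by
  refine M.cps_subst fun D x => ?_
  cases x with
  | zero => rfl
  | succ x => cases x <;> rfl

/-! ### Soundness of the CPS transformation -/

theorem Comp.cps_handle_op_beq (o : {o // o ∈ S.dom}) (V : Val Γ (S.arg o)) (H : Handler Γ S C)
    (M : Comp (S.res o :: Γ) C) :
    SysF.BEq (Ctx.cps Γ) (Comp.handle (.op o V) H M).cps
      ((H o).subst (.two V (.lam M))).cps C.cps := by
  have hk := HasType.lam M.cps_hasType
  have h_clause : SysF.BEq (Ctx.cps Γ) (Tm.listProj S.cps.ops o (Handler.cps H))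
      (lamPair (S.arg o).cps (.arr (S.res o).cps C.cps) (H o).cps) _ :=
    .listProj_listTuple
      (A := fun o : {o // o ∈ S.dom} => .arr (.prod (S.arg o).cps (.arr (S.res o).cps C.cps)) C.cps)
      (fun o => .lamPair (H o).cps_hasType) (S.cps.mem_ops o)
  rw [Comp.cps_subst_two, Comp.cps_handle]
  exact (BEq.dRun_dOp (S := S.cps) o V.cps_hasType hk (Handler.cps_hasType H)).trans
    ((BEq.app h_clause (.refl (.pair V.cps_hasType hk))).trans
      (.lamPair_beta (H o).cps_hasType V.cps_hasType hk))

mutual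
theorem VEq.cps_beq : {Γ : Ctx Op} → {A : VTy Op} → {V W : Val Γ A} → VEq V W →
    SysF.BEq (Ctx.cps Γ) V.cps W.cps A.cps
  | _, _, _, _, .refl V => .refl V.cps_hasType
  | _, _, _, _, .symm h => (VEq.cps_beq h).symm
  | _, _, _, _, .trans h₁ h₂ => (VEq.cps_beq h₁).trans (VEq.cps_beq h₂)
  | _, _, _, _, .lam h => .lam (CEq.cps_beq h)
  | _, _, _, _, .tuple h => .listTuple fun i _ => VEq.cps_beq (h i)
  | _, _, _, _, .proj (A := A) i h =>
    .listProj (A := fun i => (A i).cps) (List.mem_finRange i) (VEq.cps_beq h)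
  | _, _, _, _, .lam_eta V => by
    simp only [Val.cps, Comp.cps, V.cps_wk]
    exact .lam_eta V.cps_hasType
  | _, _, _, _, .prod_beta (A := A) V i =>
    .listProj_listTuple (A := fun i => (A i).cps) (fun i => (V i).cps_hasType)
      (List.mem_finRange i)
  | _, _, _, _, .prod_eta (n := n) V =>
    (BEq.listTuple_listProj (List.nodup_finRange n) V.cps_hasType).symm
theorem CEq.cps_beq : {Γ : Ctx Op} → {C : CTy Op} → {M N : Comp Γ C} → CEq M N →
    SysF.BEq (Ctx.cps Γ) M.cps N.cps C.cps
  | _, _, _, _, .refl M => .refl M.cps_hasType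
  | _, _, _, _, .symm h => (CEq.cps_beq h).symm
  | _, _, _, _, .trans h₁ h₂ => (CEq.cps_beq h₁).trans (CEq.cps_beq h₂)
  | _, _, _, _, .app h₁ h₂ => .app (VEq.cps_beq h₁) (VEq.cps_beq h₂)
  | _, _, _, _, .ret h => .dRet _ (VEq.cps_beq h)
  | _, _, _, _, .letIn h₁ h₂ => .dLet (CEq.cps_beq h₁) (CEq.cps_beq h₂)
  | _, _, _, _, .op (S := S) o h => .dOp (S := S.cps) o (VEq.cps_beq h)
  | _, _, _, _, .handle h₁ h₂ h₃ =>
    .dRun (CEq.cps_beq h₁) (.lam (CEq.cps_beq h₃))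
      (.listTuple fun o _ => .lamPair (CEq.cps_beq (h₂ o)))
  | _, _, _, _, .lam_beta M V => by
    rw [M.cps_subst_one]
    exact .lam_beta M.cps_hasType V.cps_hasType
  | _, _, _, _, .ret_let V M => by
    rw [M.cps_subst_one]
    exact .dLet_dRet_left V.cps_hasType M.cps_hasType
  | _, _, _, _, .let_ret M => .dLet_dRet_right M.cps_hasType
  | _, _, _, _, .let_let M N L => by
    simp only [Comp.cps_letIn, L.cps_wkUp]
    exact .dLet_assoc M.cps_hasType N.cps_hasType L.cps_hasType
  | _, _, _, _, .handle_ret V H M => by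
    rw [M.cps_subst_one, Comp.cps_handle]
    exact (BEq.dRun_dRet V.cps_hasType (.lam M.cps_hasType) (Handler.cps_hasType H)).trans
      (.lam_beta M.cps_hasType V.cps_hasType)
  | _, _, _, _, .handle_let L M H N => by
    have run := BEq.dRun_dLet L.cps_hasType M.cps_hasType (.lam N.cps_hasType)
      (Handler.cps_hasType H)
    simp only [Comp.cps_handle, Comp.cps_letIn, N.cps_wkUp, Handler.cps_wk]
    rwa [lam_wk] at run
  | _, _, _, _, .handle_op o V H M => Comp.cps_handle_op_beq o V H M
end

theorem HEqv.cps_beq {H H' : Handler Γ S C} (h : HEqv H H') :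
    SysF.BEq (Ctx.cps Γ) (Handler.cps H) (Handler.cps H') (hTy S.cps C.cps) :=
  .listTuple fun o _ => .lamPair (CEq.cps_beq (h o))

end LamEff

namespace SysF

/-! ### The tuple of the variables of a context -/

variable {m : ℕ}

/-- The tuple of the variables of `Γ`. Since `⟦Γ⟧` is a product, it is on this term that the
interpretation of a term in context `Γ` is evaluated. -/
def ctxTuple : List (Ty m) → Tm m
  | [] => .star
  | _ :: Γ => .pair (ctxTuple Γ).wk (.var 0)

theorem hasType_ctxTuple : (Γ : List (Ty m)) → HasType Γ (ctxTuple Γ) (ctxTy Γ)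
  | [] => .star
  | A :: Γ => .pair ((hasType_ctxTuple Γ).wk A) (.var rfl)

theorem ctxTuple_subst_ctxProj {Δ : List (Ty m)} : (Γ : List (Ty m)) → {t : Tm m} →
    HasType Δ t (ctxTy Γ) →
    BEq Δ ((ctxTuple Γ).subst Ty.var fun i => ctxProj i t) t (ctxTy Γ)
  | [], _, h => (BEq.unit_eta h).symm
  | A :: Γ, t, h => by
    change BEq Δ (.pair ((ctxTuple Γ).wk.subst _ _) (.snd t)) t (.prod (ctxTy Γ) A)
    rw [Tm.wk_subst]
    exact (BEq.pair (ctxTuple_subst_ctxProj Γ (.fst h)) (.refl (.snd h))).trans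
      (BEq.pair_eta h).symm

theorem Sends.eq_cls {Γ : List (Ty m)} {A B B' : Ty m} {f : A ⟶ B'} {t : Tm m}
    (hA : A = ctxTy Γ) (hB : B' = B) (h : Sends Γ f (ctxTuple Γ) t) (ht : HasType Γ t B) :
    f = eqToHom hA ≫ cls t ht ≫ eqToHom hB.symm := by
  subst hA hB
  rw [eqToHom_refl, eqToHom_refl, Category.comp_id, Category.id_comp]
  have hv : HasType [ctxTy Γ] (.var 0) (ctxTy Γ) := .var rfl
  have ht' := ht.subst₀ (IsSubst.ctxProj hv)
  exact Sends.hom_ext₁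
    ((h.subst (IsSubst.ctxProj hv)).conv_left (ctxTuple_subst_ctxProj Γ hv))
    (Sends.of_mk ht' hv (.refl (ht'.subst₁ hv))) ht'.subst₁_var.symm

end SysF

namespace LamEff

open SysF

variable {Op : Type u} [DecidableEq Op]

/-! ### The interpretation in the CPS model -/

section

variable {Γ : List (Ty 0)} {S S' : Sig Op (Ty 0)} {P A K X Y Z : Ty 0} {s t n h : Tm 0}

theorem sends_curry_assoc {f : (P ⊗ A) ⊗ K ⟶ dTy S Z} (hs : HasType Γ s P)
    (hf : Sends (K :: A :: Γ) f (.pair (.pair s.wk.wk (.var 1)) (.var 0)) n) :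
    Sends Γ ((cpsModel Op).curry S (X := P) (Y := A ⊗ K) (Z := Z) ((α_ P A K).inv ≫ f)) s
      (lamPair A K n) := by
  have hv : HasType (Ty.prod A K :: Γ) (.var 0) (.prod A K) := .var rfl
  have h_assoc : Sends (Ty.prod A K :: Γ) (α_ P A K).inv (.pair s.wk (.var 0))
      (.pair (.pair s.wk (.fst (.var 0))) (.snd (.var 0))) :=
    (Sends.associator_inv (hs.wk _) (.fst hv) (.snd hv)).conv_left
      (.pair (.refl (hs.wk _)) (SysF.BEq.pair_eta hv).symm)
  have e : (Tm.pair (.pair s.wk.wk (.var 1)) (.var 0)).subst Ty.var unpair =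
      .pair (.pair s.wk (.fst (.var 0))) (.snd (.var 0)) := by
    simp only [Tm.subst, Tm.wk_subst, unpair]
    rw [Tm.wk_eq_subst]
  have h_unpair := hf.subst (isSubst_unpair Γ A K)
  rw [e] at h_unpair
  exact sends_curry hs (h_assoc.comp h_unpair)

theorem sends_handleWith {H : P ⟶ hTy S (dTy S' Y)} {M : P ⟶ dTy S X} {f : P ⊗ X ⟶ dTy S' Y}
    (hH : Sends Γ H s h) (hM : Sends Γ M s t) (hf : Sends (X :: Γ) f (.pair s.wk (.var 0)) n) :
    Sends Γ
      (lift H (lift (𝟙 P) M ≫ (dKleisli S).str P X ≫ (dKleisli S).map f) ≫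
        (cpsModel Op).handle S S' Y)
      s (dRun t (dTy S' Y) (.lam X n) h) := by
  obtain ⟨r, hr⟩ := Sends.exists_sends (Γ := Ty.prod P X :: Γ) (s := .var 0) f (.var rfl)
  have h_str := sends_str (S := S) hM.left hM.right
  have h_map := (Sends.id hM.left).lift hM |>.comp (h_str.comp (sends_map h_str.right hr))
  exact ((hH.lift h_map).comp (sends_handle hH.right h_map.right)).conv
    (hr.dRun_dLet_dLet hf hM.right hH.right)

end

theorem cpsModel_ty_eq : (cpsModel Op).ty = VTy.cps := funext cpsModel_ty

/-- The types of a context, as interpreted in the CPS model. They are only propositionally equal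
to the types in `Γ.cps`, and stating the lemmas below for the former avoids transports. -/
noncomputable def Ctx.tys (Γ : Ctx Op) : List (Ty 0) := Γ.map (cpsModel Op).ty

theorem Ctx.tys_eq (Γ : Ctx Op) : Γ.tys = Γ.cps := by
  rw [Ctx.tys, cpsModel_ty_eq, Ctx.cps]

theorem cpsModel_ctx_eq : (Γ : Ctx Op) → (cpsModel Op).ctx Γ = ctxTy Γ.tys
  | [] => rfl
  | A :: Γ => congrArg (Ty.prod · ((cpsModel Op).ty A)) (cpsModel_ctx_eq Γ)

theorem hasType_ctxTuple_tys (Γ : Ctx Op) :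
    HasType Γ.tys (ctxTuple Γ.tys) ((cpsModel Op).ctx Γ) :=
  cpsModel_ctx_eq Γ ▸ hasType_ctxTuple Γ.tys

theorem sends_var : {Γ : Ctx Op} → {A : VTy Op} → (x : Var Γ A) →
    Sends Γ.tys ((cpsModel Op).var x) (ctxTuple Γ.tys) (.var x.idx)
  | _ :: Γ, _, .zero => .snd ((hasType_ctxTuple_tys Γ).wk _) (.var rfl)
  | _ :: Γ, _, .succ x =>
    .comp (.fst ((hasType_ctxTuple_tys Γ).wk _) (.var rfl)) (sends_var x).wk

theorem sends_handler {Γ : Ctx Op} {S : Sig Op (VTy Op)} {C : CTy Op} {H : Handler Γ S C}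
    (h : ∀ o, Sends (Ctx.tys ((S.res o).arr C :: S.arg o :: Γ)) ((cpsModel Op).comp (H o))
      (ctxTuple (Ctx.tys ((S.res o).arr C :: S.arg o :: Γ))) (H o).cps) :
    Sends Γ.tys ((cpsModel Op).handler H) (ctxTuple Γ.tys) (Handler.cps H) := by
  refine .listTuple (hasType_ctxTuple_tys Γ) (fun o => ?_) _
  have h_clause := sends_curry_assoc (Op := Op) (hasType_ctxTuple_tys Γ) (h o)
  have e : lamPair ((cpsModel Op).ty (S.arg o)) ((cpsModel Op).ty ((S.res o).arr C)) (H o).cps =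
      lamPair (S.arg o).cps (.arr (S.res o).cps C.cps) (H o).cps := by
    rw [cpsModel_ty, cpsModel_ty]
    rfl
  rw [e] at h_clause
  exact h_clause

mutual
theorem sends_val : {Γ : Ctx Op} → {A : VTy Op} → (V : Val Γ A) →
    Sends Γ.tys ((cpsModel Op).val V) (ctxTuple Γ.tys) V.cps
  | _, _, .var x => sends_var x
  | Γ, _, .lam (A := A) M => by
    rw [Val.cps, ← cpsModel_ty A]
    exact sends_curry (hasType_ctxTuple_tys Γ) (sends_comp M)
  | Γ, _, .tuple V => .listTuple (hasType_ctxTuple_tys Γ) (fun i => sends_val (V i)) _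
  | _, _, .proj (A := _) V i => .comp (sends_val V) (.listProj _ (sends_val V).right)
theorem sends_comp : {Γ : Ctx Op} → {C : CTy Op} → (M : Comp Γ C) →
    Sends Γ.tys ((cpsModel Op).comp M) (ctxTuple Γ.tys) M.cps
  | _, _, .app V W =>
    .comp (.lift (sends_val V) (sends_val W)) (sends_ev (sends_val V).right (sends_val W).right)
  | _, _, .ret (A := A) (S := S) V => by
    rw [Comp.cps, ← cpsModel_sig S, ← cpsModel_ty A]
    exact .comp (sends_val V) (sends_unit _ (sends_val V).right)
  | Γ, _, .letIn (A := A) (B := B) (S := S) M N => by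
    rw [Comp.cps_letIn, ← cpsModel_sig S, ← cpsModel_ty A, ← cpsModel_ty B]
    exact .comp (.lift (.id (hasType_ctxTuple_tys Γ)) (sends_comp M))
      (sends_ext (hasType_ctxTuple_tys Γ) (sends_comp M).right (sends_comp N))
  | _, _, .op (S := S) o V => by
    have h := Sends.comp (sends_val V)
      (sends_opr (S := (cpsModel Op).sig S) o (sends_val V).right)
    have e : dOp ((cpsModel Op).sig S) o V.cps = dOp S.cps o V.cps := by
      change dOp (S.map (cpsModel Op).ty) o V.cps = dOp (S.map VTy.cps) o V.cps
      rw [cpsModel_ty_eq]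
    rw [e] at h
    exact h
  | Γ, _, .handle (A := A) (S := S) (C := C) M H N => by
    rw [Comp.cps_handle, ← cpsModel_cty C, ← cpsModel_ty A]
    exact sends_handleWith (S := (cpsModel Op).sig S) (S' := (cpsModel Op).sig C.sig)
      (Y := (cpsModel Op).ty C.ret) (sends_handler fun o => sends_comp (H o)) (sends_comp M)
      (sends_comp N)
end

theorem cpsModel_val {Γ : Ctx Op} {A : VTy Op} (V : Val Γ A) :
    (cpsModel Op).val V = eqToHom (cpsModel_ctx Γ) ≫
      cls V.cps V.cps_hasType ≫ eqToHom (cpsModel_ty A).symm :=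
  Sends.eq_cls _ (cpsModel_ty A) (Γ.tys_eq ▸ sends_val V) _

theorem cpsModel_comp {Γ : Ctx Op} {C : CTy Op} (M : Comp Γ C) :
    (cpsModel Op).comp M = eqToHom (cpsModel_ctx Γ) ≫
      cls M.cps M.cps_hasType ≫ eqToHom (cpsModel_cty C).symm :=
  Sends.eq_cls _ (cpsModel_cty C) (Γ.tys_eq ▸ sends_comp M) _

theorem cpsModel_handler {Γ : Ctx Op} {S : Sig Op (VTy Op)} {C : CTy Op} (H : Handler Γ S C) :
    (cpsModel Op).handler H = eqToHom (cpsModel_ctx Γ) ≫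
      cls (Handler.cps H) (Handler.cps_hasType H) ≫ eqToHom (cpsModel_bundle S C).symm :=
  Sends.eq_cls _ (cpsModel_bundle S C) (Γ.tys_eq ▸ sends_handler fun o => sends_comp (H o)) _

end LamEff

theorem mainTheorem6 {Op : Type u} [DecidableEq Op] :
    (cpsModel Op).IsModel ∧
    (∀ (Γ : Ctx Op) (A : VTy Op) (V : Val Γ A),
      (cpsModel Op).val V = eqToHom (cpsModel_ctx Γ) ≫
        SysF.cls V.cps V.cps_hasType ≫ eqToHom (cpsModel_ty A).symm) ∧
    (∀ (Γ : Ctx Op) (C : CTy Op) (M : Comp Γ C),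
      (cpsModel Op).comp M = eqToHom (cpsModel_ctx Γ) ≫
        SysF.cls M.cps M.cps_hasType ≫ eqToHom (cpsModel_cty C).symm) ∧
    (∀ (Γ : Ctx Op) (S : Sig Op (VTy Op)) (C : CTy Op) (H : Handler Γ S C),
      (cpsModel Op).handler H = eqToHom (cpsModel_ctx Γ) ≫
        SysF.cls (Handler.cps H) (Handler.cps_hasType H) ≫
          eqToHom (cpsModel_bundle S C).symm) ∧
    (∀ (Γ : Ctx Op) (A : VTy Op) (V W : Val Γ A), VEq V W →
      SysF.BEq (Ctx.cps Γ) V.cps W.cps A.cps) ∧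
    (∀ (Γ : Ctx Op) (C : CTy Op) (M N : Comp Γ C), CEq M N →
      SysF.BEq (Ctx.cps Γ) M.cps N.cps C.cps) ∧
    (∀ (Γ : Ctx Op) (S : Sig Op (VTy Op)) (C : CTy Op) (H H' : Handler Γ S C), HEqv H H' →
      SysF.BEq (Ctx.cps Γ) (Handler.cps H) (Handler.cps H') (SysF.hTy S.cps C.cps)) ∧
    (∀ (C : CTy Op) (M N : Comp [] C), Red M N → SysF.BEq [] M.cps N.cps C.cps) :=
  ⟨cpsModel_isModel, fun _ _ V => cpsModel_val V, fun _ _ M => cpsModel_comp M,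
    fun _ _ _ H => cpsModel_handler H, fun _ _ _ _ h => h.cps_beq, fun _ _ _ _ h => h.cps_beq,
    fun _ _ _ _ _ h => h.cps_beq, fun _ _ _ h => h.ceq.cps_beq⟩
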